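/- Let $G$ be a Carnot group of step $r$, that is, a simply connected (finite-dimensional, smooth) Lie group whose Lie algebra has a given decomposition $\mathfrak g=\mathfrak g_1\oplus\cdots\oplus\mathfrak g_r$ with $[\mathfrak g_1,\mathfrak g_k]=\mathfrak g_{k+1}$ for $1\le k\le r-1$ and $[\mathfrak g_1,\mathfrak g_r]=0$ (so that $\mathfrak g$ is nilpotent). Put $$\mathfrak p_1=\bigoplus_{k\text{ odd}}\mathfrak g_k,\qquad \mathfrak p_2=\bigoplus_{k\text{ even},\,k\le\lfloor r/2\rfloor}\mathfrak g_k,\qquad \mathfrak k=\bigoplus_{k\text{ even},\,k>\lfloor r/2\rfloor}\mathfrak g_k,$$ and let $D$ and $V$ be the subbundles of $TG$ obtained by left translation of $\mathfrak p_1\oplus\mathfrak p_2$ and $\mathfrak k$, respectively. (a) There exists a smooth Riemannian metric on $G$ for which $D$ and $V$ are orthogonal and the foliation tangent to $V$ is totally geodesic (that is, for the Levi-Civita connection $\nabla$ and all smooth sections $Y,Z$ of $V$, the vector field $\nabla_ZY$ is again a section of $V$) if and only if $[\mathfrak p_2,\mathfrak k]=0$. (b) Let $K$ be the connected subgroup of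 $G$ corresponding to $\mathfrak k$, that is, the subgroup generated by $\exp(\mathfrak k)$. Then $G/K$, with the quotient topology, is a Hausdorff smooth manifold for a structure making $\pi\colon G\to G/K$ a smooth submersion, $D$ is an Ehresmann connection on $\pi$ (i.e. $TG=D\oplus\ker\pi_*$), and $D$ can be made principal if and only if $[\mathfrak p_2,\mathfrak k]=0$. Here "$D$ can be made principal" means that there are a connected Lie group $L$ and a smooth right action of $L$ on $G$ that makes $\pi$ a smooth principal $L$-bundle (the action preserves the fibers of $\pi$, is free and transitive on each of them, and $\pi$ has smooth $L$-equivariant local trivializations) and leaves $D$ invariant, i.e. the differential of $p\mapsto p\cdot a$ maps $D_p$ onto $D_{p\cdot a}$ for all $p\in G$, $a\in L$. -/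

import Mathlib

open scoped Manifold ContDiff Topology

noncomputable section

namespace CarnotFoliation

section LieGroups

variable {E : Type*} [NormedAddCommGroup E] [NormedSpace ℝ E]
  {H : Type*} [TopologicalSpace H] (I : ModelWithCorners ℝ E H)
  (G : Type*) [TopologicalSpace G] [ChartedSpace H G] [Group G]

/-- The span `[𝔞, 𝔟]` of all brackets of elements of two subspaces of the Lie algebra of `G`. -/
def bracketSpan (𝔞 𝔟 : Submodule ℝ (GroupLieAlgebra I G)) :
    Submodule ℝ (GroupLieAlgebra I G) :=
  Submodule.span ℝ {z | ∃ x ∈ 𝔞, ∃ y ∈ 𝔟, ⁅x, y⁆ = z}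

/-- A Carnot grading `𝔤 = 𝔤₁ ⊕ ⋯ ⊕ 𝔤ᵣ` of the Lie algebra of `G`. The layers are indexed by `ℕ`;
those whose index is not in `{1, …, r}` are zero. -/
structure IsCarnotGrading (r : ℕ) (layer : ℕ → Submodule ℝ (GroupLieAlgebra I G)) : Prop where
  isInternal : DirectSum.IsInternal layer
  layer_zero : layer 0 = ⊥
  layer_of_lt : ∀ k, r < k → layer k = ⊥
  bracket_layer : ∀ k, 1 ≤ k → k < r → bracketSpan I G (layer 1) (layer k) = layer (k + 1)
  bracket_last : bracketSpan I G (layer 1) (layer r) = ⊥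

variable {I G}

/-- `𝔭₁`: the sum of the layers of odd index. -/
def oddPart (layer : ℕ → Submodule ℝ (GroupLieAlgebra I G)) :
    Submodule ℝ (GroupLieAlgebra I G) :=
  ⨆ k : ℕ, ⨆ _ : Odd k, layer k

/-- `𝔭₂`: the sum of the layers of even index at most `⌊r / 2⌋`. -/
def lowEvenPart (r : ℕ) (layer : ℕ → Submodule ℝ (GroupLieAlgebra I G)) :
    Submodule ℝ (GroupLieAlgebra I G) :=
  ⨆ k : ℕ, ⨆ _ : Even k ∧ k ≤ r / 2, layer k

/-- `𝔨`: the sum of the layers of even index greater than `⌊r / 2⌋`. -/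
def highEvenPart (r : ℕ) (layer : ℕ → Submodule ℝ (GroupLieAlgebra I G)) :
    Submodule ℝ (GroupLieAlgebra I G) :=
  ⨆ k : ℕ, ⨆ _ : Even k ∧ r / 2 < k, layer k

/-- The subbundle of `TG` obtained by left translation of a subspace of the Lie algebra. Its fibre
at `g` is the image of `𝔞` under the differential at `1` of `x ↦ g * x`. -/
def leftTranslate (𝔞 : Submodule ℝ (GroupLieAlgebra I G)) (g : G) :
    Submodule ℝ (TangentSpace I g) where
  carrier := {w | ∃ v ∈ 𝔞, mulInvariantVectorField v g = w}
  zero_mem' := ⟨0, 𝔞.zero_mem, by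
    have h := congrFun (mulInvariantVectorField_smul (I := I) (G := G) (0 : ℝ) 0) g
    simpa using! h⟩
  add_mem' := by
    rintro _ _ ⟨v, hv, rfl⟩ ⟨w, hw, rfl⟩
    exact ⟨v + w, 𝔞.add_mem hv hw, congrFun (mulInvariantVectorField_add v w) g⟩
  smul_mem' := by
    rintro c _ ⟨v, hv, rfl⟩
    exact ⟨c • v, 𝔞.smul_mem c hv, congrFun (mulInvariantVectorField_smul c v) g⟩

/-- The connected subgroup of `G` corresponding to a Lie subalgebra `𝔥`: the subgroup generated by
the elements `exp v = γ 1`, where `v ∈ 𝔥` and `γ` is the integral curve through `1` of the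
left-invariant vector field defined by `v`. -/
def connectedSubgroup (𝔥 : Submodule ℝ (GroupLieAlgebra I G)) : Subgroup G :=
  Subgroup.closure {x | ∃ v ∈ 𝔥, ∃ γ : ℝ → G,
    γ 0 = 1 ∧ IsMIntegralCurve γ (mulInvariantVectorField (I := I) v) ∧ γ 1 = x}

end LieGroups

section Riemannian

variable {E : Type*} [NormedAddCommGroup E] [NormedSpace ℝ E]
  {H : Type*} [TopologicalSpace H] {I : ModelWithCorners ℝ E H}
  {M : Type*} [TopologicalSpace M] [ChartedSpace H M] [IsManifold I ∞ M]

/-- `cov` is the Levi-Civita connection of the Riemannian metric `g`: it is torsion free and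
`g` is parallel. (`cov Y x v` is the covariant derivative of `Y` at `x` in the direction `v`.) -/
structure IsLeviCivita
    (g : Bundle.ContMDiffRiemannianMetric I ∞ E (fun x : M ↦ TangentSpace I x))
    (cov : CovariantDerivative I E (fun x : M ↦ TangentSpace I x)) : Prop where
  torsion_free : ∀ (X Y : Π x : M, TangentSpace I x) (x : M),
    MDiffAt (T% X) x → MDiffAt (T% Y) x →
      cov Y x (X x) - cov X x (Y x) = VectorField.mlieBracket I X Y x
  metric : ∀ (Y Z : Π x : M, TangentSpace I x) (x : M) (v : TangentSpace I x),
    MDiffAt (T% Y) x → MDiffAt (T% Z) x →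
      d% (fun y ↦ g.inner y (Y y) (Z y)) x v =
        g.inner x (cov Y x v) (Z x) + g.inner x (Y x) (cov Z x v)

/-- The foliation tangent to the subbundle `V` is totally geodesic for the metric `g`: the second
fundamental form of the leaves vanishes, that is, the Levi-Civita derivative `∇_Z Y` of smooth
sections `Y`, `Z` of `V` is again tangent to `V`. -/
def IsTotallyGeodesic
    (g : Bundle.ContMDiffRiemannianMetric I ∞ E (fun x : M ↦ TangentSpace I x))
    (V : Π x : M, Submodule ℝ (TangentSpace I x)) : Prop :=
  ∃ cov : CovariantDerivative I E (fun x : M ↦ TangentSpace I x), IsLeviCivita g cov ∧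
    ∀ Y Z : Π x : M, TangentSpace I x, CMDiff ∞ (T% Y) → CMDiff ∞ (T% Z) →
      (∀ x, Y x ∈ V x) → (∀ x, Z x ∈ V x) → ∀ x, cov Y x (Z x) ∈ V x

/-- The subbundles `D` and `V` are orthogonal for the metric `g`. -/
def AreOrthogonal
    (g : Bundle.ContMDiffRiemannianMetric I ∞ E (fun x : M ↦ TangentSpace I x))
    (D V : Π x : M, Submodule ℝ (TangentSpace I x)) : Prop :=
  ∀ x, ∀ u ∈ D x, ∀ v ∈ V x, g.inner x u v = 0

end Riemannian

section Bundles

variable {E : Type*} [NormedAddCommGroup E] [NormedSpace ℝ E]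
  {H : Type*} [TopologicalSpace H] (I : ModelWithCorners ℝ E H)
  {P : Type*} [TopologicalSpace P] [ChartedSpace H P]
  {E' : Type*} [NormedAddCommGroup E'] [NormedSpace ℝ E']
  {H' : Type*} [TopologicalSpace H'] (J : ModelWithCorners ℝ E' H')
  {B : Type*} [TopologicalSpace B] [ChartedSpace H' B]
  {E'' : Type*} [NormedAddCommGroup E''] [NormedSpace ℝ E'']
  {H'' : Type*} [TopologicalSpace H''] (IL : ModelWithCorners ℝ E'' H'')
  {L : Type*} [TopologicalSpace L] [ChartedSpace H'' L] [Group L]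

/-- `π : P → B` is a smooth surjective submersion. -/
structure IsSurjectiveSubmersion (π : P → B) : Prop where
  contMDiff : ContMDiff I J ∞ π
  surjective : Function.Surjective π
  mfderiv_surjective : ∀ p, Function.Surjective (mfderiv I J π p)

/-- `D` is an Ehresmann connection on `π`: it is complementary to the vertical bundle `ker dπ`. -/
def IsEhresmannConnection (π : P → B) (D : Π p : P, Submodule ℝ (TangentSpace I p)) : Prop :=
  ∀ p, IsCompl (D p) (LinearMap.ker (mfderiv I J π p).toLinearMap)

/-- The map `act : P → L → P` is a smooth right action of the Lie group `L` making `π : P → B` a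
smooth principal `L`-bundle: it preserves the fibres of `π`, is free and transitive on each of
them, and `π` has smooth equivariant local trivializations. -/
structure IsPrincipalBundle (π : P → B) (act : P → L → P) : Prop where
  act_one : ∀ p, act p 1 = p
  act_mul : ∀ p a b, act p (a * b) = act (act p a) b
  contMDiff_act : ContMDiff (I.prod IL) I ∞ (fun q : P × L ↦ act q.1 q.2)
  proj_act : ∀ p a, π (act p a) = π p
  free : ∀ p a, act p a = p → a = 1
  transitive : ∀ p q, π p = π q → ∃ a, act p a = q
  locally_trivial : ∀ b : B, ∃ e : Bundle.Trivialization L π, b ∈ e.baseSet ∧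
    ContMDiffOn I (J.prod IL) ∞ e e.source ∧
    ContMDiffOn (J.prod IL) I ∞ e.toOpenPartialHomeomorph.symm e.target ∧
    ∀ p ∈ e.source, ∀ a, (e (act p a)).2 = (e p).2 * a

/-- The subbundle `D` of `TP` is invariant under the right action `act`, that is, the image of
`D p` under the differential of `act · a` is the fibre of `D` at `act p a`. -/
def IsInvariant (act : P → L → P) (D : Π p : P, Submodule ℝ (TangentSpace I p)) : Prop :=
  ∀ p a, (D p).map (mfderiv I I (fun q ↦ act q a) p).toLinearMap = D (act p a)

/-- The Ehresmann connection `D` on `π` can be made principal: there are a connected Lie group `L`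
and a right action of `L` on `P` such that `π` is a smooth principal `L`-bundle and `D` is
invariant under `L`. -/
def CanBeMadePrincipal (π : P → B) (D : Π p : P, Submodule ℝ (TangentSpace I p)) : Prop :=
  ∃ (d : ℕ) (L : Type) (_ : TopologicalSpace L) (_ : ChartedSpace (EuclideanSpace ℝ (Fin d)) L)
    (_ : Group L) (_ : LieGroup 𝓘(ℝ, EuclideanSpace ℝ (Fin d)) ∞ L) (_ : ConnectedSpace L)
    (act : P → L → P),
    IsPrincipalBundle I J 𝓘(ℝ, EuclideanSpace ℝ (Fin d)) π act ∧ IsInvariant I act D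

end Bundles

end CarnotFoliation

end

set_option linter.unusedSectionVars false

noncomputable section

set_option linter.style.haveILetI false


namespace CarnotFoliation

/-! Write 𝔭 = 𝔭₁ ⊕ 𝔭₂. Everything rests on a count of degrees: odd plus even is odd, so [𝔭₁, 𝔨] ⊆
𝔭₁; even plus even is even and the index only grows, so [𝔭₂, 𝔨] ⊆ 𝔨; two indices above ⌊r/2⌋ add up
to more than r, so [𝔨, 𝔨] = 0. Hence [𝔭₂, 𝔨] = 0 says exactly that ad 𝔨 preserves 𝔭. The second
ingredient is that 𝔤₁ generates 𝔤: a smooth function whose derivatives along 𝔤₁ vanish is constant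
(`IsGrading.ld_eq_zero`).

Metric statement. If [𝔭₂, 𝔨] = 0, take a left-invariant metric with 𝔭 ⟂ 𝔨; in the Koszul formula for
⟨∇_Y Z, X⟩ with Y, Z in 𝔨 and X in 𝔭 all three terms vanish. Conversely, let an arbitrary metric be
given. For left-invariant X in 𝔭 and Y, Z in 𝔨 one gets X⟨Y, Z⟩ = ⟨[X, Y], Z⟩ + ⟨Y, [X, Z]⟩
(`ld_inner_liv`). For X in 𝔤₁ the right side is zero because [X, 𝔨] ⊆ 𝔭₁ is orthogonal to 𝔨, so ⟨Y,
Z⟩ is constant on G. For X in 𝔭₂ this makes ad X a skew endomorphism of 𝔨; it is also nilpotent,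
hence zero.

Principal statement. If [𝔭₂, 𝔨] = 0, the right translations by K = exp 𝔨 preserve D. Conversely, an
element of the structure group acts by p ↦ p · exp(Y(p)) with Y valued in 𝔨. Invariance of D says
that for each W in 𝔭 some Z in 𝔭 satisfies W + dY(W) = Z + [Y, Z]. Comparing components gives dY = 0
on 𝔭₁ and dY(W) = [Y, W] on 𝔭₂. So Y is constant and [Y, 𝔭₂] = 0; transitivity lets Y(1) be any
element of 𝔨 (`br_eq_zero_of_invariant`).

Global coordinates. Let δ be the derivation equal to k on 𝔤ₖ. The 𝔤-valued form Ad_g ∘ δ is closed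
because δ is a derivation, so on the simply connected G it integrates to a crossed homomorphism
`coord` with `coord (g * h) = coord g + Ad g (coord h)`. It is a local diffeomorphism since δ is
invertible, and a section built layer by layer makes it a diffeomorphism G ≅ 𝔤. On the abelian ideal
of layers above ⌊r/2⌋ the exponential is Y ↦ `coord`⁻¹(δ Y), and modified coordinates `theta`
satisfy θ(g exp Y) = θ(g) + Y there. In them G → G/K is a linear projection, which gives the
manifold structure, the kernel of dπ and a global trivialization. -/

/-- Local functions with locally constant differences glue, up to locally constant functions, to a
global function on a simply connected space. -/
theorem exists_sub_locally_const {X F : Type*} [TopologicalSpace X] [SimplyConnectedSpace X]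
    [LocallyPathConnectedSpace X] [AddCommGroup F]
    (U : X → Set X) (hU : ∀ i, IsOpen (U i)) (hmem : ∀ x, x ∈ U x) (f : X → X → F)
    (h : ∀ i j, ∀ x ∈ U i ∩ U j, ∀ᶠ y in 𝓝 x, f i y - f j y = f i x - f j x) :
    ∃ g : X → F, ∀ i, ∀ x ∈ U i, ∀ᶠ y in 𝓝 x, g y - f i y = g x - f i x := by
  -- With `F` discrete, the locally constant differences are the transition functions of a covering
  -- space of `X`. The identity of `X` lifts to it because `X` is simply connected. The fibre
  -- coordinate of the lift at `x` is read in the chart indexed by `x`, which is why `f x x` is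
  -- added to it.
  let : TopologicalSpace F := ⊥
  have : DiscreteTopology F := ⟨rfl⟩
  let Z : FiberBundleCore X X F :=
    { baseSet := U
      isOpen_baseSet := hU
      indexAt := id
      mem_baseSet_at := hmem
      coordChange := fun i j x v => v + (f i x - f j x)
      coordChange_self := by simp
      continuousOn_coordChange := by
        rintro i j ⟨x, v⟩ ⟨hx, -⟩
        apply ContinuousAt.continuousWithinAt
        have h1 : (fun p : X × F => p.2 + (f i p.1 - f j p.1)) =ᶠ[𝓝 (x, v)]
            fun p => p.2 + (f i x - f j x) := by
          filter_upwards [(h i j x hx).prod_inl_nhds v] with p hp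
          rw [hp]
        exact ContinuousAt.congr ((continuous_of_discreteTopology
          (f := fun w : F => w + (f i x - f j x))).comp continuous_snd).continuousAt h1.symm
      coordChange_comp := by
        intros
        abel }
  have hcov : IsCoveringMap (Z.proj) := IsFiberBundle.isCoveringMap (F := F)
    fun x => ⟨Z.localTriv x, hmem x⟩
  obtain ⟨x₀⟩ : Nonempty X := inferInstance
  obtain ⟨s, ⟨-, hs⟩, -⟩ := hcov.existsUnique_continuousMap_lifts (ContinuousMap.id X) x₀
    (⟨x₀, (0 : F)⟩ : Z.TotalSpace) rfl
  have hs' : ∀ x, (s x).proj = x := fun x => congrFun hs x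
  refine ⟨fun x => (id (s x).2 : F) + f x x, fun i x hx => ?_⟩
  have hc : ContinuousAt (fun y => (Z.localTriv i (s y)).2) x := by
    refine continuous_snd.continuousAt.comp (ContinuousAt.comp ?_ s.continuous.continuousAt)
    apply (Z.localTriv i).continuousAt
    rw [FiberBundleCore.mem_localTriv_source, hs']
    exact hx
  have hv : ∀ y, (Z.localTriv i (s y)).2 = (id (s y).2 : F) + f y y - f i y := by
    intro y
    rw [FiberBundleCore.localTriv_apply]
    change (id (s y).2 : F) + (f (s y).proj (s y).proj - f i (s y).proj) = _
    rw [hs']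
    abel
  have := hc.eventually (show ∀ᶠ w in 𝓝 (Z.localTriv i (s x)).2, w = (Z.localTriv i (s x)).2 by
    simp [nhds_discrete])
  filter_upwards [this] with y hy
  rw [hv, hv] at hy
  exact hy

/-! ### Calculus in the left trivialization of the tangent bundle. -/

section LeftDerivative

variable {E : Type*} [NormedAddCommGroup E] [NormedSpace ℝ E]
    {G : Type*} [TopologicalSpace G] [ChartedSpace E G] [Group G]
    {F : Type*} [NormedAddCommGroup F] [NormedSpace ℝ F]
    {F' : Type*} [NormedAddCommGroup F'] [NormedSpace ℝ F']

/-- The parametrization of a neighbourhood of `g` obtained from the preferred chart at `1` by left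
translation. -/
def ltChart (E : Type*) [NormedAddCommGroup E] [NormedSpace ℝ E]
    {G : Type*} [TopologicalSpace G] [ChartedSpace E G] [Group G] (g : G) (u : E) : G :=
  g * (chartAt E (1 : G)).symm u

variable (E G) in
/-- The point of the model space which corresponds to `1` in the preferred chart at `1`. -/
def basePt : E := chartAt E (1 : G) 1

/-- The derivative of a vector-valued function on a Lie group, in the left trivialization of the
tangent bundle. -/
def ld (f : G → F) (g : G) : E →L[ℝ] F := fderiv ℝ (fun u => f (ltChart E g u)) (basePt E G)

@[simp]
theorem ltChart_basePt (g : G) : ltChart E g (basePt E G) = g := by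
  simp [ltChart, basePt]

theorem ltChart_mul (g h : G) (u : E) : ltChart E (g * h) u = g * ltChart E h u := by
  simp [ltChart, mul_assoc]

theorem ld_comp_mul_left (f : G → F) (h g : G) :
    ld (E := E) (fun x => f (h * x)) g = ld f (h * g) := by
  simp only [ld, ltChart_mul]

variable [LieGroup 𝓘(ℝ, E) ∞ G]

theorem continuous_mul_left_of_lieGroup (E : Type*) [NormedAddCommGroup E] [NormedSpace ℝ E]
    {G : Type*} [TopologicalSpace G] [ChartedSpace E G] [Group G] [LieGroup 𝓘(ℝ, E) ∞ G] (g : G) :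
    Continuous (fun x => g * x) :=
  (contMDiff_mul_left (I := 𝓘(ℝ, E)) (n := ∞) (a := g)).continuous

theorem contMDiffOn_ltChart (g : G) :
    ContMDiffOn 𝓘(ℝ, E) 𝓘(ℝ, E) ∞ (ltChart E g) (chartAt E (1 : G)).target :=
  (contMDiff_mul_left (I := 𝓘(ℝ, E)) (n := ∞) (a := g)).comp_contMDiffOn
    (contMDiffOn_chart_symm (I := 𝓘(ℝ, E)) (n := ∞) (x := (1 : G)))

theorem basePt_mem_target : basePt E G ∈ (chartAt E (1 : G)).target := mem_chart_target E 1

theorem target_mem_nhds : (chartAt E (1 : G)).target ∈ 𝓝 (basePt E G) :=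
  (chartAt E (1 : G)).open_target.mem_nhds basePt_mem_target

theorem contMDiffAt_ltChart (g : G) {u : E} (hu : u ∈ (chartAt E (1 : G)).target) :
    ContMDiffAt 𝓘(ℝ, E) 𝓘(ℝ, E) ∞ (ltChart E g) u :=
  (contMDiffOn_ltChart g).contMDiffAt ((chartAt E (1 : G)).open_target.mem_nhds hu)

/-- The left translate to `g` of the preferred chart at `1`. -/
def ltCoord (E : Type*) [NormedAddCommGroup E] [NormedSpace ℝ E]
    {G : Type*} [TopologicalSpace G] [ChartedSpace E G] [Group G] (g : G) (x : G) : E :=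
  chartAt E (1 : G) (g⁻¹ * x)

@[simp]
theorem ltCoord_self (g : G) : ltCoord E g g = basePt E G := by
  simp [ltCoord, basePt]

/-- The source of the chart `ltCoord E g`. -/
def ltSource (E : Type*) [NormedAddCommGroup E] [NormedSpace ℝ E]
    {G : Type*} [TopologicalSpace G] [ChartedSpace E G] [Group G] (g : G) : Set G :=
  {x | g⁻¹ * x ∈ (chartAt E (1 : G)).source}

theorem isOpen_ltSource (g : G) : IsOpen (ltSource E g) :=
  (chartAt E (1 : G)).open_source.preimage (continuous_mul_left_of_lieGroup E g⁻¹)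

theorem mem_ltSource_self (g : G) : g ∈ ltSource E g := by simp [ltSource]

theorem ltChart_ltCoord {g x : G} (hx : x ∈ ltSource E g) : ltChart E g (ltCoord E g x) = x := by
  simp [ltChart, ltCoord, (chartAt E (1 : G)).left_inv hx]

theorem ltCoord_ltChart (g : G) {u : E} (hu : u ∈ (chartAt E (1 : G)).target) :
    ltCoord E g (ltChart E g u) = u := by
  simp [ltChart, ltCoord, (chartAt E (1 : G)).right_inv hu]

theorem ltCoord_mem_target {g x : G} (hx : x ∈ ltSource E g) :
    ltCoord E g x ∈ (chartAt E (1 : G)).target := (chartAt E (1 : G)).map_source hx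

theorem ltChart_mem_ltSource (g : G) {u : E} (hu : u ∈ (chartAt E (1 : G)).target) :
    ltChart E g u ∈ ltSource E g := by
  simpa [ltSource, ltChart] using (chartAt E (1 : G)).map_target hu

theorem contMDiffAt_ltCoord {g x : G} (hx : x ∈ ltSource E g) :
    ContMDiffAt 𝓘(ℝ, E) 𝓘(ℝ, E) ∞ (ltCoord E g) x := by
  have h1 : ContMDiffAt 𝓘(ℝ, E) 𝓘(ℝ, E) ∞ (chartAt E (1 : G)) (g⁻¹ * x) :=
    (contMDiffOn_chart (I := 𝓘(ℝ, E)) (n := ∞) (x := (1 : G))).contMDiffAt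
      ((chartAt E (1 : G)).open_source.mem_nhds hx)
  exact h1.comp x (contMDiff_mul_left (I := 𝓘(ℝ, E)) (n := ∞) (a := g⁻¹)).contMDiffAt

/-- Left translates of a single chart serve as charts everywhere, so that left-invariant objects
have the same local expression at every point. -/
theorem contMDiffAt_iff_ltChart {n : ℕ∞} {f : G → F} {g : G} {u : E}
    (hu : u ∈ (chartAt E (1 : G)).target) :
    ContMDiffAt 𝓘(ℝ, E) 𝓘(ℝ, F) n f (ltChart E g u) ↔
      ContDiffAt ℝ n (fun v => f (ltChart E g v)) u := by
  have hn : (n : ℕ∞ω) ≤ ∞ := by exact_mod_cast le_top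
  constructor
  · intro hf
    exact (hf.comp u ((contMDiffAt_ltChart g hu).of_le hn)).contDiffAt
  · intro hf
    have hx := ltChart_mem_ltSource g hu
    have h1 : ContMDiffAt 𝓘(ℝ, E) 𝓘(ℝ, F) n (fun v => f (ltChart E g v))
        (ltCoord E g (ltChart E g u)) := by
      rw [ltCoord_ltChart g hu]; exact hf.contMDiffAt
    refine (h1.comp _ ((contMDiffAt_ltCoord hx).of_le hn)).congr_of_eventuallyEq ?_
    filter_upwards [(isOpen_ltSource g).mem_nhds hx] with y hy
    simp [ltChart_ltCoord hy]

theorem contMDiffAt_iff_ltChart_basePt {n : ℕ∞} {f : G → F} {g : G} :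
    ContMDiffAt 𝓘(ℝ, E) 𝓘(ℝ, F) n f g ↔
      ContDiffAt ℝ n (fun v => f (ltChart E g v)) (basePt E G) := by
  rw [← contMDiffAt_iff_ltChart (basePt_mem_target (E := E) (G := G)), ltChart_basePt]

theorem mdifferentiableAt_iff_ltChart {f : G → F} {g : G} :
    MDifferentiableAt 𝓘(ℝ, E) 𝓘(ℝ, F) f g ↔
      DifferentiableAt ℝ (fun v => f (ltChart E g v)) (basePt E G) := by
  constructor
  · intro hf
    rw [← mdifferentiableAt_iff_differentiableAt]
    refine MDifferentiableAt.comp (g := f) (f := ltChart E g) (basePt E G) ?_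
      ((contMDiffAt_ltChart g basePt_mem_target).mdifferentiableAt (by simp))
    rw [ltChart_basePt (E := E)]; exact hf
  · intro hf
    have h1 : MDifferentiableAt 𝓘(ℝ, E) 𝓘(ℝ, F) (fun v => f (ltChart E g v))
        (ltCoord E g g) := by
      rw [ltCoord_self]; exact hf.mdifferentiableAt
    refine (h1.comp g ((contMDiffAt_ltCoord (mem_ltSource_self (E := E) g)).mdifferentiableAt
      (by simp))).congr_of_eventuallyEq ?_
    filter_upwards [(isOpen_ltSource g).mem_nhds (mem_ltSource_self (E := E) g)] with y hy
    simp [ltChart_ltCoord hy]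

theorem hasFDerivAt_ld {f : G → F} {g : G} (hf : MDifferentiableAt 𝓘(ℝ, E) 𝓘(ℝ, F) f g) :
    HasFDerivAt (fun u => f (ltChart E g u)) (ld f g) (basePt E G) :=
  (mdifferentiableAt_iff_ltChart.1 hf).hasFDerivAt

/-- The differential at `1` of the left translation by `g`, as an endomorphism of the model
space. -/
def lt (E : Type*) [NormedAddCommGroup E] [NormedSpace ℝ E]
    {G : Type*} [TopologicalSpace G] [ChartedSpace E G] [Group G] (g : G) : E →L[ℝ] E :=
  mfderiv 𝓘(ℝ, E) 𝓘(ℝ, E) (fun x => g * x) (1 : G)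

theorem ld_eq_mfderiv_comp_lt {f : G → F} {g : G}
    (hf : MDifferentiableAt 𝓘(ℝ, E) 𝓘(ℝ, F) f g) :
    ld f g = (mfderiv 𝓘(ℝ, E) 𝓘(ℝ, F) f g : E →L[ℝ] F) ∘L lt E g := by
  have h2 : MDifferentiableAt 𝓘(ℝ, E) 𝓘(ℝ, E) (fun x => g * x) (1 : G) :=
    (contMDiff_mul_left (I := 𝓘(ℝ, E)) (n := ∞) (a := g)).mdifferentiable (by simp) _
  have h4 : MDifferentiableAt 𝓘(ℝ, E) 𝓘(ℝ, F) f (g * 1) := by rwa [mul_one]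
  have h3 := mfderiv_comp (I'' := 𝓘(ℝ, F)) (1 : G) h4 h2
  have h5 : mfderiv 𝓘(ℝ, E) 𝓘(ℝ, F) (f ∘ (fun x => g * x)) (1 : G) = ld (E := E) f g := by
    rw [(h4.comp (1 : G) h2).mfderiv]
    simp [ld, writtenInExtChartAt, Function.comp_def, ltChart, basePt]
    rfl
  -- The derivatives at `g * 1` and at `g` have different tangent spaces as domains; the equality of
  -- points is transported on the model space `E`.
  have h6 : ∀ y, y = g → (mfderiv 𝓘(ℝ, E) 𝓘(ℝ, F) f y : E →L[ℝ] F) =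
      mfderiv 𝓘(ℝ, E) 𝓘(ℝ, F) f g := by
    rintro _ rfl; rfl
  rw [← h5, ← h6 _ (mul_one g)]
  exact h3

/-- The left-trivialized derivative is the derivative along left-invariant vector fields. -/
theorem mfderiv_lt {f : G → F} {g : G}
    (hf : MDifferentiableAt 𝓘(ℝ, E) 𝓘(ℝ, F) f g) (X : E) :
    mfderiv 𝓘(ℝ, E) 𝓘(ℝ, F) f g (lt E g X) = ld f g X := by
  rw [ld_eq_mfderiv_comp_lt hf]
  rfl

theorem lt_mul (g h : G) :
    lt E (g * h) = (mfderiv 𝓘(ℝ, E) 𝓘(ℝ, E) (fun x => g * x) h : E →L[ℝ] E) ∘L lt E h := by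
  have h2 (g : G) (k : G) : MDifferentiableAt 𝓘(ℝ, E) 𝓘(ℝ, E) (fun x => g * x) k :=
    (contMDiff_mul_left (I := 𝓘(ℝ, E)) (n := ∞) (a := g)).mdifferentiable (by simp) _
  have h3 := mfderiv_comp (I'' := 𝓘(ℝ, E)) (1 : G) (h2 g (h * 1)) (h2 h 1)
  have h4 : (fun x => g * x) ∘ (fun x => h * x) = fun x => g * h * x := by
    ext x; simp [mul_assoc]
  have h6 : ∀ y, y = h → (mfderiv 𝓘(ℝ, E) 𝓘(ℝ, E) (fun x => g * x) y : E →L[ℝ] E) =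
      mfderiv 𝓘(ℝ, E) 𝓘(ℝ, E) (fun x => g * x) h := by
    rintro _ rfl; rfl
  rw [h4] at h3
  rw [← h6 _ (mul_one h)]
  exact h3

@[simp]
theorem lt_one : lt E (1 : G) = ContinuousLinearMap.id ℝ E := by
  have : (fun x : G => 1 * x) = id := by ext; simp
  unfold lt
  rw [this]
  exact mfderiv_id

/-- The differential of the left translation by `g⁻¹` at `g`: the inverse of `lt E g`. -/
def ltInv (E : Type*) [NormedAddCommGroup E] [NormedSpace ℝ E]
    {G : Type*} [TopologicalSpace G] [ChartedSpace E G] [Group G] (g : G) : E →L[ℝ] E :=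
  mfderiv 𝓘(ℝ, E) 𝓘(ℝ, E) (fun x => g⁻¹ * x) g

theorem ltInv_comp_lt (g : G) : ltInv E g ∘L lt E g = ContinuousLinearMap.id ℝ E := by
  have := lt_mul (E := E) g⁻¹ g
  rw [inv_mul_cancel, lt_one] at this
  exact this.symm

theorem lt_comp_ltInv (g : G) : lt E g ∘L ltInv E g = ContinuousLinearMap.id ℝ E := by
  have h2 (g : G) (k : G) : MDifferentiableAt 𝓘(ℝ, E) 𝓘(ℝ, E) (fun x => g * x) k :=
    (contMDiff_mul_left (I := 𝓘(ℝ, E)) (n := ∞) (a := g)).mdifferentiable (by simp) _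
  have h3 := mfderiv_comp (I'' := 𝓘(ℝ, E)) g (h2 g (g⁻¹ * g)) (h2 g⁻¹ g)
  have h4 : (fun x => g * x) ∘ (fun x => g⁻¹ * x) = id := by
    ext x; simp
  have h6 : ∀ y : G, y = 1 → (mfderiv 𝓘(ℝ, E) 𝓘(ℝ, E) (fun x => g * x) y : E →L[ℝ] E) =
      lt E g := by
    rintro _ rfl; rfl
  rw [h4, mfderiv_id] at h3
  rw [← h6 _ (inv_mul_cancel g)]
  exact h3.symm

@[simp]
theorem ltInv_lt (g : G) (X : E) : ltInv E g (lt E g X) = X :=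
  DFunLike.congr_fun (ltInv_comp_lt g) X

@[simp]
theorem lt_ltInv (g : G) (X : E) : lt E g (ltInv E g X) = X :=
  DFunLike.congr_fun (lt_comp_ltInv g) X

/-- The left derivative at `ltChart g u` is the partial derivative in `v`, at the base point, of the
jointly smooth map `(u, v) ↦ f (ltChart g u * ltChart 1 v)`. -/
theorem contMDiffAt_ld {f : G → F} {g : G} (hf : ContMDiffAt 𝓘(ℝ, E) 𝓘(ℝ, F) ∞ f g) :
    ContMDiffAt 𝓘(ℝ, E) 𝓘(ℝ, E →L[ℝ] F) ∞ (ld (E := E) f) g := by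
  rw [contMDiffAt_iff_ltChart_basePt]
  have h1 : ContMDiffAt (𝓘(ℝ, E).prod 𝓘(ℝ, E)) 𝓘(ℝ, F) ∞
      (fun p : E × E => f (ltChart E g p.1 * ltChart E 1 p.2)) (basePt E G, basePt E G) := by
    refine ContMDiffAt.comp (g := f) (f := fun p : E × E => ltChart E g p.1 * ltChart E 1 p.2)
      (basePt E G, basePt E G) (by simpa using hf) ?_
    exact ((contMDiffAt_ltChart g basePt_mem_target).comp (basePt E G, basePt E G)
      contMDiffAt_fst).mul
      ((contMDiffAt_ltChart 1 basePt_mem_target).comp (basePt E G, basePt E G) contMDiffAt_snd)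
  rw [← modelWithCornersSelf_prod, chartedSpaceSelf_prod] at h1
  have h3 := ContDiffAt.fderiv (f := fun u v => f (ltChart E g u * ltChart E 1 v))
    (g := fun _ => basePt E G) (m := ∞) (n := ∞) h1.contDiffAt contDiffAt_const le_rfl
  simp only [← ltChart_mul, mul_one] at h3
  exact h3

theorem contMDiff_ld {f : G → F} (hf : ContMDiff 𝓘(ℝ, E) 𝓘(ℝ, F) ∞ f) :
    ContMDiff 𝓘(ℝ, E) 𝓘(ℝ, E →L[ℝ] F) ∞ (ld (E := E) f) :=
  fun g => contMDiffAt_ld (hf g)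

theorem tendsto_ltChart (g : G) : Filter.Tendsto (ltChart E g) (𝓝 (basePt E G)) (𝓝 g) := by
  have := (contMDiffAt_ltChart (E := E) g basePt_mem_target).continuousAt.tendsto
  rwa [ltChart_basePt] at this

theorem ld_congr {f f' : G → F} {g : G} (h : f =ᶠ[𝓝 g] f') : ld (E := E) f g = ld f' g :=
  Filter.EventuallyEq.fderiv_eq (h.comp_tendsto (tendsto_ltChart (E := E) g))

end LeftDerivative
end CarnotFoliation

end

/-! ### The bracket of vector fields as a commutator of derivations. -/

noncomputable section

namespace CarnotFoliation

section Commutator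

open VectorField

variable {E : Type*} [NormedAddCommGroup E] [NormedSpace ℝ E] [CompleteSpace E]
    {M : Type*} [TopologicalSpace M] [ChartedSpace E M] [IsManifold 𝓘(ℝ, E) ∞ M]
    {F : Type*} [NormedAddCommGroup F] [NormedSpace ℝ F]

/-- The derivative of a vector-valued function along a vector field. -/
def vfDeriv (f : M → F) (V : Π x : M, TangentSpace 𝓘(ℝ, E) x) (x : M) : F :=
  mfderiv 𝓘(ℝ, E) 𝓘(ℝ, F) f x (V x)

/-- The local representative of a vector field in the preferred chart at `x`. -/
def chartField (x : M) (V : Π x : M, TangentSpace 𝓘(ℝ, E) x) : E → E :=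
  mpullback 𝓘(ℝ, E) 𝓘(ℝ, E) (extChartAt 𝓘(ℝ, E) x).symm V

theorem fderiv_comp_extChartAt_symm_mpullback {h : M → F} {x : M} {u : E}
    (hu : u ∈ (extChartAt 𝓘(ℝ, E) x).target)
    (hh : MDifferentiableAt 𝓘(ℝ, E) 𝓘(ℝ, F) h ((extChartAt 𝓘(ℝ, E) x).symm u))
    (V : Π x : M, TangentSpace 𝓘(ℝ, E) x) :
    fderiv ℝ (h ∘ (extChartAt 𝓘(ℝ, E) x).symm) u
        (chartField x V u) =
      vfDeriv h V ((extChartAt 𝓘(ℝ, E) x).symm u) := by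
  have h1 : (mfderiv 𝓘(ℝ, E) 𝓘(ℝ, E) (extChartAt 𝓘(ℝ, E) x).symm u).IsInvertible := by
    have := isInvertible_mfderivWithin_extChartAt_symm hu
    rwa [ModelWithCorners.range_eq_univ, mfderivWithin_univ] at this
  have h2 : MDifferentiableAt 𝓘(ℝ, E) 𝓘(ℝ, E) (extChartAt 𝓘(ℝ, E) x).symm u := by
    have := mdifferentiableWithinAt_extChartAt_symm hu
    rwa [ModelWithCorners.range_eq_univ, mdifferentiableWithinAt_univ] at this
  have h3 := mfderiv_comp u hh h2
  rw [← mfderiv_eq_fderiv, h3]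
  simp only [chartField, mpullback_apply]
  obtain ⟨e, he⟩ := h1
  change (mfderiv 𝓘(ℝ, E) 𝓘(ℝ, F) h ((extChartAt 𝓘(ℝ, E) x).symm u))
    ((mfderiv 𝓘(ℝ, E) 𝓘(ℝ, E) (extChartAt 𝓘(ℝ, E) x).symm u) _) =
    mfderiv 𝓘(ℝ, E) 𝓘(ℝ, F) h ((extChartAt 𝓘(ℝ, E) x).symm u) _
  congr 1
  rw [← he, ContinuousLinearMap.inverse_equiv]
  exact e.apply_symm_apply _

/-- The bracket of two vector fields acts on smooth functions as the commutator of the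
derivations. -/
theorem mfderiv_mlieBracket {f : M → F} {x : M} {V W : Π x : M, TangentSpace 𝓘(ℝ, E) x}
    (hf : ContMDiffAt 𝓘(ℝ, E) 𝓘(ℝ, F) ∞ f x) (hV : MDiffAt (T% V) x) (hW : MDiffAt (T% W) x) :
    vfDeriv f (mlieBracket 𝓘(ℝ, E) V W) x =
      vfDeriv (vfDeriv f W) V x - vfDeriv (vfDeriv f V) W x := by
  set φ := extChartAt 𝓘(ℝ, E) x with hφ
  set p : E := φ x with hp
  have hsp : φ.symm p = x := extChartAt_to_inv x
  have hpt : p ∈ φ.target := mem_extChartAt_target x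
  have hft : ContDiffAt ℝ ∞ (f ∘ φ.symm) p := by
    have h1 : ContMDiffAt 𝓘(ℝ, E) 𝓘(ℝ, E) ∞ φ.symm p :=
      (contMDiffOn_extChartAt_symm (I := 𝓘(ℝ, E)) (n := ∞) x).contMDiffAt
        (extChartAt_target_mem_nhds x)
    exact (ContMDiffAt.comp (g := f) p (by rwa [hsp]) h1).contDiffAt
  have hnear : ∀ᶠ u in 𝓝 p, u ∈ φ.target ∧ MDifferentiableAt 𝓘(ℝ, E) 𝓘(ℝ, F) f (φ.symm u) := by
    have h1 : ∀ᶠ y in 𝓝 x, MDifferentiableAt 𝓘(ℝ, E) 𝓘(ℝ, F) f y := by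
      filter_upwards [contMDiffAt_iff_contMDiffAt_nhds (n := 1) (by simp) |>.1 (hf.of_le (by simp))] with y hy
      exact hy.mdifferentiableAt (by simp)
    have h2 : Filter.Tendsto φ.symm (𝓝 p) (𝓝 x) := by
      have := continuousAt_extChartAt_symm (I := 𝓘(ℝ, E)) x
      rw [ContinuousAt, extChartAt_to_inv] at this
      exact this
    exact Filter.Eventually.and (extChartAt_target_mem_nhds (I := 𝓘(ℝ, E)) x) (h2.eventually h1)
  have key (U : Π x : M, TangentSpace 𝓘(ℝ, E) x) :
      vfDeriv f U ∘ φ.symm =ᶠ[𝓝 p]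
      fun u => fderiv ℝ (f ∘ φ.symm) u (chartField x U u) := by
    filter_upwards [hnear] with u hu
    exact (fderiv_comp_extChartAt_symm_mpullback hu.1 hu.2 U).symm
  have hdiff (U : Π x : M, TangentSpace 𝓘(ℝ, E) x) (hU : MDiffAt (T% U) x) :
      DifferentiableAt ℝ (chartField x U) p := by
    have := MDifferentiableWithinAt.differentiableWithinAt_mpullbackWithin_vectorField
      (mdifferentiableWithinAt_univ.2 hU)
    rw [Set.preimage_univ, ModelWithCorners.range_eq_univ, Set.univ_inter,
      mpullbackWithin_univ] at this
    exact differentiableWithinAt_univ.1 this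
  have hD2 : HasFDerivAt (fderiv ℝ (f ∘ φ.symm)) (fderiv ℝ (fderiv ℝ (f ∘ φ.symm)) p) p :=
    ((hft.fderiv_right (m := ∞) le_rfl).differentiableAt (by simp)).hasFDerivAt
  have hder (U : Π x : M, TangentSpace 𝓘(ℝ, E) x) (hU : MDiffAt (T% U) x) :
      HasFDerivAt (vfDeriv f U ∘ φ.symm)
      ((fderiv ℝ (f ∘ φ.symm) p).comp (fderiv ℝ (chartField x U) p) +
        (fderiv ℝ (fderiv ℝ (f ∘ φ.symm)) p).flip (chartField x U p)) p :=
    (hD2.clm_apply (hdiff U hU).hasFDerivAt).congr_of_eventuallyEq (key U)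
  have hmd (U : Π x : M, TangentSpace 𝓘(ℝ, E) x) (hU : MDiffAt (T% U) x) :
      MDifferentiableAt 𝓘(ℝ, E) 𝓘(ℝ, F)
        (vfDeriv f U) x := by
    have h1 := (hder U hU).differentiableAt.mdifferentiableAt.comp (f := φ) x
      ((contMDiffAt_extChartAt (I := 𝓘(ℝ, E)) (n := ∞) (x := x)).mdifferentiableAt (by simp))
    refine h1.congr_of_eventuallyEq ?_
    filter_upwards [extChartAt_source_mem_nhds (I := 𝓘(ℝ, E)) x] with y hy
    simp only [Function.comp_apply]
    rw [φ.left_inv hy]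
  have hval (U U' : Π x : M, TangentSpace 𝓘(ℝ, E) x) (hU : MDiffAt (T% U) x) :
      vfDeriv (vfDeriv f U) U' x =
      (fderiv ℝ (f ∘ φ.symm) p) (fderiv ℝ (chartField x U) p
          (chartField x U' p)) +
        (fderiv ℝ (fderiv ℝ (f ∘ φ.symm)) p) (chartField x U' p)
          (chartField x U p) := by
    have h1 := fderiv_comp_extChartAt_symm_mpullback
      (h := vfDeriv f U) hpt (by
        rw [← hφ, hsp]; exact hmd U hU) U'
    rw [← hφ, hsp, (hder U hU).fderiv] at h1
    exact h1.symm
  rw [hval W V hW, hval V W hV]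
  have hb : mlieBracket 𝓘(ℝ, E) V W x = (mfderiv 𝓘(ℝ, E) 𝓘(ℝ, E) φ x).inverse
      (show E from lieBracket ℝ (chartField x V) (chartField x W) p) := by
    rw [← mlieBracketWithin_univ, mlieBracketWithin_apply, Set.preimage_univ,
      ModelWithCorners.range_eq_univ, Set.univ_inter, mpullbackWithin_univ, mpullbackWithin_univ]
    exact congrArg (fun w : E => (mfderiv 𝓘(ℝ, E) 𝓘(ℝ, E) φ x).inverse w)
      (congrFun (lieBracketWithin_univ (𝕜 := ℝ) (V := chartField x V) (W := chartField x W)) p)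
  have hinv : (mfderiv 𝓘(ℝ, E) 𝓘(ℝ, E) φ x).IsInvertible :=
    isInvertible_mfderiv_extChartAt (mem_extChartAt_source x)
  have hfx : vfDeriv f (mlieBracket 𝓘(ℝ, E) V W) x =
      fderiv ℝ (f ∘ φ.symm) p (mfderiv 𝓘(ℝ, E) 𝓘(ℝ, E) φ x (mlieBracket 𝓘(ℝ, E) V W x)) := by
    have h0 : MDifferentiableAt 𝓘(ℝ, E) 𝓘(ℝ, E) φ x :=
      (contMDiffAt_extChartAt (I := 𝓘(ℝ, E)) (n := ∞) (x := x)).mdifferentiableAt (by simp)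
    have h2 : MDifferentiableAt 𝓘(ℝ, E) 𝓘(ℝ, F) (f ∘ φ.symm) (φ x) :=
      (hft.differentiableAt (by simp)).mdifferentiableAt
    have h1 := mfderiv_comp x h2 h0
    have h3 : (f ∘ φ.symm) ∘ φ =ᶠ[𝓝 x] f := by
      filter_upwards [extChartAt_source_mem_nhds (I := 𝓘(ℝ, E)) x] with y hy
      simp only [Function.comp_apply]
      rw [φ.left_inv hy]
    have h4 := h3.symm.mfderiv_eq (I := 𝓘(ℝ, E)) (I' := 𝓘(ℝ, F))
    rw [mfderiv_eq_fderiv] at h1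
    exact (DFunLike.congr_fun h4 _).trans (DFunLike.congr_fun h1 _)
  have hbr : mfderiv 𝓘(ℝ, E) 𝓘(ℝ, E) φ x (mlieBracket 𝓘(ℝ, E) V W x) =
      lieBracket ℝ (chartField x V) (chartField x W) p := by
    rw [hb]
    obtain ⟨e, he⟩ := hinv
    rw [← he, ContinuousLinearMap.inverse_equiv]
    exact e.apply_symm_apply _
  have hsymm : IsSymmSndFDerivAt ℝ (f ∘ φ.symm) p := hft.isSymmSndFDerivAt (by simpa using (ENat.LEInfty.out : (2 : ℕ∞ω) ≤ ∞))
  -- The second-derivative terms of the two iterated derivatives agree by symmetry and cancel; the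
  -- first-order terms that remain are the derivative of `f` on the bracket.
  rw [hfx, hbr, lieBracket_eq, hsymm.eq (chartField x V p) (chartField x W p)]
  simp only [map_sub]
  abel

end Commutator
end CarnotFoliation

end

/-! ### The Maurer–Cartan form and primitives of closed forms. -/

noncomputable section

namespace CarnotFoliation

section ClosedForms

open VectorField

variable {E : Type*} [NormedAddCommGroup E] [NormedSpace ℝ E] [FiniteDimensional ℝ E]
    {G : Type*} [TopologicalSpace G] [ChartedSpace E G] [Group G] [LieGroup 𝓘(ℝ, E) ∞ G]
    {F : Type*} [NormedAddCommGroup F] [NormedSpace ℝ F]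

variable (E G) in
theorem lieGroup_minSmoothness : LieGroup 𝓘(ℝ, E) (minSmoothness ℝ 3) G :=
  LieGroup.of_le (n := ∞) (by simpa using (ENat.LEInfty.out : (3 : ℕ∞ω) ≤ ∞))

variable (E G) in
/-- The Lie bracket of the Lie algebra of `G`, as a bilinear map on the model space. -/
def brₗ : E →ₗ[ℝ] E →ₗ[ℝ] E :=
  haveI := lieGroup_minSmoothness E G
  LinearMap.mk₂ ℝ (fun X Y : E => (⁅(show GroupLieAlgebra 𝓘(ℝ, E) G from X),
      (show GroupLieAlgebra 𝓘(ℝ, E) G from Y)⁆ : GroupLieAlgebra 𝓘(ℝ, E) G))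
    (fun X Y Z => add_lie (L := GroupLieAlgebra 𝓘(ℝ, E) G) (M := GroupLieAlgebra 𝓘(ℝ, E) G) X Y Z)
    (fun c X Y => smul_lie (R := ℝ) (L := GroupLieAlgebra 𝓘(ℝ, E) G)
      (M := GroupLieAlgebra 𝓘(ℝ, E) G) c X Y)
    (fun X Y Z => lie_add (L := GroupLieAlgebra 𝓘(ℝ, E) G) (M := GroupLieAlgebra 𝓘(ℝ, E) G) X Y Z)
    (fun c X Y => lie_smul (R := ℝ) (L := GroupLieAlgebra 𝓘(ℝ, E) G)
      (M := GroupLieAlgebra 𝓘(ℝ, E) G) c X Y)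

variable (E G) in
/-- The Lie bracket of the Lie algebra of `G`, as a continuous bilinear map on the model space. -/
def br : E →L[ℝ] E →L[ℝ] E :=
  LinearMap.toContinuousLinearMap
    ((LinearMap.toContinuousLinearMap (𝕜 := ℝ) (E := E) (F' := E)).toLinearMap ∘ₗ brₗ E G)

theorem br_eq (X Y : E) : br E G X Y = (⁅(show GroupLieAlgebra 𝓘(ℝ, E) G from X),
    (show GroupLieAlgebra 𝓘(ℝ, E) G from Y)⁆ : GroupLieAlgebra 𝓘(ℝ, E) G) := rfl

theorem br_swap (X Y : E) : br E G X Y = - br E G Y X := by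
  have := lieGroup_minSmoothness E G
  rw [br_eq, br_eq]
  exact (lie_skew (L := GroupLieAlgebra 𝓘(ℝ, E) G) X Y).symm

theorem br_jacobi (X Y Z : E) :
    br E G X (br E G Y Z) = br E G (br E G X Y) Z + br E G Y (br E G X Z) := by
  have := lieGroup_minSmoothness E G
  simp only [br_eq]
  exact leibniz_lie (L₁ := GroupLieAlgebra 𝓘(ℝ, E) G) (L₂ := GroupLieAlgebra 𝓘(ℝ, E) G) (M := GroupLieAlgebra 𝓘(ℝ, E) G) X Y Z

theorem mdifferentiableAt_lt (X : E) (g : G) :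
    MDiffAt (T% (fun g : G => (mulInvariantVectorField (I := 𝓘(ℝ, E)) X g))) g := by
  have := lieGroup_minSmoothness E G
  exact mdifferentiableAt_mulInvariantVectorField _

theorem eventually_mdifferentiableAt {f : G → F} {g : G}
    (hf : ContMDiffAt 𝓘(ℝ, E) 𝓘(ℝ, F) ∞ f g) :
    ∀ᶠ x in 𝓝 g, MDifferentiableAt 𝓘(ℝ, E) 𝓘(ℝ, F) f x := by
  filter_upwards [contMDiffAt_iff_contMDiffAt_nhds (n := 1) (by simp) |>.1
    (hf.of_le (by simp))] with y hy
  exact hy.mdifferentiableAt (by simp)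

theorem ld_clm_apply {A : G → E →L[ℝ] F} {g : G}
    (hA : MDifferentiableAt 𝓘(ℝ, E) 𝓘(ℝ, E →L[ℝ] F) A g) (X Y : E) :
    ld (fun h => A h Y) g X = ld A g X Y := by
  have h1 := (hasFDerivAt_ld hA).clm_apply (hasFDerivAt_const Y (basePt E G))
  unfold ld at *
  rw [h1.fderiv]
  simp

/-- The commutator of the derivations defined by two left-invariant vector fields. -/
theorem ld_ld_comm {f : G → F} {g : G} (hf : ContMDiffAt 𝓘(ℝ, E) 𝓘(ℝ, F) ∞ f g) (X Y : E) :
    ld (ld (E := E) f) g X Y - ld (ld f) g Y X = ld f g (br E G X Y) := by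
  have := lieGroup_minSmoothness E G
  have hf1 : MDifferentiableAt 𝓘(ℝ, E) 𝓘(ℝ, F) f g := hf.mdifferentiableAt (by simp)
  have hA : MDifferentiableAt 𝓘(ℝ, E) 𝓘(ℝ, E →L[ℝ] F) (ld (E := E) f) g :=
    (contMDiffAt_ld hf).mdifferentiableAt (by simp)
  have h1 := mfderiv_mlieBracket hf (mdifferentiableAt_lt X g) (mdifferentiableAt_lt Y g)
  have hb : mlieBracket 𝓘(ℝ, E) (fun g : G => mulInvariantVectorField (I := 𝓘(ℝ, E)) X g)
      (fun g : G => mulInvariantVectorField (I := 𝓘(ℝ, E)) Y g) =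
      fun g => mulInvariantVectorField (br E G X Y) g :=
    (mulInvariantVector_mlieBracket (I := 𝓘(ℝ, E)) (G := G) X Y).symm
  have key (Z : E) : vfDeriv f (fun g : G => mulInvariantVectorField (I := 𝓘(ℝ, E)) Z g)
      =ᶠ[𝓝 g] fun h => ld f h Z := by
    filter_upwards [eventually_mdifferentiableAt hf] with y hy
    exact mfderiv_lt hy Z
  have hd (Z : E) : MDifferentiableAt 𝓘(ℝ, E) 𝓘(ℝ, F) (fun h => ld (E := E) f h Z) g :=
    hA.clm_apply mdifferentiableAt_const
  have key2 (Z W : E) : vfDeriv (vfDeriv f (fun g : G => mulInvariantVectorField (I := 𝓘(ℝ, E)) Z g))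
      (fun g : G => mulInvariantVectorField (I := 𝓘(ℝ, E)) W g) g = ld (ld f) g W Z := by
    rw [← ld_clm_apply hA, ← mfderiv_lt (hd Z)]
    exact DFunLike.congr_fun ((key Z).mfderiv_eq (I := 𝓘(ℝ, E)) (I' := 𝓘(ℝ, F))) (lt E g W)
  rw [key2, key2, hb] at h1
  rw [← h1, ← mfderiv_lt hf1]
  rfl

variable (E) in
/-- The Maurer-Cartan form in the left-translated chart at `g`. -/
def mcForm (g : G) (u : E) : E →L[ℝ] E :=
  ltInv E (ltChart E g u) ∘L (mfderiv 𝓘(ℝ, E) 𝓘(ℝ, E) (ltChart E g) u : E →L[ℝ] E)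

/-- The chain rule: the Maurer–Cartan form converts left derivatives into ordinary derivatives in a
chart, where Euclidean calculus applies. -/
theorem fderiv_comp_ltChart {f : G → F} {g : G} {u : E} (hu : u ∈ (chartAt E (1 : G)).target)
    (hf : MDifferentiableAt 𝓘(ℝ, E) 𝓘(ℝ, F) f (ltChart E g u)) :
    fderiv ℝ (fun v => f (ltChart E g v)) u = ld f (ltChart E g u) ∘L mcForm E g u := by
  have h1 := mfderiv_comp u hf ((contMDiffAt_ltChart g hu).mdifferentiableAt (by simp))
  rw [mfderiv_eq_fderiv] at h1
  refine Eq.trans h1 ?_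
  ext v
  refine Eq.trans ?_ (mfderiv_lt hf (mcForm E g u v))
  exact congrArg (fun w : E => (mfderiv 𝓘(ℝ, E) 𝓘(ℝ, F) f (ltChart E g u) : E →L[ℝ] F) w)
    (lt_ltInv (ltChart E g u) _).symm

theorem ld_ltCoord_comp_mcForm {g : G} {u : E} (hu : u ∈ (chartAt E (1 : G)).target) :
    ld (ltCoord E g) (ltChart E g u) ∘L mcForm E g u = ContinuousLinearMap.id ℝ E := by
  rw [← fderiv_comp_ltChart hu
    ((contMDiffAt_ltCoord (ltChart_mem_ltSource g hu)).mdifferentiableAt (by simp))]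
  have : (fun v => ltCoord E g (ltChart E g v)) =ᶠ[𝓝 u] id := by
    filter_upwards [(chartAt E (1 : G)).open_target.mem_nhds hu] with v hv
    exact ltCoord_ltChart g hv
  rw [this.fderiv_eq, fderiv_id]

/-- In finite dimension a one-sided inverse is two-sided. -/
theorem mcForm_comp_ld_ltCoord {g : G} {u : E} (hu : u ∈ (chartAt E (1 : G)).target) :
    mcForm E g u ∘L ld (ltCoord E g) (ltChart E g u) = ContinuousLinearMap.id ℝ E := by
  have h1 := ld_ltCoord_comp_mcForm (g := g) hu
  have h2 : (ld (ltCoord E g) (ltChart E g u)).toLinearMap * (mcForm E g u).toLinearMap = 1 := by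
    ext v; exact DFunLike.congr_fun h1 v
  ext v
  exact DFunLike.congr_fun (mul_eq_one_comm.1 h2) v

theorem eventuallyEq_const_of_ld_eq_zero {f : G → F} {g : G}
    (hf : ∀ᶠ x in 𝓝 g, MDifferentiableAt 𝓘(ℝ, E) 𝓘(ℝ, F) f x)
    (h : ∀ᶠ x in 𝓝 g, ld (E := E) f x = 0) : ∀ᶠ x in 𝓝 g, f x = f g := by
  have h1 : ∀ᶠ u in 𝓝 (basePt E G), u ∈ (chartAt E (1 : G)).target ∧
      MDifferentiableAt 𝓘(ℝ, E) 𝓘(ℝ, F) f (ltChart E g u) ∧ ld (E := E) f (ltChart E g u) = 0 :=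
    Filter.Eventually.and target_mem_nhds ((tendsto_ltChart g).eventually (hf.and h))
  obtain ⟨ε, hε, hball⟩ := Metric.eventually_nhds_iff_ball.1 h1
  have hconst : ∀ u ∈ Metric.ball (basePt E G) ε, f (ltChart E g u) = f g := by
    intro u hu
    have := IsOpen.is_const_of_fderiv_eq_zero (𝕜 := ℝ) (f := fun v => f (ltChart E g v))
      Metric.isOpen_ball (convex_ball (basePt E G) ε).isPreconnected
      (fun v hv => by
        obtain ⟨hv1, hv2, hv3⟩ := hball v hv
        exact (MDifferentiableAt.comp (g := f) (f := ltChart E g) v hv2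
          ((contMDiffAt_ltChart g hv1).mdifferentiableAt (by simp))).differentiableAt
            |>.differentiableWithinAt)
      (fun v hv => by
        obtain ⟨hv1, hv2, hv3⟩ := hball v hv
        rw [fderiv_comp_ltChart hv1 hv2, hv3, ContinuousLinearMap.zero_comp]
        rfl) hu (Metric.mem_ball_self hε)
    simpa using this
  have h2 : ∀ᶠ x in 𝓝 g, x ∈ ltSource E g ∧ ltCoord E g x ∈ Metric.ball (basePt E G) ε := by
    refine Filter.Eventually.and ((isOpen_ltSource g).mem_nhds (mem_ltSource_self (E := E) g)) ?_
    have := (contMDiffAt_ltCoord (mem_ltSource_self (E := E) g)).continuousAt.tendsto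
    rw [ltCoord_self] at this
    exact this.eventually (Metric.ball_mem_nhds _ hε)
  filter_upwards [h2] with x hx
  rw [← hconst _ hx.2, ltChart_ltCoord hx.1]

/-- The uniqueness principle behind the later identities between functions on `G`: compare left
derivatives and the values at `1`. -/
theorem eq_of_ld_eq_zero [PreconnectedSpace G] {f : G → F}
    (hf : ∀ x, MDifferentiableAt 𝓘(ℝ, E) 𝓘(ℝ, F) f x) (h : ∀ x, ld (E := E) f x = 0) (x y : G) :
    f x = f y := by
  have : IsLocallyConstant f := (IsLocallyConstant.iff_eventually_eq f).2 fun g =>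
    eventuallyEq_const_of_ld_eq_zero (.of_forall hf) (.of_forall h)
  exact this.apply_eq_of_isPreconnected isPreconnected_univ (Set.mem_univ x) (Set.mem_univ y)

theorem contDiffOn_ld_ltCoord (g : G) : ContDiffOn ℝ ∞
    (fun u : E => ld (E := E) (ltCoord E g) (ltChart E g u)) (chartAt E (1 : G)).target := by
  intro u hu
  exact ((contMDiffAt_iff_ltChart (n := ⊤) hu).1 (contMDiffAt_ld
    (contMDiffAt_ltCoord (ltChart_mem_ltSource g hu)))).contDiffWithinAt

/-- The form is the inverse of the left derivative of the chart, which is visibly smooth, and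
inversion of operators is smooth. -/
theorem contDiffOn_mcForm (g : G) : ContDiffOn ℝ ∞ (mcForm E g) (chartAt E (1 : G)).target := by
  intro u hu
  have h1 : ∀ v ∈ (chartAt E (1 : G)).target,
      mcForm E g v = (ld (ltCoord E g) (ltChart E g v)).inverse := fun v hv =>
    (ContinuousLinearMap.inverse_eq (ld_ltCoord_comp_mcForm hv) (mcForm_comp_ld_ltCoord hv)).symm
  refine ContDiffWithinAt.congr ?_ h1 (h1 u hu)
  let e : E ≃L[ℝ] E := ContinuousLinearEquiv.equivOfInverse
    (ld (ltCoord E g) (ltChart E g u)) (mcForm E g u)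
    (fun v => DFunLike.congr_fun (mcForm_comp_ld_ltCoord hu) v)
    (fun v => DFunLike.congr_fun (ld_ltCoord_comp_mcForm hu) v)
  have h2 : ContDiffAt ℝ ∞ (ContinuousLinearMap.inverse (R := ℝ) (M := E) (M₂ := E))
      (ld (ltCoord E g) (ltChart E g u)) := contDiffAt_map_inverse e
  exact h2.comp_contDiffWithinAt u (contDiffOn_ld_ltCoord g u hu)

/-- Local primitives of closed forms. -/
theorem exists_local_primitive [CompleteSpace F] {A : G → E →L[ℝ] F}
    (hA : ContMDiff 𝓘(ℝ, E) 𝓘(ℝ, E →L[ℝ] F) ∞ A)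
    (hclosed : ∀ g X Y, ld A g X Y - ld A g Y X = A g (br E G X Y)) (g : G) :
    ∃ (U : Set G) (f : G → F), IsOpen U ∧ g ∈ U ∧ ∀ x ∈ U,
      ContMDiffAt 𝓘(ℝ, E) 𝓘(ℝ, F) ∞ f x ∧ ld f x = A x := by
  obtain ⟨ε, hε, hball⟩ := Metric.eventually_nhds_iff_ball.1
    (target_mem_nhds (E := E) (G := G) : ∀ᶠ u in 𝓝 (basePt E G), u ∈ (chartAt E (1 : G)).target)
  set B := Metric.ball (basePt E G) ε with hB
  let η : E → E →L[ℝ] F := fun u => A (ltChart E g u) ∘L mcForm E g u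
  have hAc : ContDiffOn ℝ ∞ (fun u => A (ltChart E g u)) B := fun u hu =>
    ((contMDiffAt_iff_ltChart (n := ⊤) (hball u hu)).1 (hA _)).contDiffWithinAt
  have hη : ContDiffOn ℝ ∞ η B := hAc.clm_comp ((contDiffOn_mcForm g).mono hball)
  -- The Poincaré lemma on a ball needs this symmetry. With `P` the inverse of `mcForm`, the
  -- relation `η ∘ P = A` is differentiated in place of the definition of `η`. The antisymmetric
  -- part of the result is `A [X, Y]` from `hclosed` minus the same quantity from `ld_ld_comm`
  -- applied to the chart.
  have hsymm : ∀ u ∈ B, ∀ v w, fderiv ℝ η u v w = fderiv ℝ η u w v := by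
    intro u hu
    have hut := hball u hu
    set P : E → E →L[ℝ] E := fun u => ld (ltCoord E g) (ltChart E g u) with hP
    have hBn : B ∈ 𝓝 u := Metric.isOpen_ball.mem_nhds hu
    have hηu : DifferentiableAt ℝ η u :=
      (hη.contDiffAt hBn).differentiableAt (by simp)
    have hPu : DifferentiableAt ℝ P u :=
      (((contDiffOn_ld_ltCoord g).mono hball).contDiffAt hBn).differentiableAt (by simp)
    have hAu : MDifferentiableAt 𝓘(ℝ, E) 𝓘(ℝ, E →L[ℝ] F) A (ltChart E g u) :=
      hA.mdifferentiable (by simp) _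
    have hκ := contMDiffAt_ltCoord (ltChart_mem_ltSource g hut)
    have hκ' : MDifferentiableAt 𝓘(ℝ, E) 𝓘(ℝ, E →L[ℝ] E) (ld (ltCoord E g)) (ltChart E g u) :=
      (contMDiffAt_ld hκ).mdifferentiableAt (by simp)
    have hmc : ∀ X, mcForm E g u (P u X) = X := fun X =>
      DFunLike.congr_fun (mcForm_comp_ld_ltCoord hut) X
    have hmc' : ∀ v, P u (mcForm E g u v) = v := fun v =>
      DFunLike.congr_fun (ld_ltCoord_comp_mcForm hut) v
    have hprod : (fun v => η v ∘L P v) =ᶠ[𝓝 u] fun v => A (ltChart E g v) := by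
      filter_upwards [hBn] with v hv
      ext X
      exact congrArg (A (ltChart E g v)) (DFunLike.congr_fun (mcForm_comp_ld_ltCoord (hball v hv)) X)
    have hder : ∀ X Y, fderiv ℝ η u (P u X) (P u Y) =
        ld A (ltChart E g u) X Y - η u (ld (ld (ltCoord E g)) (ltChart E g u) X Y) := by
      intro X Y
      have h1 := hprod.fderiv_eq (𝕜 := ℝ)
      rw [(hηu.hasFDerivAt.clm_comp hPu.hasFDerivAt).fderiv, fderiv_comp_ltChart hut hAu] at h1
      have h2 := DFunLike.congr_fun (DFunLike.congr_fun h1 (P u X)) Y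
      have h3 : fderiv ℝ P u = _ := fderiv_comp_ltChart hut hκ'
      simp [h3, hmc] at h2
      rw [← h2]
      abel
    intro v w
    rw [← hmc' v, ← hmc' w, hder, hder]
    have h1 := hclosed (ltChart E g u) (mcForm E g u v) (mcForm E g u w)
    have h2 := ld_ld_comm hκ (mcForm E g u v) (mcForm E g u w)
    have h3 : η u (ld (ltCoord E g) (ltChart E g u)
        (br E G (mcForm E g u v) (mcForm E g u w))) =
        A (ltChart E g u) (br E G (mcForm E g u v) (mcForm E g u w)) :=
      congrArg (A (ltChart E g u)) (hmc _)
    rw [← h2, map_sub, ← h1] at h3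
    rw [sub_eq_sub_iff_sub_eq_sub]
    exact h3.symm
  obtain ⟨f, hf⟩ := (convex_ball (basePt E G) ε).exists_forall_hasFDerivAt_of_fderiv_symmetric
    Metric.isOpen_ball (hη.differentiableOn (by simp)) hsymm
  have hfc : ContDiffOn ℝ ∞ f B := by
    rw [contDiffOn_infty_iff_fderiv_of_isOpen Metric.isOpen_ball]
    exact ⟨fun u hu => (hf u hu).differentiableAt.differentiableWithinAt,
      hη.congr fun u hu => (hf u hu).fderiv⟩
  refine ⟨{x | x ∈ ltSource E g ∧ ltCoord E g x ∈ B}, fun x => f (ltCoord E g x), ?_, ?_, ?_⟩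
  · rw [isOpen_iff_mem_nhds]
    rintro x ⟨hx, hxB⟩
    exact Filter.inter_mem ((isOpen_ltSource g).mem_nhds hx)
      ((contMDiffAt_ltCoord hx).continuousAt.preimage_mem_nhds (Metric.isOpen_ball.mem_nhds hxB))
  · exact ⟨mem_ltSource_self (E := E) g, by simpa [hB] using hε⟩
  · rintro x ⟨hx, hxB⟩
    have hfx : ContMDiffAt 𝓘(ℝ, E) 𝓘(ℝ, F) ∞ (fun x => f (ltCoord E g x)) x :=
      (hfc.contDiffAt (Metric.isOpen_ball.mem_nhds hxB)).contMDiffAt.comp x (contMDiffAt_ltCoord hx)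
    refine ⟨hfx, ?_⟩
    set u := ltCoord E g x with hu
    have hut : u ∈ (chartAt E (1 : G)).target := ltCoord_mem_target hx
    have hxu : ltChart E g u = x := ltChart_ltCoord hx
    have h1 := fderiv_comp_ltChart (f := fun x => f (ltCoord E g x)) (g := g) hut
      (by rw [hxu]; exact hfx.mdifferentiableAt (by simp))
    have h2 : (fun v => f (ltCoord E g (ltChart E g v))) =ᶠ[𝓝 u] f := by
      filter_upwards [(chartAt E (1 : G)).open_target.mem_nhds hut] with v hv
      rw [ltCoord_ltChart g hv]
    rw [h2.fderiv_eq, (hf u hxB).fderiv] at h1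
    have h3 : ∀ X, mcForm E g u (ld (ltCoord E g) (ltChart E g u) X) = X := fun X =>
      DFunLike.congr_fun (mcForm_comp_ld_ltCoord hut) X
    ext X
    have h4 := DFunLike.congr_fun h1 (ld (ltCoord E g) (ltChart E g u) X)
    simp only [η, ContinuousLinearMap.comp_apply, h3] at h4
    rw [← hxu]
    exact h4.symm

/-- Closed forms on a simply connected Lie group are exact. -/
theorem exists_ld_eq [SimplyConnectedSpace G] [CompleteSpace F] {A : G → E →L[ℝ] F}
    (hA : ContMDiff 𝓘(ℝ, E) 𝓘(ℝ, E →L[ℝ] F) ∞ A)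
    (hclosed : ∀ g X Y, ld A g X Y - ld A g Y X = A g (br E G X Y)) :
    ∃ f : G → F, ContMDiff 𝓘(ℝ, E) 𝓘(ℝ, F) ∞ f ∧ ∀ g, ld f g = A g := by
  have := ChartedSpace.locallyPathConnectedSpace E G
  choose U f hU hmem hf using exists_local_primitive hA hclosed
  have hld : ∀ {f f' : G → F} {x : G}, MDifferentiableAt 𝓘(ℝ, E) 𝓘(ℝ, F) f x →
      MDifferentiableAt 𝓘(ℝ, E) 𝓘(ℝ, F) f' x →
      ld (E := E) (fun y => f y - f' y) x = ld f x - ld f' x := fun h h' =>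
    ((hasFDerivAt_ld h).sub (hasFDerivAt_ld h')).fderiv
  -- On an overlap two local primitives have the same left derivative, so their difference is
  -- locally constant.
  obtain ⟨s, hs⟩ := exists_sub_locally_const U hU hmem f (fun i j x hx => by
    have h1 : ∀ᶠ y in 𝓝 x, y ∈ U i ∩ U j := ((hU i).inter (hU j)).mem_nhds hx
    refine eventuallyEq_const_of_ld_eq_zero (E := E) (f := fun y => f i y - f j y) ?_ ?_
    · filter_upwards [h1] with y hy
      exact ((hf i y hy.1).1.mdifferentiableAt (by simp)).sub
        ((hf j y hy.2).1.mdifferentiableAt (by simp))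
    · filter_upwards [h1] with y hy
      rw [hld ((hf i y hy.1).1.mdifferentiableAt (by simp))
        ((hf j y hy.2).1.mdifferentiableAt (by simp)), (hf i y hy.1).2, (hf j y hy.2).2, sub_self])
  have hs' : ∀ x, s =ᶠ[𝓝 x] fun y => f x y + (s x - f x x) := fun x => by
    filter_upwards [hs x x (hmem x)] with y hy
    rw [← hy]; abel
  refine ⟨s, fun x => ?_, fun x => ?_⟩
  · exact ((hf x x (hmem x)).1.add contMDiffAt_const).congr_of_eventuallyEq (hs' x)
  · rw [ld_congr (hs' x), ← (hf x x (hmem x)).2]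
    exact ((hasFDerivAt_ld ((hf x x (hmem x)).1.mdifferentiableAt (by simp))).add_const _).fderiv

end ClosedForms
end CarnotFoliation

end

/-! ### Mixed partial derivatives and the adjoint representation. -/

noncomputable section

namespace CarnotFoliation

/-- Symmetry of mixed partial derivatives. -/
theorem fderiv_fderiv_comm_of_contDiffAt {E₁ E₂ F : Type*} [NormedAddCommGroup E₁] [NormedSpace ℝ E₁]
    [NormedAddCommGroup E₂] [NormedSpace ℝ E₂] [NormedAddCommGroup F] [NormedSpace ℝ F]
    {H : E₁ → E₂ → F} {a : E₁} {b : E₂} (hH : ContDiffAt ℝ ∞ (Function.uncurry H) (a, b))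
    (X : E₁) (Y : E₂) :
    fderiv ℝ (fun v => fderiv ℝ (fun u => H u v) a) b Y X =
      fderiv ℝ (fun u => fderiv ℝ (fun v => H u v) b) a X Y := by
  have hd : ∀ᶠ p in 𝓝 (a, b), DifferentiableAt ℝ (Function.uncurry H) p := by
    filter_upwards [(hH.of_le (show (1 : ℕ∞ω) ≤ ∞ by simp)).eventually (by simp)] with p hp
    exact hp.differentiableAt (by simp)
  have hD : HasFDerivAt (fderiv ℝ (Function.uncurry H))
      (fderiv ℝ (fderiv ℝ (Function.uncurry H)) (a, b)) (a, b) :=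
    ((hH.fderiv_right (m := ∞) le_rfl).differentiableAt (by simp)).hasFDerivAt
  have hc1 : Filter.Tendsto (fun v => (a, v)) (𝓝 b) (𝓝 (a, b)) :=
    (Continuous.prodMk_right a).tendsto b
  have hc2 : Filter.Tendsto (fun u => (u, b)) (𝓝 a) (𝓝 (a, b)) :=
    (Continuous.prodMk_left b).tendsto a
  have h1 : (fun v => fderiv ℝ (fun u => H u v) a) =ᶠ[𝓝 b]
      fun v => fderiv ℝ (Function.uncurry H) (a, v) ∘L ContinuousLinearMap.inl ℝ E₁ E₂ := by
    filter_upwards [hc1.eventually hd] with v hv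
    exact (HasFDerivAt.comp (g := Function.uncurry H) (f := fun e => (e, v)) a hv.hasFDerivAt
      (hasFDerivAt_prodMk_left (𝕜 := ℝ) a v)).fderiv
  have h2 : (fun u => fderiv ℝ (fun v => H u v) b) =ᶠ[𝓝 a]
      fun u => fderiv ℝ (Function.uncurry H) (u, b) ∘L ContinuousLinearMap.inr ℝ E₁ E₂ := by
    filter_upwards [hc2.eventually hd] with u hu
    exact (HasFDerivAt.comp (g := Function.uncurry H) (f := fun e => (u, e)) b hu.hasFDerivAt
      (hasFDerivAt_prodMk_right (𝕜 := ℝ) u b)).fderiv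
  have h3 := ((HasFDerivAt.comp (g := fderiv ℝ (Function.uncurry H)) (f := fun e => (a, e)) b hD
    (hasFDerivAt_prodMk_right (𝕜 := ℝ) a b)).clm_comp
    (hasFDerivAt_const (ContinuousLinearMap.inl ℝ E₁ E₂) b)).fderiv
  have h4 := ((HasFDerivAt.comp (g := fderiv ℝ (Function.uncurry H)) (f := fun e => (e, b)) a hD
    (hasFDerivAt_prodMk_left (𝕜 := ℝ) a b)).clm_comp
    (hasFDerivAt_const (ContinuousLinearMap.inr ℝ E₁ E₂) a)).fderiv
  rw [h1.fderiv_eq, h2.fderiv_eq]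
  simp only [Function.comp_def] at h3 h4
  rw [h3, h4]
  have hsymm : IsSymmSndFDerivAt ℝ (Function.uncurry H) (a, b) :=
    hH.isSymmSndFDerivAt (by simpa using (ENat.LEInfty.out : (2 : ℕ∞ω) ≤ ∞))
  simpa using hsymm.eq (0, Y) (X, 0)

section Adjoint

variable {E : Type*} [NormedAddCommGroup E] [NormedSpace ℝ E] [FiniteDimensional ℝ E]
    {G : Type*} [TopologicalSpace G] [ChartedSpace E G] [Group G] [LieGroup 𝓘(ℝ, E) ∞ G]
    {F : Type*} [NormedAddCommGroup F] [NormedSpace ℝ F]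

variable (E) in
/-- The adjoint representation, as a family of endomorphisms of the model space. -/
def Ad (g : G) : E →L[ℝ] E := ld (fun x => ltCoord E 1 (g * x * g⁻¹)) 1

theorem mdifferentiableAt_conj (g x : G) :
    MDifferentiableAt 𝓘(ℝ, E) 𝓘(ℝ, E) (fun x => g * x * g⁻¹) x :=
  ((contMDiff_mul_right (I := 𝓘(ℝ, E)) (n := ∞) (a := g⁻¹)).comp
    (contMDiff_mul_left (I := 𝓘(ℝ, E)) (n := ∞) (a := g))).mdifferentiable (by simp) x

theorem mdifferentiableAt_ltCoord_self (g : G) :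
    MDifferentiableAt 𝓘(ℝ, E) 𝓘(ℝ, E) (ltCoord E g) g :=
  (contMDiffAt_ltCoord (mem_ltSource_self (E := E) g)).mdifferentiableAt (by simp)

theorem ld_conj {f : G → F} (g : G) (hf : MDifferentiableAt 𝓘(ℝ, E) 𝓘(ℝ, F) f 1) :
    ld (fun x => f (g * x * g⁻¹)) 1 = ld f 1 ∘L Ad E g := by
  have h1 : MDifferentiableAt 𝓘(ℝ, E) 𝓘(ℝ, E) (fun x => ltCoord E 1 (g * x * g⁻¹)) 1 := by
    refine MDifferentiableAt.comp (g := ltCoord E 1) (f := fun x => g * x * g⁻¹) 1 ?_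
      (mdifferentiableAt_conj g 1)
    simpa using mdifferentiableAt_ltCoord_self (E := E) (1 : G)
  have h2 : HasFDerivAt (fun u => f (ltChart E 1 u)) (ld f 1)
      (ltCoord E 1 (g * ltChart E 1 (basePt E G) * g⁻¹)) := by
    simpa using hasFDerivAt_ld hf
  have h3 := (h2.comp (basePt E G) (hasFDerivAt_ld h1)).fderiv
  have h4 : (fun x => f (g * x * g⁻¹)) =ᶠ[𝓝 1]
      fun x => f (ltChart E 1 (ltCoord E 1 (g * x * g⁻¹))) := by
    have hc : Filter.Tendsto (fun x => g * x * g⁻¹) (𝓝 1) (𝓝 1) := by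
      have := (mdifferentiableAt_conj (E := E) g 1).continuousAt.tendsto
      simpa using this
    filter_upwards [hc ((isOpen_ltSource (E := E) 1).mem_nhds (mem_ltSource_self (1 : G)))] with x hx
    rw [ltChart_ltCoord hx]
  rw [ld_congr h4]
  exact h3

/-- Because `g x h = (g h)(h⁻¹ x h)`, a right translation is a left translation preceded by a
conjugation, and conjugation has derivative `Ad h⁻¹` at `1`. -/
theorem ld_mul_right {f : G → F} {g h : G} (hf : MDifferentiableAt 𝓘(ℝ, E) 𝓘(ℝ, F) f (g * h)) :
    ld (fun x => f (x * h)) g = ld f (g * h) ∘L Ad E h⁻¹ := by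
  have h1 : MDifferentiableAt 𝓘(ℝ, E) 𝓘(ℝ, F) (fun x => f (g * h * x)) 1 := by
    refine MDifferentiableAt.comp (g := f) (f := fun x => g * h * x) 1 (by simpa using hf) ?_
    exact (contMDiff_mul_left (I := 𝓘(ℝ, E)) (n := ∞) (a := g * h)).mdifferentiable (by simp) _
  have h2 := ld_conj h⁻¹ h1
  rw [ld_comp_mul_left, mul_one] at h2
  rw [← h2]
  have h3 := ld_comp_mul_left (E := E) (fun x => f (x * h)) g 1
  rw [mul_one] at h3
  rw [← h3]
  congr 1
  ext x
  congr 1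
  group

theorem ld_ltCoord_one : ld (ltCoord E (1 : G)) 1 = ContinuousLinearMap.id ℝ E := by
  have : (fun u => ltCoord E (1 : G) (ltChart E 1 u)) =ᶠ[𝓝 (basePt E G)] id := by
    filter_upwards [target_mem_nhds (E := E) (G := G)] with u hu
    exact ltCoord_ltChart 1 hu
  rw [ld, this.fderiv_eq, fderiv_id]

@[simp]
theorem Ad_one : Ad E (1 : G) = ContinuousLinearMap.id ℝ E := by
  simp [Ad, ld_ltCoord_one]

theorem Ad_mul (g h : G) : Ad E (g * h) = Ad E g ∘L Ad E h := by
  have h1 : MDifferentiableAt 𝓘(ℝ, E) 𝓘(ℝ, E) (fun x => ltCoord E 1 (g * x * g⁻¹)) 1 := by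
    refine MDifferentiableAt.comp (g := ltCoord E 1) (f := fun x => g * x * g⁻¹) 1 ?_
      (mdifferentiableAt_conj g 1)
    simpa using mdifferentiableAt_ltCoord_self (E := E) (1 : G)
  rw [show Ad E g = ld (fun x => ltCoord E 1 (g * x * g⁻¹)) 1 from rfl, ← ld_conj h h1]
  simp [Ad, mul_assoc]

theorem Ad_mul_apply (g h : G) (X : E) : Ad E (g * h) X = Ad E g (Ad E h X) := by
  rw [Ad_mul]; rfl

@[simp]
theorem Ad_inv_Ad (g : G) (X : E) : Ad E g⁻¹ (Ad E g X) = X := by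
  rw [← Ad_mul_apply, inv_mul_cancel, Ad_one]; rfl

@[simp]
theorem Ad_Ad_inv (g : G) (X : E) : Ad E g (Ad E g⁻¹ X) = X := by
  rw [← Ad_mul_apply, mul_inv_cancel, Ad_one]; rfl

/-- Near `1` it is a partial derivative of a jointly smooth map; the factorization `Ad x = Ad g ∘ Ad
(g⁻¹ x)` carries smoothness from `1` to `g`. -/
theorem contMDiff_Ad : ContMDiff 𝓘(ℝ, E) 𝓘(ℝ, E →L[ℝ] E) ∞ (Ad E : G → E →L[ℝ] E) := by
  have h0 : ContMDiffAt 𝓘(ℝ, E) 𝓘(ℝ, E →L[ℝ] E) ∞ (Ad E : G → E →L[ℝ] E) 1 := by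
    rw [contMDiffAt_iff_ltChart_basePt]
    have h1 : ContMDiffAt (𝓘(ℝ, E).prod 𝓘(ℝ, E)) 𝓘(ℝ, E) ∞
        (fun p : E × E => ltCoord E 1 (ltChart E 1 p.1 * ltChart E 1 p.2 *
          (ltChart E (1 : G) p.1)⁻¹)) (basePt E G, basePt E G) := by
      refine ContMDiffAt.comp (I' := 𝓘(ℝ, E)) (g := ltCoord E (1 : G)) (f := fun p : E × E =>
        ltChart E 1 p.1 * ltChart E 1 p.2 * (ltChart E (1 : G) p.1)⁻¹)
        (basePt E G, basePt E G) ?_ ?_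
      · simpa using contMDiffAt_ltCoord (mem_ltSource_self (E := E) (1 : G))
      · have ha : ContMDiffAt (𝓘(ℝ, E).prod 𝓘(ℝ, E)) 𝓘(ℝ, E) ∞
            (fun p : E × E => ltChart E (1 : G) p.1) (basePt E G, basePt E G) :=
          ContMDiffAt.comp (g := ltChart E (1 : G)) (f := fun p : E × E => p.1)
            (basePt E G, basePt E G) (contMDiffAt_ltChart (E := E) (1 : G) basePt_mem_target)
            contMDiffAt_fst
        exact (ha.mul (ContMDiffAt.comp (g := ltChart E (1 : G)) (f := fun p : E × E => p.2)
            (basePt E G, basePt E G) (contMDiffAt_ltChart (E := E) (1 : G) basePt_mem_target)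
            contMDiffAt_snd)).mul ha.inv
    rw [← modelWithCornersSelf_prod, chartedSpaceSelf_prod] at h1
    exact ContDiffAt.fderiv (f := fun u v => ltCoord E 1 (ltChart E 1 u * ltChart E 1 v *
          (ltChart E (1 : G) u)⁻¹))
      (g := fun _ => basePt E G) (m := ∞) (n := ∞) h1.contDiffAt contDiffAt_const le_rfl
  intro g
  have h2 : (Ad E : G → E →L[ℝ] E) = fun x => Ad E g ∘L Ad E (g⁻¹ * x) := by
    ext1 x
    rw [← Ad_mul (E := E), mul_inv_cancel_left]
  rw [h2]
  have h3 : ContMDiffAt 𝓘(ℝ, E) 𝓘(ℝ, E →L[ℝ] E) ∞ (fun x => Ad E (g⁻¹ * x)) g :=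
    ContMDiffAt.comp (g := (Ad E : G → E →L[ℝ] E)) (f := fun x : G => g⁻¹ * x) (I := 𝓘(ℝ, E))
      (I' := 𝓘(ℝ, E)) g (by simpa using h0)
      (contMDiff_mul_left (I := 𝓘(ℝ, E)) (n := ∞) (a := g⁻¹)).contMDiffAt
  exact ContMDiffAt.clm_comp contMDiffAt_const h3

/-- The derivative of Ad is ad. With `κ` the chart at `1` and `r x` the derivative at `1` of `z ↦ κ
(z x)`, one has `ld κ x = r x ∘ Ad x`. Differentiating at `1` gives `ld (ld κ) X Y = ld r X Y + ld
Ad X Y`, and symmetry of mixed partials identifies `ld r X Y` with `ld (ld κ) Y X`. So the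
derivative of Ad is the commutator computed in `ld_ld_comm`. -/
theorem ld_Ad_one (X Y : E) : ld (Ad E) (1 : G) X Y = br E G X Y := by
  set κ : G → E := ltCoord E 1 with hκ
  have hκ1 : ContMDiffAt 𝓘(ℝ, E) 𝓘(ℝ, E) ∞ κ 1 :=
    contMDiffAt_ltCoord (mem_ltSource_self (E := E) (1 : G))
  set r : G → E →L[ℝ] E := fun x => ld (fun z => κ (z * x)) 1 with hr
  have hH : ContDiffAt ℝ ∞ (Function.uncurry fun u v => κ (ltChart E 1 u * ltChart E 1 v))
      (basePt E G, basePt E G) := by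
    have h1 : ContMDiffAt (𝓘(ℝ, E).prod 𝓘(ℝ, E)) 𝓘(ℝ, E) ∞
        (fun p : E × E => κ (ltChart E 1 p.1 * ltChart E 1 p.2)) (basePt E G, basePt E G) := by
      refine ContMDiffAt.comp (I' := 𝓘(ℝ, E)) (g := κ) (f := fun p : E × E => ltChart E 1 p.1 * ltChart E 1 p.2)
        (basePt E G, basePt E G) (by simpa using hκ1) ?_
      exact (ContMDiffAt.comp (g := ltChart E (1 : G)) (f := fun p : E × E => p.1)
            (basePt E G, basePt E G) (contMDiffAt_ltChart (E := E) (1 : G) basePt_mem_target)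
            contMDiffAt_fst).mul
        (ContMDiffAt.comp (g := ltChart E (1 : G)) (f := fun p : E × E => p.2)
            (basePt E G, basePt E G) (contMDiffAt_ltChart (E := E) (1 : G) basePt_mem_target)
            contMDiffAt_snd)
    rw [← modelWithCornersSelf_prod, chartedSpaceSelf_prod] at h1
    exact h1.contDiffAt
  have hrd : HasFDerivAt (fun v => r (ltChart E 1 v)) (ld r 1) (basePt E G) := by
    refine DifferentiableAt.hasFDerivAt ?_
    have := ContDiffAt.fderiv (f := fun v u => κ (ltChart E 1 u * ltChart E 1 v))
      (g := fun _ => basePt E G) (x₀ := basePt E G) (m := ∞) (n := ∞)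
      (ContDiffAt.comp (f := fun p : E × E => (p.2, p.1)) (basePt E G, basePt E G) hH
        (contDiffAt_snd.prodMk contDiffAt_fst))
      contDiffAt_const le_rfl
    exact this.differentiableAt (by simp)
  have hmixed : ld r 1 X Y = ld (ld κ) 1 Y X := by
    have h1 := fderiv_fderiv_comm_of_contDiffAt hH Y X
    simp only [← ltChart_mul, mul_one] at h1
    simp only [hr, ld, ← ltChart_mul, mul_one] at h1 ⊢
    convert h1 using 6
  have hAd : HasFDerivAt (fun v => Ad E (ltChart E (1 : G) v)) (ld (Ad E) (1 : G)) (basePt E G) :=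
    hasFDerivAt_ld (contMDiff_Ad.mdifferentiable (by simp) (1 : G))
  have hprod : ld κ =ᶠ[𝓝 1] fun x => r x ∘L Ad E x := by
    filter_upwards [eventually_mdifferentiableAt hκ1] with x hx
    have h1 := ld_mul_right (f := κ) (g := 1) (h := x) (by rwa [one_mul])
    rw [one_mul] at h1
    simp only [hr]
    rw [h1]
    refine ContinuousLinearMap.ext fun v => ?_
    exact congrArg (ld κ x) (Ad_inv_Ad (E := E) x v).symm
  have h2 := ld_congr (E := E) hprod
  have h3 : ld (fun x => r x ∘L Ad E x) 1 = _ := (hrd.clm_comp hAd).fderiv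
  have h4 : r 1 = ContinuousLinearMap.id ℝ E := by simp [hr, hκ, ld_ltCoord_one]
  have h5 := DFunLike.congr_fun (DFunLike.congr_fun (h2.trans h3) X) Y
  simp [h4, hmixed] at h5
  have h6 := ld_ld_comm hκ1 X Y
  rw [h5, hκ, ld_ltCoord_one] at h6
  simpa using h6

theorem ld_Ad (g : G) (X Y : E) : ld (Ad E) g X Y = Ad E g (br E G X Y) := by
  have h1 := ld_comp_mul_left (E := E) (Ad E) g 1
  rw [mul_one] at h1
  have h2 : HasFDerivAt (fun v => Ad E (ltChart E (1 : G) v)) (ld (Ad E) (1 : G)) (basePt E G) :=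
    hasFDerivAt_ld (contMDiff_Ad.mdifferentiable (by simp) (1 : G))
  have h3 := ((hasFDerivAt_const (Ad E g) (basePt E G)).clm_comp h2).fderiv
  rw [← h1, ld]
  simp only [Ad_mul]
  rw [h3]
  simp [ld_Ad_one]

end Adjoint

/-! ### Integral curves of left-invariant fields. -/

section IntegralCurves

variable {E : Type*} [NormedAddCommGroup E] [NormedSpace ℝ E] [FiniteDimensional ℝ E]
    {G : Type*} [TopologicalSpace G] [T2Space G] [ChartedSpace E G] [Group G]
    [LieGroup 𝓘(ℝ, E) ∞ G] {F : Type*} [NormedAddCommGroup F] [NormedSpace ℝ F]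

variable (G) in
/-- The left-invariant vector field defined by a vector of the model space. -/
def liv (X : E) : Π g : G, TangentSpace 𝓘(ℝ, E) g :=
  mulInvariantVectorField (I := 𝓘(ℝ, E)) (G := G) X

theorem contMDiff_liv (X : E) :
    CMDiff 1 (fun g : G => (⟨g, liv G X g⟩ : TangentBundle 𝓘(ℝ, E) G)) := by
  have := lieGroup_minSmoothness E G
  exact (contMDiff_mulInvariantVectorField (I := 𝓘(ℝ, E)) (G := G) X).of_le (by simp)

theorem isMIntegralCurveOn_mul_left {X : E} {γ : ℝ → G} {s : Set ℝ} (g : G)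
    (hγ : IsMIntegralCurveOn γ (liv G X) s) :
    IsMIntegralCurveOn (fun t => g * γ t) (liv G X) s := by
  intro t ht
  have h1 : MDifferentiableAt 𝓘(ℝ, E) 𝓘(ℝ, E) (fun x => g * x) (γ t) :=
    (contMDiff_mul_left (I := 𝓘(ℝ, E)) (n := ∞) (a := g)).mdifferentiable (by simp) _
  have h2 := h1.hasMFDerivAt.comp_hasMFDerivWithinAt t (hγ t ht)
  refine h2.congr_mfderiv ?_
  have h3 := DFunLike.congr_fun (lt_mul (E := E) g (γ t)) X
  refine ContinuousLinearMap.ext fun c => ?_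
  refine Eq.trans ?_ (congrArg (fun w : E => (show ℝ from c) • w) h3.symm)
  exact map_smul (mfderiv 𝓘(ℝ, E) 𝓘(ℝ, E) (fun x => g * x) (γ t) : E →L[ℝ] E) (show ℝ from c)
    (lt E (γ t) X)

/-- Left translates of one local integral curve through `1` give curves with a common lifetime `ε`
through all points, which forces completeness. -/
theorem exists_isMIntegralCurve_liv (X : E) (g : G) :
    ∃ γ : ℝ → G, γ 0 = g ∧ IsMIntegralCurve γ (liv G X) := by
  obtain ⟨γ, hγ0, hγ⟩ := exists_isMIntegralCurveAt_of_contMDiffAt_boundaryless (t₀ := 0)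
    (contMDiff_liv (G := G) X).contMDiffAt (x₀ := 1)
  obtain ⟨ε, hε, h⟩ := isMIntegralCurveAt_iff'.1 hγ
  rw [Real.ball_eq_Ioo, zero_sub, zero_add] at h
  exact exists_isMIntegralCurve_of_isMIntegralCurveOn (contMDiff_liv X) hε
    (fun x => ⟨fun t => x * γ t, by simp [hγ0], isMIntegralCurveOn_mul_left x h⟩) g

theorem hasDerivAt_comp_of_isMIntegralCurve {X : E} {γ : ℝ → G}
    (hγ : IsMIntegralCurve γ (liv G X)) {f : G → F} {t : ℝ}
    (hf : MDifferentiableAt 𝓘(ℝ, E) 𝓘(ℝ, F) f (γ t)) :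
    HasDerivAt (fun s => f (γ s)) (ld f (γ t) X) t := by
  obtain ⟨A, hA, hAX⟩ : ∃ A : E →L[ℝ] F, HasMFDerivAt 𝓘(ℝ, E) 𝓘(ℝ, F) f (γ t) A ∧
      A (lt E (γ t) X) = ld f (γ t) X :=
    ⟨mfderiv 𝓘(ℝ, E) 𝓘(ℝ, F) f (γ t), hf.hasMFDerivAt, mfderiv_lt hf X⟩
  have h1 : HasFDerivAt (fun s => f (γ s)) (A ∘L
      ContinuousLinearMap.smulRight (1 : ℝ →L[ℝ] ℝ) (lt E (γ t) X)) t :=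
    hasMFDerivAt_iff_hasFDerivAt.1 (hA.comp t (hγ t))
  have h2 := h1.hasDerivAt
  rw [← hAX]
  convert h2 using 1
  simp

end IntegralCurves
end CarnotFoliation

end

/-! ### Algebra of the grading and the bracket-generating property. -/

noncomputable section

namespace CarnotFoliation

section Grading

variable {E : Type*} [NormedAddCommGroup E] [NormedSpace ℝ E] [FiniteDimensional ℝ E]
    {G : Type*} [TopologicalSpace G] [ChartedSpace E G] [Group G] [LieGroup 𝓘(ℝ, E) ∞ G]
    {r : ℕ} {layer : ℕ → Submodule ℝ E}

variable (E G) in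
/-- A Carnot grading, expressed on the model space. -/
structure IsGrading (r : ℕ) (layer : ℕ → Submodule ℝ E) : Prop where
  isInternal : DirectSum.IsInternal layer
  layer_zero : layer 0 = ⊥
  layer_of_lt : ∀ k, r < k → layer k = ⊥
  span_br : ∀ k, 1 ≤ k → k < r →
    Submodule.span ℝ {z | ∃ x ∈ layer 1, ∃ y ∈ layer k, br E G x y = z} = layer (k + 1)
  br_last : ∀ x ∈ layer 1, ∀ y ∈ layer r, br E G x y = 0

theorem bracketSpan_eq_bot_iff {𝔞 𝔟 : Submodule ℝ E} :
    bracketSpan 𝓘(ℝ, E) G 𝔞 𝔟 = ⊥ ↔ ∀ x ∈ 𝔞, ∀ y ∈ 𝔟, br E G x y = 0 := by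
  refine Submodule.span_eq_bot.trans ?_
  constructor
  · exact fun h x hx y hy => h _ ⟨x, hx, y, hy, rfl⟩
  · rintro h _ ⟨x, hx, y, hy, rfl⟩
    exact h x hx y hy

theorem IsCarnotGrading.isGrading {layer : ℕ → Submodule ℝ E}
    (h : IsCarnotGrading 𝓘(ℝ, E) G r layer) : IsGrading E G r layer where
  isInternal := h.isInternal
  layer_zero := h.layer_zero
  layer_of_lt := h.layer_of_lt
  span_br := h.bracket_layer
  br_last := bracketSpan_eq_bot_iff.1 h.bracket_last

/-- The sum of the layers whose index lies in `S`. -/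
def part (layer : ℕ → Submodule ℝ E) (S : Set ℕ) : Submodule ℝ E := ⨆ k : ℕ, ⨆ _ : k ∈ S, layer k

namespace IsGrading

theorem br_layer_one (gr : IsGrading E G r layer) {j : ℕ} {x y : E} (hx : x ∈ layer 1)
    (hy : y ∈ layer j) : br E G x y ∈ layer (1 + j) := by
  rcases Nat.eq_zero_or_pos j with rfl | hj
  · rw [gr.layer_zero, Submodule.mem_bot] at hy
    simp [hy]
  rcases lt_trichotomy j r with h | rfl | h
  · rw [add_comm, ← gr.span_br j hj h]
    exact Submodule.subset_span ⟨x, hx, y, hy, rfl⟩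
  · rw [gr.br_last x hx y hy]
    exact zero_mem _
  · rw [gr.layer_of_lt j h, Submodule.mem_bot] at hy
    simp [hy]

/-- Only brackets with the first layer are given. Layer `i + 1` is spanned by brackets `[u, v]` with
`u` in layer 1 and `v` in layer `i`, and the Jacobi identity reduces `[[u, v], y]` to brackets
already treated. -/
theorem br_layer (gr : IsGrading E G r layer) (i : ℕ) : ∀ {j : ℕ} {x y : E}, x ∈ layer i →
    y ∈ layer j → br E G x y ∈ layer (i + j) := by
  induction i with
  | zero =>
    intro j x y hx hy
    rw [gr.layer_zero, Submodule.mem_bot] at hx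
    simp [hx]
  | succ i ih =>
    intro j x y hx hy
    rcases Nat.eq_zero_or_pos i with rfl | hi
    · exact gr.br_layer_one hx hy
    rcases lt_or_ge i r with hir | hir
    · rw [← gr.span_br i hi hir] at hx
      induction hx using Submodule.span_induction with
      | mem z hz =>
        obtain ⟨u, hu, v, hv, rfl⟩ := hz
        have h1 : br E G (br E G u v) y = br E G u (br E G v y) - br E G v (br E G u y) := by
          rw [br_jacobi u v y]; abel
        rw [h1]
        refine sub_mem ?_ ?_
        · have := gr.br_layer_one hu (ih hv hy)
          rwa [show i + 1 + j = 1 + (i + j) by ring]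
        · have := ih hv (gr.br_layer_one hu hy)
          rwa [show i + 1 + j = i + (1 + j) by ring]
      | zero => simp
      | add a b _ _ ha hb => simpa using add_mem ha hb
      | smul c a _ ha => simpa using Submodule.smul_mem _ c ha
    · rw [gr.layer_of_lt (i + 1) (by omega), Submodule.mem_bot] at hx
      simp [hx]

theorem layer_le_part (layer : ℕ → Submodule ℝ E) {S : Set ℕ} {k : ℕ} (hk : k ∈ S) :
    layer k ≤ part layer S :=
  le_iSup₂_of_le k hk le_rfl

/-- Layers outside the range `1, …, r` are zero, so all index conditions may be checked inside it.
-/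
theorem part_le {S : Set ℕ} {q : Submodule ℝ E} (gr : IsGrading E G r layer)
    (h : ∀ k ∈ S, 1 ≤ k → k ≤ r → layer k ≤ q) : part layer S ≤ q := by
  refine iSup₂_le fun k hk => ?_
  rcases Nat.eq_zero_or_pos k with rfl | hk1
  · rw [gr.layer_zero]; exact bot_le
  rcases lt_or_ge r k with hr | hr
  · rw [gr.layer_of_lt k hr]; exact bot_le
  · exact h k hk hk1 hr

theorem part_mono (gr : IsGrading E G r layer) {S T : Set ℕ}
    (h : ∀ k ∈ S, 1 ≤ k → k ≤ r → k ∈ T) : part layer S ≤ part layer T :=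
  gr.part_le fun k hk h1 h2 => layer_le_part layer (h k hk h1 h2)

theorem part_univ (gr : IsGrading E G r layer) : part layer Set.univ = ⊤ := by
  simpa [part] using gr.isInternal.submodule_iSup_eq_top

theorem part_sup (S T : Set ℕ) : part layer S ⊔ part layer T = part layer (S ∪ T) := by
  simp only [part]
  exact iSup_union.symm

theorem br_part (gr : IsGrading E G r layer) {S T U : Set ℕ}
    (h : ∀ i ∈ S, ∀ j ∈ T, 1 ≤ i → 1 ≤ j → i + j ≤ r → i + j ∈ U) {x y : E}
    (hx : x ∈ part layer S) (hy : y ∈ part layer T) : br E G x y ∈ part layer U := by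
  have h1 : part layer S ≤ (part layer U).comap ((br E G).flip y).toLinearMap := by
    refine gr.part_le fun i hi hi1 _ a ha => ?_
    have h2 : part layer T ≤ (part layer U).comap (br E G a).toLinearMap := by
      refine gr.part_le fun j hj hj1 _ b hb => ?_
      have hab := gr.br_layer i ha hb
      rcases lt_or_ge r (i + j) with hr | hr
      · rw [gr.layer_of_lt _ hr, Submodule.mem_bot] at hab
        simp [hab]
      · exact layer_le_part layer (h i hi j hj hi1 hj1 hr) hab
    exact h2 hy
  exact h1 hx

theorem br_part_eq_zero (gr : IsGrading E G r layer) {S T : Set ℕ}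
    (h : ∀ i ∈ S, ∀ j ∈ T, 1 ≤ i → 1 ≤ j → r < i + j) {x y : E}
    (hx : x ∈ part layer S) (hy : y ∈ part layer T) : br E G x y = 0 := by
  have := gr.br_part (U := ∅) (fun i hi j hj hi1 hj1 hr => by
    have := h i hi j hj hi1 hj1; omega) hx hy
  simpa [part] using this

theorem bijective_coeLinearMap (gr : IsGrading E G r layer) :
    Function.Bijective (DirectSum.coeLinearMap layer) := gr.isInternal

/-- The diagonal operator that multiplies the layer of index `k` by `f k`. -/
def diag (gr : IsGrading E G r layer) (f : ℕ → ℝ) : E →L[ℝ] E :=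
  LinearMap.toContinuousLinearMap
    (DirectSum.toModule ℝ ℕ E (fun k => f k • (layer k).subtype) ∘ₗ
      (LinearEquiv.ofBijective (DirectSum.coeLinearMap layer) gr.bijective_coeLinearMap).symm.toLinearMap)

theorem diag_of_mem (gr : IsGrading E G r layer) (f : ℕ → ℝ) {k : ℕ} {x : E} (hx : x ∈ layer k) :
    gr.diag f x = f k • x := by
  have : (LinearEquiv.ofBijective (DirectSum.coeLinearMap layer) gr.bijective_coeLinearMap).symm x =
      DirectSum.lof ℝ ℕ (fun k => layer k) k ⟨x, hx⟩ := by
    rw [LinearEquiv.symm_apply_eq, LinearEquiv.ofBijective_apply]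
    exact (DirectSum.coeLinearMap_of layer k ⟨x, hx⟩).symm
  simp [diag, this]

theorem clm_ext {F : Type*} [NormedAddCommGroup F] [NormedSpace ℝ F]
    (gr : IsGrading E G r layer) {A B : E →L[ℝ] F}
    (h : ∀ k, ∀ x ∈ layer k, A x = B x) : A = B := by
  have h1 : part layer Set.univ ≤ LinearMap.eqLocus A.toLinearMap B.toLinearMap :=
    iSup₂_le fun k _ x hx => h k x hx
  rw [gr.part_univ] at h1
  ext x
  exact h1 (show x ∈ (⊤ : Submodule ℝ E) from trivial)

theorem diag_comp (gr : IsGrading E G r layer) (f g : ℕ → ℝ) :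
    gr.diag f ∘L gr.diag g = gr.diag (f * g) := by
  refine gr.clm_ext fun k x hx => ?_
  simp [gr.diag_of_mem _ hx, mul_smul, smul_comm (f k)]

theorem diag_diag (gr : IsGrading E G r layer) (f g : ℕ → ℝ) (x : E) :
    gr.diag f (gr.diag g x) = gr.diag (f * g) x := by
  rw [← gr.diag_comp]; rfl

theorem diag_one (gr : IsGrading E G r layer) : gr.diag 1 = ContinuousLinearMap.id ℝ E :=
  gr.clm_ext fun k x hx => by simp [gr.diag_of_mem _ hx]

theorem diag_add (gr : IsGrading E G r layer) (f g : ℕ → ℝ) :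
    gr.diag (f + g) = gr.diag f + gr.diag g :=
  gr.clm_ext fun k x hx => by simp [gr.diag_of_mem _ hx, add_smul]

theorem diag_congr (gr : IsGrading E G r layer) {f g : ℕ → ℝ}
    (h : ∀ k, 1 ≤ k → k ≤ r → f k = g k) : gr.diag f = gr.diag g := by
  refine gr.clm_ext fun k x hx => ?_
  rw [gr.diag_of_mem _ hx, gr.diag_of_mem _ hx]
  rcases Nat.eq_zero_or_pos k with rfl | hk1
  · rw [gr.layer_zero, Submodule.mem_bot] at hx
    simp [hx]
  rcases lt_or_ge r k with hr | hr
  · rw [gr.layer_of_lt k hr, Submodule.mem_bot] at hx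
    simp [hx]
  · rw [h k hk1 hr]

theorem diag_mem (gr : IsGrading E G r layer) {f : ℕ → ℝ} {S : Set ℕ}
    (h : ∀ k, 1 ≤ k → k ≤ r → k ∉ S → f k = 0) (x : E) : gr.diag f x ∈ part layer S := by
  have h1 : part layer Set.univ ≤ (part layer S).comap (gr.diag f).toLinearMap := by
    refine gr.part_le fun k _ hk1 hkr x hx => ?_
    change gr.diag f x ∈ part layer S
    rw [gr.diag_of_mem _ hx]
    by_cases hk : k ∈ S
    · exact Submodule.smul_mem _ _ (layer_le_part layer hk hx)
    · simp [h k hk1 hkr hk]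
  rw [gr.part_univ] at h1
  exact h1 (show x ∈ (⊤ : Submodule ℝ E) from trivial)

theorem diag_eq_of_mem (gr : IsGrading E G r layer) {f g : ℕ → ℝ} {S : Set ℕ}
    (h : ∀ k ∈ S, 1 ≤ k → k ≤ r → f k = g k) {x : E} (hx : x ∈ part layer S) :
    gr.diag f x = gr.diag g x := by
  have h1 : part layer S ≤
      LinearMap.eqLocus (gr.diag f).toLinearMap (gr.diag g).toLinearMap :=
    gr.part_le fun k hk h1 h2 x (hx : x ∈ layer k) => by
      change gr.diag f x = gr.diag g x
      rw [gr.diag_of_mem _ hx, gr.diag_of_mem _ hx, h k hk h1 h2]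
  exact h1 hx

open Classical in
/-- The projection onto the layers with index in `S`. -/
def proj (gr : IsGrading E G r layer) (S : Set ℕ) : E →L[ℝ] E := gr.diag (S.indicator 1)

theorem proj_mem (gr : IsGrading E G r layer) (S : Set ℕ) (x : E) : gr.proj S x ∈ part layer S :=
  gr.diag_mem (fun k _ _ hk => by simp [hk]) x

theorem proj_of_mem (gr : IsGrading E G r layer) {S T : Set ℕ}
    (h : ∀ k ∈ S, 1 ≤ k → k ≤ r → k ∈ T) {x : E} (hx : x ∈ part layer S) :
    gr.proj T x = x := by
  have := gr.diag_eq_of_mem (f := T.indicator 1) (g := 1)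
    (fun k hk h1 h2 => by simp [h k hk h1 h2]) hx
  rw [proj, this, gr.diag_one]; rfl

theorem proj_eq_zero (gr : IsGrading E G r layer) {S T : Set ℕ}
    (h : ∀ k ∈ S, 1 ≤ k → k ≤ r → k ∉ T) {x : E} (hx : x ∈ part layer S) :
    gr.proj T x = 0 := by
  have h1 := gr.diag_eq_of_mem (f := T.indicator 1) (g := 0)
    (fun k hk h1 h2 => by simp [h k hk h1 h2]) hx
  have h2 : gr.diag 0 = 0 := gr.clm_ext fun k x hx => by simp [gr.diag_of_mem _ hx]
  rw [proj, h1, h2]; rfl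

theorem proj_add_proj_compl (gr : IsGrading E G r layer) (S : Set ℕ) (x : E) :
    gr.proj S x + gr.proj Sᶜ x = x := by
  have h1 : gr.diag (S.indicator 1 + Sᶜ.indicator 1) = gr.diag 1 := by
    rw [Set.indicator_self_add_compl]
  rw [gr.diag_add, gr.diag_one] at h1
  exact DFunLike.congr_fun h1 x

theorem isCompl_part (gr : IsGrading E G r layer) (S : Set ℕ) :
    IsCompl (part layer S) (part layer Sᶜ) := by
  refine IsCompl.of_eq ?_ ?_
  · refine (Submodule.eq_bot_iff _).2 fun x hx => ?_
    have h1 := gr.proj_of_mem (fun k hk _ _ => hk) (Submodule.mem_inf.1 hx).1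
    rw [← h1]
    exact gr.proj_eq_zero (fun k hk _ _ => hk) (Submodule.mem_inf.1 hx).2
  · rw [part_sup, Set.union_compl_self, gr.part_univ]

/-- The derivation that multiplies the layer of index `k` by `k`. -/
def δ (gr : IsGrading E G r layer) : E →L[ℝ] E := gr.diag fun k => k

/-- The inverse of the derivation `δ`. -/
def δinv (gr : IsGrading E G r layer) : E →L[ℝ] E := gr.diag fun k => (k : ℝ)⁻¹

/-- The convention `0⁻¹ = 0` does no harm since layer 0 is zero. -/
theorem δ_δinv (gr : IsGrading E G r layer) (x : E) : gr.δ (gr.δinv x) = x := by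
  rw [δ, δinv, gr.diag_diag, gr.diag_congr (g := 1), gr.diag_one]
  · rfl
  · intro k hk _
    have : (k : ℝ) ≠ 0 := by positivity
    simp [this]

theorem δinv_δ (gr : IsGrading E G r layer) (x : E) : gr.δinv (gr.δ x) = x := by
  rw [δ, δinv, gr.diag_diag, gr.diag_congr (g := 1), gr.diag_one]
  · rfl
  · intro k hk _
    have : (k : ℝ) ≠ 0 := by positivity
    simp [this]

theorem diag_part (gr : IsGrading E G r layer) (f : ℕ → ℝ) {S : Set ℕ} {x : E}
    (hx : x ∈ part layer S) : gr.diag f x ∈ part layer S := by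
  have h1 : part layer S ≤ (part layer S).comap (gr.diag f).toLinearMap :=
    gr.part_le fun k hk _ _ x (hx : x ∈ layer k) => by
      change gr.diag f x ∈ part layer S
      rw [gr.diag_of_mem _ hx]
      exact Submodule.smul_mem _ _ (layer_le_part layer hk hx)
  exact h1 hx

theorem δ_br (gr : IsGrading E G r layer) (x y : E) :
    gr.δ (br E G x y) = br E G (gr.δ x) y + br E G x (gr.δ y) := by
  have h1 : (ContinuousLinearMap.compL ℝ E E E gr.δ) ∘L br E G = br E G ∘L gr.δ +
      ((ContinuousLinearMap.compL ℝ E E E).flip gr.δ) ∘L br E G := by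
    refine gr.clm_ext fun i a ha => gr.clm_ext fun j b hb => ?_
    simp only [ContinuousLinearMap.comp_apply, ContinuousLinearMap.compL_apply,
      add_apply, ContinuousLinearMap.flip_apply]
    simp only [δ, gr.diag_of_mem _ (gr.br_layer i ha hb), gr.diag_of_mem _ ha,
      gr.diag_of_mem _ hb, map_smul, smul_apply]
    push_cast
    rw [add_smul]
  exact DFunLike.congr_fun (DFunLike.congr_fun h1 x) y

/-- A subspace that contains the first layer and is closed under brackets with it is everything. -/
theorem eq_top_of_layer_one_le (gr : IsGrading E G r layer) {q : Submodule ℝ E}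
    (h1 : layer 1 ≤ q) (h : ∀ x ∈ layer 1, ∀ y ∈ q, br E G x y ∈ q) : q = ⊤ := by
  have h2 : ∀ k, 1 ≤ k → k ≤ r → layer k ≤ q := by
    intro k hk
    induction k, hk using Nat.le_induction with
    | base => exact fun _ => h1
    | succ k hk ih =>
      intro hkr
      rw [← gr.span_br k hk (by omega), Submodule.span_le]
      rintro _ ⟨x, hx, y, hy, rfl⟩
      exact h x hx y (ih (by omega) hy)
  rw [eq_top_iff, ← gr.part_univ]
  exact gr.part_le fun k _ hk1 hkr => h2 k hk1 hkr

/-- A smooth function that is constant in the directions of the first layer is constant. -/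
theorem ld_eq_zero {F : Type*} [NormedAddCommGroup F] [NormedSpace ℝ F]
    (gr : IsGrading E G r layer) {f : G → F} (hf : ContMDiff 𝓘(ℝ, E) 𝓘(ℝ, F) ∞ f)
    (h : ∀ g, ∀ X ∈ layer 1, ld f g X = 0) (g : G) : ld (E := E) f g = 0 := by
  -- The vectors that kill `f` at every point. For `X`, `Y` in `q` the derivative along `[X, Y]` is
  -- a commutator of derivatives of zero functions, so `q` is closed under brackets and contains the
  -- generators.
  let q : Submodule ℝ E := ⨅ g : G, LinearMap.ker (ld (E := E) f g).toLinearMap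
  have hq : ∀ X : E, X ∈ q ↔ ∀ g, ld f g X = 0 := by simp [q]
  have hA : ∀ g, MDifferentiableAt 𝓘(ℝ, E) 𝓘(ℝ, E →L[ℝ] F) (ld (E := E) f) g := fun g =>
    (contMDiffAt_ld (hf g)).mdifferentiableAt (by simp)
  have h0 : ∀ X ∈ q, ∀ (Y : E) (g : G), ld (ld (E := E) f) g Y X = 0 := by
    intro X hX Y g
    rw [← ld_clm_apply (hA g)]
    have : (fun h => ld f h X) = fun _ : G => (0 : F) := funext ((hq X).1 hX)
    rw [this]
    simp [ld]
  have : q = ⊤ := by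
    refine gr.eq_top_of_layer_one_le (fun X (hX : X ∈ layer 1) => (hq X).2 fun g => h g X hX) ?_
    intro X hX Y hY
    have hX' : X ∈ q := (hq X).2 fun g => h g X hX
    refine (hq _).2 fun g => ?_
    rw [← ld_ld_comm (hf g), h0 X hX', h0 Y hY, sub_zero]
  ext X
  exact (hq X).1 (this ▸ Submodule.mem_top) g

end IsGrading

end Grading

end CarnotFoliation

end

/-! ### Rules for left derivatives; inverting a local diffeomorphism with a section. -/

noncomputable section

namespace CarnotFoliation

section LeftDerivativeRules

variable {E : Type*} [NormedAddCommGroup E] [NormedSpace ℝ E] [FiniteDimensional ℝ E]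
    {G : Type*} [TopologicalSpace G] [ChartedSpace E G] [Group G] [LieGroup 𝓘(ℝ, E) ∞ G]
    {F : Type*} [NormedAddCommGroup F] [NormedSpace ℝ F]
    {F' : Type*} [NormedAddCommGroup F'] [NormedSpace ℝ F']

theorem ld_clm_comp (A : F →L[ℝ] F') {f : G → F} {g : G}
    (hf : MDifferentiableAt 𝓘(ℝ, E) 𝓘(ℝ, F) f g) :
    ld (fun x => A (f x)) g = A ∘L ld (E := E) f g :=
  (A.hasFDerivAt.comp (basePt E G) (hasFDerivAt_ld hf)).fderiv

theorem ld_sub {f f' : G → F} {g : G} (hf : MDifferentiableAt 𝓘(ℝ, E) 𝓘(ℝ, F) f g)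
    (hf' : MDifferentiableAt 𝓘(ℝ, E) 𝓘(ℝ, F) f' g) :
    ld (fun x => f x - f' x) g = ld (E := E) f g - ld f' g :=
  ((hasFDerivAt_ld hf).sub (hasFDerivAt_ld hf')).fderiv

theorem ld_const (a : F) (g : G) : ld (E := E) (fun _ : G => a) g = 0 := by
  simp [ld]

theorem ld_comp_clm {A : G → F →L[ℝ] F'} {g : G} (B : E →L[ℝ] F)
    {C : G → E →L[ℝ] F'} (hC : C = fun x => A x ∘L B)
    (hA : MDifferentiableAt 𝓘(ℝ, E) 𝓘(ℝ, F →L[ℝ] F') A g) (X Y : E) :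
    ld C g X Y = ld A g X (B Y) := by
  subst hC
  have h1 := ((hasFDerivAt_ld hA).clm_comp (hasFDerivAt_const B (basePt E G))).fderiv
  rw [ld, h1]
  simp

theorem mdifferentiableAt_Ad (g : G) :
    MDifferentiableAt 𝓘(ℝ, E) 𝓘(ℝ, E →L[ℝ] E) (Ad E : G → E →L[ℝ] E) g :=
  contMDiff_Ad.mdifferentiable (by simp) g

theorem ld_Ad_apply (g : G) (X w : E) :
    ld (fun x => Ad E x w) g X = Ad E g (br E G X w) := by
  rw [ld_clm_apply (mdifferentiableAt_Ad g), ld_Ad]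

theorem mdifferentiableAt_Ad_apply (w : E) (g : G) :
    MDifferentiableAt 𝓘(ℝ, E) 𝓘(ℝ, E) (fun x : G => Ad E x w) g :=
  (mdifferentiableAt_Ad g).clm_apply mdifferentiableAt_const

theorem continuous_Ad : Continuous (Ad E : G → E →L[ℝ] E) := contMDiff_Ad.continuous

/-- The inverse function theorem: an injective endomorphism of a finite-dimensional space is
invertible, so `f` is a local coordinate at `g` and determines the chart smoothly. -/
theorem ltCoord_eq_comp_of_bijective {f : G → E} {g : G}
    (hf : ContMDiffAt 𝓘(ℝ, E) 𝓘(ℝ, E) ∞ f g) (hb : Function.Injective (ld (E := E) f g)) :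
    ∃ ψ : E → E, ContDiffAt ℝ ∞ ψ (f g) ∧ ∀ᶠ x in 𝓝 g, ltCoord E g x = ψ (f x) := by
  let A : E ≃L[ℝ] E := (LinearEquiv.ofInjectiveEndo (ld (E := E) f g).toLinearMap hb).toContinuousLinearEquiv
  have hA : HasFDerivAt (fun u => f (ltChart E g u)) (A : E →L[ℝ] E) (basePt E G) := by
    convert hasFDerivAt_ld (hf.mdifferentiableAt (by simp))
    ext x
    rfl
  have h1 := contMDiffAt_iff_ltChart_basePt.1 hf
  refine ⟨h1.localInverse hA (by simp), ?_, ?_⟩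
  · have := h1.to_localInverse hA (by simp)
    rwa [ltChart_basePt] at this
  · have h2 := (h1.hasStrictFDerivAt' hA (by simp)).eventually_left_inverse
    have h3 : Filter.Tendsto (ltCoord E g) (𝓝 g) (𝓝 (basePt E G)) := by
      have := (contMDiffAt_ltCoord (mem_ltSource_self (E := E) g)).continuousAt.tendsto
      rwa [ltCoord_self] at this
    filter_upwards [h3.eventually h2, (isOpen_ltSource (E := E) g).mem_nhds (mem_ltSource_self g)]
      with x hx hx'
    rw [ltChart_ltCoord hx'] at hx
    exact hx.symm

/-- The inverse of a smooth map with injective derivatives is smooth if it is continuous. -/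
theorem contMDiff_of_rightInverse {f : G → E} (hf : ContMDiff 𝓘(ℝ, E) 𝓘(ℝ, E) ∞ f)
    (hb : ∀ g, Function.Injective (ld (E := E) f g)) {s : E → G} (hs : Continuous s)
    (hfs : ∀ w, f (s w) = w) : ContMDiff 𝓘(ℝ, E) 𝓘(ℝ, E) ∞ s := by
  intro w
  obtain ⟨ψ, hψ, h⟩ := ltCoord_eq_comp_of_bijective (hf (s w)) (hb (s w))
  rw [hfs] at hψ
  have h1 : s =ᶠ[𝓝 w] fun v => ltChart E (s w) (ψ v) := by
    filter_upwards [(hs.tendsto w).eventually h, (hs.tendsto w).eventually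
      ((isOpen_ltSource (E := E) (s w)).mem_nhds (mem_ltSource_self (s w)))] with v hv hv'
    rw [hfs] at hv
    rw [← hv, ltChart_ltCoord hv']
  refine ContMDiffAt.congr_of_eventuallyEq ?_ h1
  refine ContMDiffAt.comp (I' := 𝓘(ℝ, E)) (g := ltChart E (s w)) (f := ψ) w ?_ hψ.contMDiffAt
  have h2 := h.self_of_nhds
  rw [hfs, ltCoord_self] at h2
  rw [← h2]
  exact contMDiffAt_ltChart _ basePt_mem_target

/-- A continuous section of a local diffeomorphism from a connected space is surjective. -/
theorem leftInverse_of_rightInverse [T2Space G] [PreconnectedSpace G] {f : G → E}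
    (hf : ContMDiff 𝓘(ℝ, E) 𝓘(ℝ, E) ∞ f)
    (hb : ∀ g, Function.Injective (ld (E := E) f g)) {s : E → G} (hs : Continuous s)
    (hfs : ∀ w, f (s w) = w) (g : G) : s (f g) = g := by
  have hcont : Continuous fun x => s (f x) := hs.comp hf.continuous
  have hclosed : IsClosed {x | s (f x) = x} := isClosed_eq hcont continuous_id
  -- Near a fixed point of `s ∘ f` both `y` and `s (f y)` lie where `f` is injective, and `f` takes
  -- the same value on them.
  have hopen : IsOpen {x | s (f x) = x} := by
    rw [isOpen_iff_mem_nhds]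
    intro x hx
    obtain ⟨ψ, -, h⟩ := ltCoord_eq_comp_of_bijective (hf x) (hb x)
    have h1 := h.and ((isOpen_ltSource (E := E) x).mem_nhds (mem_ltSource_self x))
    have h2 := hcont.tendsto x
    rw [show s (f x) = x from hx] at h2
    filter_upwards [h1, h2.eventually h1] with y hy hy'
    have := hy'.1
    rw [hfs, ← hy.1] at this
    have h3 := congrArg (ltChart E x) this
    rwa [ltChart_ltCoord hy'.2, ltChart_ltCoord hy.2] at h3
  have huniv := IsClopen.eq_univ ⟨hclosed, hopen⟩ ⟨s 0, by simp [hfs]⟩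
  exact (Set.eq_univ_iff_forall.1 huniv) g

end LeftDerivativeRules

/-! ### The crossed homomorphism `coord` as a global diffeomorphism. -/

section Coordinates

namespace IsGrading

variable {E : Type*} [NormedAddCommGroup E] [NormedSpace ℝ E] [FiniteDimensional ℝ E]
    {G : Type*} [TopologicalSpace G] [T2Space G] [SimplyConnectedSpace G] [ChartedSpace E G]
    [Group G] [LieGroup 𝓘(ℝ, E) ∞ G]
    {r : ℕ} {layer : ℕ → Submodule ℝ E}

/-- Since the derivative of Ad is `Ad g ∘ ad`, closedness of `Ad g ∘ δ` reads `[X, δ Y] - [Y, δ X] =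
δ [X, Y]`: the derivation property of `δ`. -/
theorem exists_coord (gr : IsGrading E G r layer) :
    ∃ c : G → E, ContMDiff 𝓘(ℝ, E) 𝓘(ℝ, E) ∞ c ∧ ∀ g, ld c g = Ad E g ∘L gr.δ := by
  have := FiniteDimensional.complete ℝ E
  refine exists_ld_eq (A := fun g : G => Ad E g ∘L gr.δ)
    (contMDiff_Ad.clm_comp contMDiff_const) fun g X Y => ?_
  rw [ld_comp_clm gr.δ rfl (mdifferentiableAt_Ad g), ld_comp_clm gr.δ rfl (mdifferentiableAt_Ad g),
    ld_Ad, ld_Ad, ← map_sub, ContinuousLinearMap.comp_apply, δ_br, br_swap Y]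
  congr 1
  abel

/-- The crossed homomorphism `c : G → 𝔤` integrating the derivation `δ`. -/
def coord (gr : IsGrading E G r layer) (g : G) : E :=
  gr.exists_coord.choose g - gr.exists_coord.choose 1

theorem contMDiff_coord (gr : IsGrading E G r layer) :
    ContMDiff 𝓘(ℝ, E) 𝓘(ℝ, E) ∞ (gr.coord : G → E) :=
  gr.exists_coord.choose_spec.1.sub contMDiff_const

theorem ld_coord (gr : IsGrading E G r layer) (g : G) : ld gr.coord g = Ad E g ∘L gr.δ := by
  have h := ld_sub (gr.exists_coord (G := G).choose_spec.1.mdifferentiable (by simp) g)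
    (mdifferentiableAt_const (c := gr.exists_coord.choose (1 : G)))
  rw [ld_const, sub_zero, gr.exists_coord.choose_spec.2] at h
  exact h

@[simp]
theorem coord_one (gr : IsGrading E G r layer) : gr.coord (1 : G) = 0 := by simp [coord]

theorem mdifferentiableAt_coord (gr : IsGrading E G r layer) (g : G) :
    MDifferentiableAt 𝓘(ℝ, E) 𝓘(ℝ, E) (gr.coord : G → E) g :=
  gr.contMDiff_coord.mdifferentiable (by simp) g

theorem ld_coord_injective (gr : IsGrading E G r layer) (g : G) :
    Function.Injective (ld (E := E) gr.coord g) := by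
  refine Function.LeftInverse.injective (g := fun X => gr.δinv (Ad E g⁻¹ X)) fun X => ?_
  simp [ld_coord, δinv_δ]

/-- As functions of `h`, both sides have left derivative `Ad (g * h) ∘ δ` and they agree at `1`. -/
theorem coord_mul (gr : IsGrading E G r layer) (g h : G) :
    gr.coord (g * h) = gr.coord g + Ad E g (gr.coord h) := by
  have hm : ∀ x, MDifferentiableAt 𝓘(ℝ, E) 𝓘(ℝ, E) (fun x => gr.coord (g * x)) x := fun x =>
    (gr.contMDiff_coord.comp (contMDiff_mul_left (I := 𝓘(ℝ, E)) (n := ∞) (a := g))).mdifferentiable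
      (by simp) x
  have hm' : ∀ x, MDifferentiableAt 𝓘(ℝ, E) 𝓘(ℝ, E) (fun x => Ad E g (gr.coord x)) x := fun x =>
    MDifferentiableAt.clm_apply mdifferentiableAt_const (gr.mdifferentiableAt_coord x)
  have h1 := eq_of_ld_eq_zero (E := E) (f := fun x => gr.coord (g * x) - Ad E g (gr.coord x))
    (fun x => (hm x).sub (hm' x)) (fun x => by
      rw [ld_sub (hm x) (hm' x), ld_comp_mul_left, ld_clm_comp _ (gr.mdifferentiableAt_coord x),
        ld_coord, ld_coord, Ad_mul, ContinuousLinearMap.comp_assoc, sub_self]) h 1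
  simp only [mul_one, coord_one, map_zero, sub_zero] at h1
  rw [← h1]; abel

theorem mem_compl_of_proj_eq_zero (gr : IsGrading E G r layer) {S : Set ℕ} {x : E}
    (hx : gr.proj S x = 0) : x ∈ part layer Sᶜ := by
  have h := gr.proj_add_proj_compl S x
  rw [hx, zero_add] at h
  rw [← h]
  exact gr.proj_mem _ _

theorem δ_mem (gr : IsGrading E G r layer) {S : Set ℕ} {x : E} (hx : x ∈ part layer S) :
    gr.δ x ∈ part layer S := gr.diag_part _ hx

theorem δinv_mem (gr : IsGrading E G r layer) {S : Set ℕ} {x : E} (hx : x ∈ part layer S) :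
    gr.δinv x ∈ part layer S := gr.diag_part _ hx

/-- The terms of the descending filtration defined by the grading. -/
abbrev filt (layer : ℕ → Submodule ℝ E) (j : ℕ) : Submodule ℝ E := part layer {k | j ≤ k}

theorem filt_mono (gr : IsGrading E G r layer) {i j : ℕ} (h : i ≤ j) :
    filt layer j ≤ filt layer i :=
  gr.part_mono fun _ hk _ _ => h.trans hk

theorem compl_setOf_le (j : ℕ) : {k : ℕ | k ≤ j}ᶜ = {k | j + 1 ≤ k} := by
  ext k; simp

theorem br_mem_filt (gr : IsGrading E G r layer) {j : ℕ} (X : E) {w : E} (hw : w ∈ filt layer j) :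
    br E G X w ∈ filt layer (j + 1) := by
  refine gr.br_part (S := Set.univ) (fun i _ k hk hi _ _ => ?_) (by rw [gr.part_univ]; trivial) hw
  simp only [Set.mem_ofPred_eq] at hk ⊢
  omega

theorem proj_filt_eq_zero (gr : IsGrading E G r layer) {j : ℕ} {w : E}
    (hw : w ∈ filt layer (j + 1)) : gr.proj {k | k ≤ j} w = 0 :=
  gr.proj_eq_zero (fun k hk _ _ => by simp only [Set.mem_ofPred_eq] at hk ⊢; omega) hw

theorem mem_filt_of_proj_eq_zero (gr : IsGrading E G r layer) {j : ℕ} {w : E}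
    (hw : gr.proj {k | k ≤ j} w = 0) : w ∈ filt layer (j + 1) := by
  rw [filt, ← compl_setOf_le]
  exact gr.mem_compl_of_proj_eq_zero hw

theorem filt_eq_bot (gr : IsGrading E G r layer) {j : ℕ} (hj : r < j) : filt layer j = ⊥ :=
  bot_unique (gr.part_le fun k hk _ hkr => by simp only [Set.mem_ofPred_eq] at hk; omega)

/-- Unipotence of Ad, by descending induction on `j`. The derivative of `g ↦ Ad g w` along `X` is
`Ad g [X, w]`, where `[X, w]` is one step deeper in the filtration; by induction it stays there, so
the components of `Ad g w` of index at most `j` are constant. -/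
theorem Ad_sub_mem (gr : IsGrading E G r layer) (g : G) (j : ℕ) {w : E}
    (hw : w ∈ filt layer j) : Ad E g w - w ∈ filt layer (j + 1) := by
  induction hn : r + 1 - j generalizing j w g with
  | zero =>
    rw [gr.filt_eq_bot (by omega), Submodule.mem_bot] at hw
    simp [hw]
  | succ n ih =>
    refine gr.mem_filt_of_proj_eq_zero ?_
    have hm := fun x : G => mdifferentiableAt_Ad_apply (E := E) w x
    have hm' : ∀ x : G, MDifferentiableAt 𝓘(ℝ, E) 𝓘(ℝ, E) (fun x => Ad E x w - w) x := fun x =>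
      (hm x).sub mdifferentiableAt_const
    have h1 := eq_of_ld_eq_zero (E := E)
      (f := fun x : G => gr.proj {k | k ≤ j} (Ad E x w - w))
      (fun x => MDifferentiableAt.clm_apply mdifferentiableAt_const (hm' x)) (fun x => by
        rw [ld_clm_comp _ (hm' x), ld_sub (hm x) mdifferentiableAt_const, ld_const, sub_zero]
        ext X
        have h2 := gr.br_mem_filt X hw
        have h3 := ih x (j + 1) h2 (by omega)
        have h4 := add_mem h2 (gr.filt_mono (Nat.le_succ _) h3)
        rw [add_sub_cancel] at h4
        rw [ContinuousLinearMap.comp_apply, ld_Ad_apply]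
        exact gr.proj_filt_eq_zero h4) g 1
    simpa using h1

theorem Ad_mem_filt (gr : IsGrading E G r layer) (g : G) {j : ℕ} {w : E}
    (hw : w ∈ filt layer j) : Ad E g w ∈ filt layer j := by
  have := add_mem hw (gr.filt_mono (Nat.le_succ _) (gr.Ad_sub_mem g j hw))
  rwa [add_sub_cancel] at this

theorem hasDerivAt_coord (gr : IsGrading E G r layer) {Y : E} {γ : ℝ → G}
    (hγ : IsMIntegralCurve γ (liv G Y)) (t : ℝ) :
    HasDerivAt (fun t => gr.coord (γ t)) (Ad E (γ t) (gr.δ Y)) t := by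
  have := hasDerivAt_comp_of_isMIntegralCurve hγ (gr.mdifferentiableAt_coord (γ t))
  rwa [ld_coord] at this

theorem eq_add_smul_of_hasDerivAt {f : ℝ → E} {v : E} (hf : ∀ t, HasDerivAt f v t) (t : ℝ) :
    f t = f 0 + t • v := by
  have h1 : ∀ t, HasDerivAt (fun t => f t - t • v) 0 t := fun t => by
    have := (hf t).sub ((hasDerivAt_id t).smul_const v)
    rw [one_smul, sub_self] at this
    exact this
  have h2 := is_const_of_deriv_eq_zero (f := fun t => f t - t • v)
    (fun t => (h1 t).differentiableAt) (fun t => (h1 t).deriv) t 0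
  simp only [zero_smul, sub_zero] at h2
  rw [← h2]; abel

/-- The velocity of `coord` along the curve is `Ad (γ t) (δ Y)`, congruent to the constant `δ Y`
modulo the next filtration step. -/
theorem coord_integralCurve_sub_mem (gr : IsGrading E G r layer) {j : ℕ} {Y : E} {γ : ℝ → G}
    (hY : Y ∈ filt layer j) (h0 : γ 0 = 1) (hγ : IsMIntegralCurve γ (liv G Y)) (t : ℝ) :
    gr.coord (γ t) - t • gr.δ Y ∈ filt layer (j + 1) := by
  refine gr.mem_filt_of_proj_eq_zero ?_
  have h1 := eq_add_smul_of_hasDerivAt (f := fun t => gr.proj {k | k ≤ j} (gr.coord (γ t)))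
    (v := gr.proj {k | k ≤ j} (gr.δ Y)) (fun s => by
      have h2 := (gr.proj {k | k ≤ j}).hasFDerivAt.comp_hasDerivAt s (gr.hasDerivAt_coord hγ s)
      have h3 := gr.proj_filt_eq_zero (gr.Ad_sub_mem (γ s) j (gr.δ_mem hY))
      rw [map_sub, sub_eq_zero] at h3
      rw [← h3]
      exact h2) t
  simp only [h0, coord_one, map_zero, zero_add] at h1
  rw [map_sub, map_smul, h1, sub_self]

/-- A product of one-parameter curves run for times `a i w`. Since Ad is trivial on successive
quotients of the filtration, `coord` is additive on such products modulo the next step. -/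
theorem exists_section_mod (gr : IsGrading E G r layer) (j : ℕ) {ι : Type*} (s : Finset ι)
    (a : ι → E → ℝ) (ha : ∀ i, Continuous (a i)) (Y : ι → E) (hY : ∀ i, Y i ∈ filt layer j) :
    ∃ ρ : E → G, Continuous ρ ∧
      ∀ w, gr.coord (ρ w) - ∑ i ∈ s, a i w • gr.δ (Y i) ∈ filt layer (j + 1) := by
  classical
  have : IsTopologicalGroup G := topologicalGroup_of_lieGroup 𝓘(ℝ, E) ∞
  induction s using Finset.induction_on with
  | empty => exact ⟨fun _ => 1, continuous_const, by simp⟩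
  | insert i s hi ih =>
    obtain ⟨ρ, hρ, h⟩ := ih
    obtain ⟨γ, hγ0, hγ⟩ := exists_isMIntegralCurve_liv (Y i) (1 : G)
    refine ⟨fun w => ρ w * γ (a i w), hρ.mul (hγ.continuous.comp (ha i)), fun w => ?_⟩
    have h1 := gr.coord_integralCurve_sub_mem (hY i) hγ0 hγ (a i w)
    have h2 : gr.coord (γ (a i w)) ∈ filt layer j := by
      have := add_mem (gr.filt_mono (Nat.le_succ j) h1)
        (Submodule.smul_mem _ (a i w) (gr.δ_mem (hY i)))
      rwa [sub_add_cancel] at this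
    have h3 := gr.Ad_sub_mem (ρ w) j h2
    rw [Finset.sum_insert hi, coord_mul]
    have := add_mem (add_mem (h w) h1) h3
    convert this using 1
    abel

/-- Successive correction: `ρ w` reaches `w` up to an error in the next filtration step, and a
deeper section removes it. The error is first twisted by `Ad (ρ w)⁻¹` to undo the twist in the
crossed homomorphism law. -/
theorem exists_section_filt (gr : IsGrading E G r layer) (j : ℕ) :
    ∃ σ : E → G, Continuous σ ∧ ∀ w ∈ filt layer j, gr.coord (σ w) = w := by
  have : IsTopologicalGroup G := topologicalGroup_of_lieGroup 𝓘(ℝ, E) ∞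
  induction hn : r + 1 - j generalizing j with
  | zero =>
    refine ⟨fun _ => 1, continuous_const, fun w hw => ?_⟩
    rw [gr.filt_eq_bot (by omega), Submodule.mem_bot] at hw
    simp [hw]
  | succ n ih =>
    obtain ⟨σ, hσ, h⟩ := ih (j + 1) (by omega)
    let b := Module.finBasis ℝ E
    obtain ⟨ρ, hρ, h'⟩ := gr.exists_section_mod (G := G) j Finset.univ (fun i w => b.repr w i)
      (fun i => (LinearMap.toContinuousLinearMap (b.coord i)).continuous)
      -- The projection puts the directions into the filtration step, and `δinv` compensates for the
      -- `δ` in the velocity of `coord`.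
      (fun i => gr.δinv (gr.proj {k | j ≤ k} (b i)))
      (fun i => gr.δinv_mem (gr.proj_mem _ _))
    have h2 : ∀ w ∈ filt layer j, gr.coord (ρ w) - w ∈ filt layer (j + 1) := by
      intro w hw
      convert h' w using 2
      simp only [δ_δinv, ← map_smul, ← map_sum]
      rw [b.sum_repr, gr.proj_of_mem (fun k hk _ _ => hk) hw]
    refine ⟨fun w => ρ w * σ (Ad E (ρ w)⁻¹ (w - gr.coord (ρ w))), hρ.mul (hσ.comp ?_), ?_⟩
    · exact (continuous_Ad.comp hρ.inv).clm_apply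
        (continuous_id.sub (gr.contMDiff_coord.continuous.comp hρ))
    · intro w hw
      have h3 : w - gr.coord (ρ w) ∈ filt layer (j + 1) := by
        rw [← neg_sub]; exact neg_mem (h2 w hw)
      rw [coord_mul, h _ (gr.Ad_mem_filt _ h3), Ad_Ad_inv]
      abel

theorem exists_section (gr : IsGrading E G r layer) :
    ∃ σ : E → G, Continuous σ ∧ ∀ w, gr.coord (σ w) = w := by
  obtain ⟨σ, hσ, h⟩ := gr.exists_section_filt (G := G) 0
  refine ⟨σ, hσ, fun w => h w ?_⟩
  have hw : w ∈ part layer Set.univ := by rw [gr.part_univ]; trivial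
  exact gr.part_mono (fun k _ _ _ => Nat.zero_le k) hw

/-- The inverse of `coord`. -/
def coordSymm (gr : IsGrading E G r layer) : E → G := gr.exists_section.choose

@[simp]
theorem coord_coordSymm (gr : IsGrading E G r layer) (w : E) :
    gr.coord (gr.coordSymm w : G) = w := gr.exists_section.choose_spec.2 w

@[simp]
theorem coordSymm_coord (gr : IsGrading E G r layer) (g : G) :
    gr.coordSymm (gr.coord g) = g :=
  leftInverse_of_rightInverse gr.contMDiff_coord gr.ld_coord_injective
    gr.exists_section.choose_spec.1 gr.coord_coordSymm g

theorem contMDiff_coordSymm (gr : IsGrading E G r layer) :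
    ContMDiff 𝓘(ℝ, E) 𝓘(ℝ, E) ∞ (gr.coordSymm : E → G) :=
  contMDiff_of_rightInverse gr.contMDiff_coord gr.ld_coord_injective
    gr.exists_section.choose_spec.1 gr.coord_coordSymm

theorem coord_injective (gr : IsGrading E G r layer) :
    Function.Injective (gr.coord : G → E) :=
  Function.LeftInverse.injective gr.coordSymm_coord

end IsGrading

end Coordinates

end CarnotFoliation

end

/-! ### The exponential on the abelian ideal and the adapted coordinates `theta`. -/

noncomputable section

namespace CarnotFoliation

namespace IsGrading

variable {E : Type*} [NormedAddCommGroup E] [NormedSpace ℝ E] [FiniteDimensional ℝ E]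
    {G : Type*} [TopologicalSpace G] [T2Space G] [SimplyConnectedSpace G] [ChartedSpace E G]
    [Group G] [LieGroup 𝓘(ℝ, E) ∞ G]
    {r : ℕ} {layer : ℕ → Submodule ℝ E}

/-- The abelian ideal formed by the layers of index greater than `⌊r / 2⌋`. -/
abbrev highIdeal (r : ℕ) (layer : ℕ → Submodule ℝ E) : Submodule ℝ E := filt layer (r / 2 + 1)

theorem br_highIdeal_highIdeal (gr : IsGrading E G r layer) {Y Z : E}
    (hY : Y ∈ highIdeal r layer) (hZ : Z ∈ highIdeal r layer) : br E G Y Z = 0 :=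
  gr.br_part_eq_zero (fun i hi j hj _ _ => by
    simp only [Set.mem_ofPred_eq] at hi hj; omega) hY hZ

theorem br_mem_highIdeal (gr : IsGrading E G r layer) (X : E) {Y : E}
    (hY : Y ∈ highIdeal r layer) : br E G Y X ∈ highIdeal r layer := by
  rw [br_swap]
  exact neg_mem (gr.filt_mono (Nat.le_succ _) (gr.br_mem_filt X hY))

/-- The exponential map, on the abelian ideal `highIdeal`. -/
def ex (gr : IsGrading E G r layer) (Y : E) : G := gr.coordSymm (gr.δ Y)

@[simp]
theorem coord_ex (gr : IsGrading E G r layer) (Y : E) : gr.coord (gr.ex Y : G) = gr.δ Y := by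
  simp [ex]

@[simp]
theorem ex_zero (gr : IsGrading E G r layer) : gr.ex 0 = (1 : G) :=
  gr.coord_injective (by simp)

theorem contMDiff_ex (gr : IsGrading E G r layer) :
    ContMDiff 𝓘(ℝ, E) 𝓘(ℝ, E) ∞ (gr.ex : E → G) :=
  gr.contMDiff_coordSymm.comp (gr.δ : E →L[ℝ] E).contDiff.contMDiff

/-- The exponential series of `ad Y` stops after the linear term: `[Y, w]` lies in the abelian ideal
again, so `[Y, [Y, w]] = 0`. -/
theorem Ad_integralCurve (gr : IsGrading E G r layer) {Y : E} (hY : Y ∈ highIdeal r layer)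
    {γ : ℝ → G} (h0 : γ 0 = 1) (hγ : IsMIntegralCurve γ (liv G Y)) (w : E) (t : ℝ) :
    Ad E (γ t) w = w + t • br E G Y w := by
  have hd : ∀ (v : E) (s : ℝ),
      HasDerivAt (fun t => Ad E (γ t) v) (Ad E (γ s) (br E G Y v)) s := fun v s => by
    have := hasDerivAt_comp_of_isMIntegralCurve hγ (mdifferentiableAt_Ad_apply (E := E) v (γ s))
    rwa [ld_Ad_apply] at this
  have h1 : ∀ s, Ad E (γ s) (br E G Y w) = br E G Y w := fun s => by
    have := eq_add_smul_of_hasDerivAt (f := fun t => Ad E (γ t) (br E G Y w)) (v := 0)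
      (fun s => by
        have := hd (br E G Y w) s
        rwa [gr.br_highIdeal_highIdeal hY (gr.br_mem_highIdeal w hY), map_zero] at this) s
    simpa [h0] using this
  have h2 := eq_add_smul_of_hasDerivAt (f := fun t => Ad E (γ t) w) (v := br E G Y w)
    (fun s => by
      have := hd w s
      rwa [h1] at this) t
  simpa [h0] using h2

/-- Along the curve `Ad` fixes `δ Y`, so `coord` moves with constant velocity. This identifies `ex`
with the exponential used to define `connectedSubgroup`. -/
theorem integralCurve_eq_ex (gr : IsGrading E G r layer) {Y : E} (hY : Y ∈ highIdeal r layer)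
    {γ : ℝ → G} (h0 : γ 0 = 1) (hγ : IsMIntegralCurve γ (liv G Y)) (t : ℝ) :
    γ t = gr.ex (t • Y) := by
  refine gr.coord_injective ?_
  have h2 := eq_add_smul_of_hasDerivAt (f := fun t => gr.coord (γ t)) (v := gr.δ Y)
    (fun s => by
      have := gr.hasDerivAt_coord hγ s
      rwa [gr.Ad_integralCurve hY h0 hγ, gr.br_highIdeal_highIdeal hY (gr.δ_mem hY), smul_zero,
        add_zero] at this) t
  simpa [h0] using h2

theorem isMIntegralCurve_ex (gr : IsGrading E G r layer) {Y : E} (hY : Y ∈ highIdeal r layer) :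
    IsMIntegralCurve (fun t : ℝ => gr.ex (t • Y)) (liv G Y) := by
  obtain ⟨γ, h0, hγ⟩ := exists_isMIntegralCurve_liv Y (1 : G)
  rwa [← funext (gr.integralCurve_eq_ex hY h0 hγ)]

theorem Ad_ex (gr : IsGrading E G r layer) {Y : E} (hY : Y ∈ highIdeal r layer) (w : E) :
    Ad E (gr.ex Y : G) w = w + br E G Y w := by
  simpa using gr.Ad_integralCurve hY (by simp) (gr.isMIntegralCurve_ex hY) w 1

theorem ex_add (gr : IsGrading E G r layer) {Y Z : E} (hY : Y ∈ highIdeal r layer)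
    (hZ : Z ∈ highIdeal r layer) : (gr.ex (Y + Z) : G) = gr.ex Y * gr.ex Z := by
  refine gr.coord_injective ?_
  rw [coord_mul, coord_ex, coord_ex, coord_ex, gr.Ad_ex hY,
    gr.br_highIdeal_highIdeal hY (gr.δ_mem hZ), map_add, add_zero]

theorem ex_neg (gr : IsGrading E G r layer) {Y : E} (hY : Y ∈ highIdeal r layer) :
    (gr.ex (-Y) : G) = (gr.ex Y)⁻¹ := by
  rw [eq_inv_iff_mul_eq_one, ← gr.ex_add (neg_mem hY) hY, neg_add_cancel, ex_zero]

/-- The ideal is abelian, so the exponentials of a subspace already form a subgroup and no products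
are needed. -/
theorem mem_connectedSubgroup_iff (gr : IsGrading E G r layer) {𝔨 : Submodule ℝ E}
    (h𝔨 : 𝔨 ≤ highIdeal r layer) {x : G} :
    x ∈ connectedSubgroup (I := 𝓘(ℝ, E)) (G := G) 𝔨 ↔ ∃ Y ∈ 𝔨, gr.ex Y = x := by
  have h : {x : G | ∃ v ∈ 𝔨, ∃ γ : ℝ → G, γ 0 = 1 ∧ IsMIntegralCurve γ (liv G v) ∧ γ 1 = x} =
      {x : G | ∃ Y ∈ 𝔨, gr.ex Y = x} := by
    ext x
    constructor
    · rintro ⟨v, hv, γ, h0, hγ, rfl⟩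
      exact ⟨v, hv, by simpa using (gr.integralCurve_eq_ex (h𝔨 hv) h0 hγ 1).symm⟩
    · rintro ⟨v, hv, rfl⟩
      exact ⟨v, hv, _, by simp, gr.isMIntegralCurve_ex (h𝔨 hv), by simp⟩
  let K : Subgroup G :=
    { carrier := {x : G | ∃ Y ∈ 𝔨, gr.ex Y = x}
      one_mem' := ⟨0, zero_mem _, gr.ex_zero⟩
      mul_mem' := by
        rintro _ _ ⟨Y, hY, rfl⟩ ⟨Z, hZ, rfl⟩
        exact ⟨Y + Z, add_mem hY hZ, gr.ex_add (h𝔨 hY) (h𝔨 hZ)⟩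
      inv_mem' := by
        rintro _ ⟨Y, hY, rfl⟩
        exact ⟨-Y, neg_mem hY, gr.ex_neg (h𝔨 hY)⟩ }
  have h1 : connectedSubgroup (I := 𝓘(ℝ, E)) (G := G) 𝔨 = K :=
    (congrArg Subgroup.closure h).trans (Subgroup.closure_eq K)
  rw [h1]
  rfl

/-- The component of `coord` in the low layers. -/
def low (gr : IsGrading E G r layer) : E →L[ℝ] E := gr.proj {k | k ≤ r / 2}

/-- The projection onto the high layers. -/
def high (gr : IsGrading E G r layer) : E →L[ℝ] E := gr.proj {k | r / 2 + 1 ≤ k}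

theorem low_add_high (gr : IsGrading E G r layer) (x : E) : gr.low x + gr.high x = x := by
  rw [low, high, ← compl_setOf_le]
  exact gr.proj_add_proj_compl _ x

theorem high_mem (gr : IsGrading E G r layer) (x : E) : gr.high x ∈ highIdeal r layer :=
  gr.proj_mem _ x

theorem high_of_mem (gr : IsGrading E G r layer) {x : E} (hx : x ∈ highIdeal r layer) :
    gr.high x = x := gr.proj_of_mem (fun _ hk _ _ => hk) hx

theorem low_of_mem (gr : IsGrading E G r layer) {x : E} (hx : x ∈ highIdeal r layer) :
    gr.low x = 0 := gr.proj_filt_eq_zero hx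

theorem high_low (gr : IsGrading E G r layer) (x : E) : gr.high (gr.low x) = 0 := by
  have := gr.low_add_high (gr.high x)
  rw [gr.low_of_mem (gr.high_mem x), zero_add] at this
  have h2 := congrArg gr.high (gr.low_add_high x)
  rw [map_add, this] at h2
  simpa using h2

theorem low_low (gr : IsGrading E G r layer) (x : E) : gr.low (gr.low x) = gr.low x := by
  have := gr.low_add_high (gr.low x)
  rwa [high_low, add_zero] at this

/-- The coordinates on `G` in which right multiplication by the exponential of an element of the
abelian ideal `highIdeal` is a translation. -/
def theta (gr : IsGrading E G r layer) (g : G) : E :=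
  gr.low (gr.coord g) +
    gr.δinv (Ad E (gr.coordSymm (gr.low (gr.coord g)) : G)⁻¹ (gr.high (gr.coord g)))

/-- The inverse of `theta`. -/
def thetaSymm (gr : IsGrading E G r layer) (u : E) : G :=
  gr.coordSymm (gr.low u + Ad E (gr.coordSymm (gr.low u) : G) (gr.δ (gr.high u)))

theorem contMDiff_theta (gr : IsGrading E G r layer) :
    ContMDiff 𝓘(ℝ, E) 𝓘(ℝ, E) ∞ (gr.theta : G → E) := by
  have h1 : ContMDiff 𝓘(ℝ, E) 𝓘(ℝ, E) ∞ fun g : G => gr.low (gr.coord g) :=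
    gr.low.contDiff.contMDiff.comp gr.contMDiff_coord
  have h2 : ContMDiff 𝓘(ℝ, E) 𝓘(ℝ, E) ∞ fun g : G => gr.high (gr.coord g) :=
    gr.high.contDiff.contMDiff.comp gr.contMDiff_coord
  have h3 : ContMDiff 𝓘(ℝ, E) 𝓘(ℝ, E) ∞
      fun g : G => (gr.coordSymm (gr.low (gr.coord g)) : G)⁻¹ :=
    (gr.contMDiff_coordSymm.comp h1).inv
  exact h1.add (gr.δinv.contDiff.contMDiff.comp ((contMDiff_Ad.comp h3).clm_apply h2))

theorem contMDiff_thetaSymm (gr : IsGrading E G r layer) :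
    ContMDiff 𝓘(ℝ, E) 𝓘(ℝ, E) ∞ (gr.thetaSymm : E → G) := by
  have h1 : ContMDiff 𝓘(ℝ, E) 𝓘(ℝ, E) ∞ fun u : E => gr.low u := gr.low.contDiff.contMDiff
  have h2 : ContMDiff 𝓘(ℝ, E) 𝓘(ℝ, E) ∞ fun u : E => gr.δ (gr.high u) :=
    (gr.δ ∘L gr.high).contDiff.contMDiff
  exact gr.contMDiff_coordSymm.comp
    (h1.add ((contMDiff_Ad.comp (gr.contMDiff_coordSymm.comp h1)).clm_apply h2))

@[simp]
theorem theta_thetaSymm (gr : IsGrading E G r layer) (u : E) :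
    gr.theta (gr.thetaSymm u : G) = u := by
  have h1 : Ad E (gr.coordSymm (gr.low u) : G) (gr.δ (gr.high u)) ∈ highIdeal r layer :=
    gr.Ad_mem_filt _ (gr.δ_mem (gr.high_mem u))
  rw [theta, thetaSymm, coord_coordSymm, map_add, map_add, low_low, high_low, gr.low_of_mem h1,
    gr.high_of_mem h1, add_zero, zero_add, Ad_inv_Ad, δinv_δ, low_add_high]

@[simp]
theorem thetaSymm_theta (gr : IsGrading E G r layer) (g : G) :
    gr.thetaSymm (gr.theta g) = g := by
  have h1 : gr.δinv (Ad E (gr.coordSymm (gr.low (gr.coord g)) : G)⁻¹ (gr.high (gr.coord g))) ∈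
      highIdeal r layer := gr.δinv_mem (gr.Ad_mem_filt _ (gr.high_mem _))
  rw [theta, thetaSymm, map_add, map_add, low_low, high_low, gr.low_of_mem h1,
    gr.high_of_mem h1, add_zero, zero_add, δ_δinv, Ad_Ad_inv, low_add_high, coordSymm_coord]

theorem theta_injective (gr : IsGrading E G r layer) : Function.Injective (gr.theta : G → E) :=
  Function.LeftInverse.injective gr.thetaSymm_theta

/-- Write `g = a exp Z`, where `coord a` is the low part of `coord g` and `Z` lies in the ideal;
then `theta g` is that low part plus `Z`. Multiplying by `exp Y` keeps `a` and replaces `Z` by `Z +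
Y`. -/
theorem theta_mul_ex (gr : IsGrading E G r layer) (g : G) {Y : E} (hY : Y ∈ highIdeal r layer) :
    gr.theta (g * gr.ex Y) = gr.theta g + Y := by
  set a : G := gr.coordSymm (gr.low (gr.coord g)) with ha
  have h1 : Ad E g (gr.δ Y) ∈ highIdeal r layer := gr.Ad_mem_filt g (gr.δ_mem hY)
  have h2 : gr.coord (a⁻¹ * g) ∈ highIdeal r layer := by
    have h3 := gr.coord_mul a (a⁻¹ * g)
    rw [mul_inv_cancel_left, ha, coord_coordSymm, ← ha] at h3
    have h4 : gr.high (gr.coord g) = Ad E a (gr.coord (a⁻¹ * g)) :=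
      add_left_cancel ((gr.low_add_high _).trans h3)
    have h5 := congrArg (Ad E a⁻¹) h4
    rw [Ad_inv_Ad] at h5
    rw [← h5]
    exact gr.Ad_mem_filt _ (gr.high_mem _)
  have h3 : Ad E a⁻¹ (Ad E g (gr.δ Y)) = gr.δ Y := by
    have h4 : a⁻¹ * g = gr.ex (gr.δinv (gr.coord (a⁻¹ * g))) :=
      gr.coord_injective (by rw [coord_ex, δ_δinv])
    rw [← Ad_mul_apply, h4, gr.Ad_ex (gr.δinv_mem h2),
      gr.br_highIdeal_highIdeal (gr.δinv_mem h2) (gr.δ_mem hY), add_zero]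
  rw [theta, theta, coord_mul, coord_ex, map_add, map_add, gr.low_of_mem h1, gr.high_of_mem h1,
    add_zero, ← ha, map_add, h3, map_add, δinv_δ, add_assoc]

theorem mdifferentiableAt_theta (gr : IsGrading E G r layer) (g : G) :
    MDifferentiableAt 𝓘(ℝ, E) 𝓘(ℝ, E) (gr.theta : G → E) g :=
  gr.contMDiff_theta.mdifferentiable (by simp) g

theorem ld_theta_of_mem (gr : IsGrading E G r layer) (g : G) {Y : E}
    (hY : Y ∈ highIdeal r layer) : ld gr.theta g Y = Y := by
  have h1 : IsMIntegralCurve (fun t : ℝ => g * gr.ex (t • Y)) (liv G Y) := by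
    rw [isMIntegralCurve_iff_isMIntegralCurveOn]
    exact isMIntegralCurveOn_mul_left g ((gr.isMIntegralCurve_ex hY).isMIntegralCurveOn _)
  have h2 := hasDerivAt_comp_of_isMIntegralCurve h1 (t := 0) (gr.mdifferentiableAt_theta _)
  simp only [zero_smul, ex_zero, mul_one] at h2
  have h3 : (fun t : ℝ => gr.theta (g * gr.ex (t • Y))) = fun t => gr.theta g + t • Y :=
    funext fun t => gr.theta_mul_ex g (Submodule.smul_mem _ t hY)
  rw [h3] at h2
  have h4 : HasDerivAt (fun t : ℝ => gr.theta g + t • Y) Y 0 := by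
    simpa using ((hasDerivAt_id (0 : ℝ)).smul_const Y).const_add (gr.theta g)
  exact h2.unique h4

theorem ld_theta_injective (gr : IsGrading E G r layer) (g : G) :
    Function.Injective (ld (E := E) gr.theta g) := by
  have h1 : HasFDerivAt (fun u => gr.theta (ltChart E g u)) (ld gr.theta g) (basePt E G) :=
    hasFDerivAt_ld (gr.mdifferentiableAt_theta g)
  have h2 : DifferentiableAt ℝ (fun v => ltCoord E g (gr.thetaSymm v)) (gr.theta g) := by
    rw [← mdifferentiableAt_iff_differentiableAt]
    refine MDifferentiableAt.comp (I' := 𝓘(ℝ, E)) (g := ltCoord E g) (f := gr.thetaSymm)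
      (gr.theta g) ?_ (gr.contMDiff_thetaSymm.mdifferentiable (by simp) _)
    rw [thetaSymm_theta]
    exact mdifferentiableAt_ltCoord_self g
  have h3 : HasFDerivAt (fun v => ltCoord E g (gr.thetaSymm v)) (fderiv ℝ (fun v =>
      ltCoord E g (gr.thetaSymm v)) (gr.theta g)) (gr.theta (ltChart E g (basePt E G))) := by
    rw [ltChart_basePt]; exact h2.hasFDerivAt
  have h4 := (h3.comp (basePt E G) h1).fderiv
  have h5 : (fun v => ltCoord E g (gr.thetaSymm v)) ∘ (fun u => gr.theta (ltChart E g u))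
      =ᶠ[𝓝 (basePt E G)] id := by
    filter_upwards [target_mem_nhds (E := E) (G := G)] with u hu
    simp [ltCoord_ltChart g hu]
  rw [h5.fderiv_eq, fderiv_id] at h4
  refine Function.LeftInverse.injective (g := fderiv ℝ (fun v =>
      ltCoord E g (gr.thetaSymm v)) (gr.theta g)) fun X => ?_
  exact (DFunLike.congr_fun h4 X).symm

theorem inv_mul_mem_iff (gr : IsGrading E G r layer) {𝔨 : Submodule ℝ E}
    (h𝔨 : 𝔨 ≤ highIdeal r layer) {g g' : G} :
    g⁻¹ * g' ∈ connectedSubgroup (I := 𝓘(ℝ, E)) (G := G) 𝔨 ↔ gr.theta g' - gr.theta g ∈ 𝔨 := by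
  rw [gr.mem_connectedSubgroup_iff h𝔨]
  constructor
  · rintro ⟨Y, hY, h⟩
    rw [eq_inv_mul_iff_mul_eq] at h
    rwa [← h, gr.theta_mul_ex g (h𝔨 hY), add_sub_cancel_left]
  · intro h
    refine ⟨_, h, ?_⟩
    rw [eq_inv_mul_iff_mul_eq]
    refine gr.theta_injective ?_
    rw [gr.theta_mul_ex g (h𝔨 h), add_sub_cancel]

end IsGrading

end CarnotFoliation

end

/-! ### The splitting of the Lie algebra into horizontal and vertical parts. -/

noncomputable section

namespace CarnotFoliation

/-- The manifold structure with a single global chart. -/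
theorem exists_chartedSpace_of_homeomorph {V : Type*} [NormedAddCommGroup V] [NormedSpace ℝ V]
    {B : Type*} [TopologicalSpace B] (Φ : B ≃ₜ V) :
    ∃ _ : ChartedSpace V B, IsManifold 𝓘(ℝ, V) ∞ B ∧ ContMDiff 𝓘(ℝ, V) 𝓘(ℝ, V) ∞ Φ ∧
      ContMDiff 𝓘(ℝ, V) 𝓘(ℝ, V) ∞ Φ.symm := by
  let cs : ChartedSpace V B := Φ.toOpenPartialHomeomorph.singletonChartedSpace rfl
  have hm : IsManifold 𝓘(ℝ, V) ∞ B :=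
    { __ := Φ.toOpenPartialHomeomorph.singleton_hasGroupoid rfl (contDiffGroupoid ∞ 𝓘(ℝ, V)) }
  refine ⟨cs, hm, ?_, ?_⟩
  · intro x
    have := contMDiffAt_of_mem_maximalAtlas (I := 𝓘(ℝ, V)) (n := ∞)
      (IsManifold.chart_mem_maximalAtlas (I := 𝓘(ℝ, V)) (n := ∞) x) (mem_chart_source V x)
    exact this
  · intro v
    have := contMDiffOn_chart_symm (I := 𝓘(ℝ, V)) (n := ∞) (x := Φ.symm v)
    exact (this v (by simp)).contMDiffAt (by simp)

/-- Linear coordinates on two complementary subspaces. -/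
theorem exists_coords_of_isCompl {E : Type*} [NormedAddCommGroup E] [NormedSpace ℝ E]
    [FiniteDimensional ℝ E] {𝔭 𝔨 : Submodule ℝ E} (h : IsCompl 𝔭 𝔨) :
    ∃ (m d : ℕ) (q : E →L[ℝ] EuclideanSpace ℝ (Fin m)) (j : EuclideanSpace ℝ (Fin m) →L[ℝ] E)
      (κ' : E →L[ℝ] EuclideanSpace ℝ (Fin d)) (κ : EuclideanSpace ℝ (Fin d) →L[ℝ] E),
      (∀ v, q (j v) = v) ∧ (∀ a, κ' (κ a) = a) ∧ (∀ x, j (q x) + κ (κ' x) = x) ∧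
      (∀ v, κ' (j v) = 0) ∧ (∀ a, q (κ a) = 0) ∧ (∀ x, q x = 0 ↔ x ∈ 𝔨) ∧ (∀ a, κ a ∈ 𝔨) := by
  let eP : 𝔭 ≃ₗ[ℝ] EuclideanSpace ℝ (Fin (Module.finrank ℝ 𝔭)) :=
    LinearEquiv.ofFinrankEq _ _ (by simp)
  let eK : 𝔨 ≃ₗ[ℝ] EuclideanSpace ℝ (Fin (Module.finrank ℝ 𝔨)) :=
    LinearEquiv.ofFinrankEq _ _ (by simp)
  let e := Submodule.prodEquivOfIsCompl 𝔭 𝔨 h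
  refine ⟨_, _, LinearMap.toContinuousLinearMap
      (eP.toLinearMap ∘ₗ LinearMap.fst ℝ 𝔭 𝔨 ∘ₗ e.symm.toLinearMap),
    LinearMap.toContinuousLinearMap (𝔭.subtype ∘ₗ eP.symm.toLinearMap),
    LinearMap.toContinuousLinearMap (eK.toLinearMap ∘ₗ LinearMap.snd ℝ 𝔭 𝔨 ∘ₗ e.symm.toLinearMap),
    LinearMap.toContinuousLinearMap (𝔨.subtype ∘ₗ eK.symm.toLinearMap), ?_, ?_, ?_, ?_, ?_, ?_, ?_⟩
  · intro v
    simp [e]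
  · intro a
    simp [e]
  · intro x
    have := e.apply_symm_apply x
    rw [Submodule.coe_prodEquivOfIsCompl'] at this
    simpa using this
  · intro v
    simp [e]
  · intro a
    simp [e]
  · intro x
    simp only [LinearMap.coe_toContinuousLinearMap', LinearMap.comp_apply, LinearEquiv.coe_coe,
      LinearMap.fst_apply, LinearEquiv.map_eq_zero_iff]
    exact Submodule.prodEquivOfIsCompl_symm_apply_fst_eq_zero _ _ h
  · intro a
    simp

/-- `𝔨`, on the model space. -/
abbrev vert (r : ℕ) {E : Type*} [NormedAddCommGroup E] [NormedSpace ℝ E]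
    (layer : ℕ → Submodule ℝ E) : Submodule ℝ E := part layer {k | Even k ∧ r / 2 < k}

/-- `𝔭₁ ⊕ 𝔭₂`, on the model space. -/
abbrev hor (r : ℕ) {E : Type*} [NormedAddCommGroup E] [NormedSpace ℝ E]
    (layer : ℕ → Submodule ℝ E) : Submodule ℝ E := part layer {k | Even k ∧ r / 2 < k}ᶜ

/-- `𝔭₁`, on the model space. -/
abbrev horOdd {E : Type*} [NormedAddCommGroup E] [NormedSpace ℝ E]
    (layer : ℕ → Submodule ℝ E) : Submodule ℝ E := part layer {k | Odd k}

/-- `𝔭₂`, on the model space. -/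
abbrev horEven (r : ℕ) {E : Type*} [NormedAddCommGroup E] [NormedSpace ℝ E]
    (layer : ℕ → Submodule ℝ E) : Submodule ℝ E := part layer {k | Even k ∧ k ≤ r / 2}

theorem horOdd_sup_horEven (r : ℕ) {E : Type*} [NormedAddCommGroup E] [NormedSpace ℝ E]
    [FiniteDimensional ℝ E] (layer : ℕ → Submodule ℝ E) :
    horOdd layer ⊔ horEven r layer = hor r layer := by
  rw [horOdd, horEven, IsGrading.part_sup]
  congr 1
  ext k
  simp only [Set.mem_union, Set.mem_ofPred_eq, Set.mem_compl_iff, ← Nat.not_even_iff_odd]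
  rw [not_and, not_lt]
  tauto

theorem mem_leftTranslate_iff {E : Type*} [NormedAddCommGroup E] [NormedSpace ℝ E]
    {G : Type*} [TopologicalSpace G] [ChartedSpace E G] [Group G] [LieGroup 𝓘(ℝ, E) ∞ G]
    {𝔞 : Submodule ℝ E} {g : G} {w : E} :
    w ∈ (leftTranslate (I := 𝓘(ℝ, E)) (G := G) 𝔞 g : Submodule ℝ E) ↔ ltInv E g w ∈ 𝔞 := by
  constructor
  · rintro ⟨v, hv, rfl⟩
    exact (ltInv_lt (E := E) g v).symm ▸ hv
  · intro h
    exact ⟨_, h, lt_ltInv g w⟩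

namespace IsGrading

variable {E : Type*} [NormedAddCommGroup E] [NormedSpace ℝ E] [FiniteDimensional ℝ E]
    {G : Type*} [TopologicalSpace G] [T2Space G] [SimplyConnectedSpace G] [ChartedSpace E G]
    [Group G] [LieGroup 𝓘(ℝ, E) ∞ G]
    {r : ℕ} {layer : ℕ → Submodule ℝ E}

theorem vert_le_highIdeal (gr : IsGrading E G r layer) : vert r layer ≤ highIdeal r layer :=
  gr.part_mono fun _ hk _ _ => hk.2

theorem br_horOdd_vert (gr : IsGrading E G r layer) {X Y : E} (hX : X ∈ horOdd layer)
    (hY : Y ∈ vert r layer) : br E G X Y ∈ horOdd layer :=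
  gr.br_part (fun _ hi _ hj _ _ _ => Odd.add_even hi hj.1) hX hY

/-- Parity is kept and the index exceeds that of `Y`, so it stays above `r / 2`. -/
theorem br_horEven_vert (gr : IsGrading E G r layer) {X Y : E} (hX : X ∈ horEven r layer)
    (hY : Y ∈ vert r layer) : br E G X Y ∈ vert r layer :=
  gr.br_part (U := {k | Even k ∧ r / 2 < k}) (fun _ hi j hj _ _ _ =>
    ⟨Even.add hi.1 hj.1, by have := hj.2; omega⟩) hX hY

theorem horOdd_le_hor (r : ℕ) (layer : ℕ → Submodule ℝ E) : horOdd layer ≤ hor r layer := by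
  rw [← horOdd_sup_horEven r layer]; exact le_sup_left

theorem horEven_le_hor (r : ℕ) (layer : ℕ → Submodule ℝ E) : horEven r layer ≤ hor r layer := by
  rw [← horOdd_sup_horEven r layer]; exact le_sup_right

theorem layer_one_le_horOdd (layer : ℕ → Submodule ℝ E) : layer 1 ≤ horOdd layer :=
  layer_le_part layer odd_one

theorem isCompl_hor_vert (gr : IsGrading E G r layer) : IsCompl (hor r layer) (vert r layer) :=
  (gr.isCompl_part _).symm

/-- Right translation by an element of `exp 𝔨` moves the differential of `theta` by `Ad`. -/
theorem ld_theta_mul_ex (gr : IsGrading E G r layer) (p : G) {y : E}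
    (hy : y ∈ highIdeal r layer) (W : E) :
    ld gr.theta (p * gr.ex y) W = ld gr.theta p (W + br E G y W) := by
  have h1 := ld_mul_right (f := gr.theta) (g := p) (h := gr.ex y) (gr.mdifferentiableAt_theta _)
  have h2 : (fun x : G => gr.theta (x * gr.ex y)) = fun x => gr.theta x - (-y) := by
    ext x
    rw [gr.theta_mul_ex x hy, sub_neg_eq_add]
  rw [h2, ld_sub (gr.mdifferentiableAt_theta p) mdifferentiableAt_const, ld_const, sub_zero] at h1
  rw [h1, ContinuousLinearMap.comp_apply, ← gr.Ad_ex hy, Ad_inv_Ad]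

theorem mfderiv_theta_injective (gr : IsGrading E G r layer) (g : G) {v w : E}
    (h : (mfderiv 𝓘(ℝ, E) 𝓘(ℝ, E) gr.theta g : E →L[ℝ] E) v =
      (mfderiv 𝓘(ℝ, E) 𝓘(ℝ, E) gr.theta g : E →L[ℝ] E) w) : v = w := by
  have h1 : ∀ v : E, (mfderiv 𝓘(ℝ, E) 𝓘(ℝ, E) gr.theta g : E →L[ℝ] E) v =
      ld gr.theta g (ltInv E g v) := fun v => by
    refine Eq.trans ?_ (mfderiv_lt (gr.mdifferentiableAt_theta g) (ltInv E g v))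
    rw [lt_ltInv]
  rw [h1, h1] at h
  have h2 := gr.ld_theta_injective g h
  rw [← lt_ltInv (E := E) g v, h2, lt_ltInv]

/-- The differential of a map `F : G → G`, read in the coordinates `theta`. -/
theorem mfderiv_lt_eq_iff (gr : IsGrading E G r layer) {F : G → G} {p : G}
    (hF : MDifferentiableAt 𝓘(ℝ, E) 𝓘(ℝ, E) F p) (X Z : E) :
    (mfderiv 𝓘(ℝ, E) 𝓘(ℝ, E) F p : E →L[ℝ] E) (lt E p X) = lt E (F p) Z ↔
      ld (fun x => gr.theta (F x)) p X = ld gr.theta (F p) Z := by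
  have hc : MDifferentiableAt 𝓘(ℝ, E) 𝓘(ℝ, E) (fun x => gr.theta (F x)) p :=
    MDifferentiableAt.comp (g := gr.theta) (f := F) p (gr.mdifferentiableAt_theta (F p)) hF
  have h1 : ld (fun x => gr.theta (F x)) p X =
      (mfderiv 𝓘(ℝ, E) 𝓘(ℝ, E) gr.theta (F p) : E →L[ℝ] E)
        ((mfderiv 𝓘(ℝ, E) 𝓘(ℝ, E) F p : E →L[ℝ] E) (lt E p X)) := by
    rw [← mfderiv_lt hc]
    exact DFunLike.congr_fun (mfderiv_comp (g := gr.theta) (f := F) p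
      (gr.mdifferentiableAt_theta (F p)) hF) (lt E p X)
  have h2 : ld gr.theta (F p) Z =
      (mfderiv 𝓘(ℝ, E) 𝓘(ℝ, E) gr.theta (F p) : E →L[ℝ] E) (lt E (F p) Z) :=
    (mfderiv_lt (gr.mdifferentiableAt_theta (F p)) Z).symm
  rw [h1, h2]
  exact ⟨fun h => by rw [h], fun h => gr.mfderiv_theta_injective _ h⟩

end IsGrading

end CarnotFoliation

end

/-! ### The differential of the projection; necessity of the bracket condition for a principal
connection. -/

noncomputable section

namespace CarnotFoliation

namespace IsGrading

variable {E : Type*} [NormedAddCommGroup E] [NormedSpace ℝ E] [FiniteDimensional ℝ E]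
    {G : Type*} [TopologicalSpace G] [T2Space G] [SimplyConnectedSpace G] [ChartedSpace E G]
    [Group G] [LieGroup 𝓘(ℝ, E) ∞ G]
    {r : ℕ} {layer : ℕ → Submodule ℝ E}

section Quotient

variable {V : Type*} [NormedAddCommGroup V] [NormedSpace ℝ V] {B : Type*} [TopologicalSpace B]
  [ChartedSpace V B] {π : G → B} {Φ : B → V} {Φs : V → B} {q : E →L[ℝ] V}

theorem contMDiff_proj (gr : IsGrading E G r layer) (hΦs : ContMDiff 𝓘(ℝ, V) 𝓘(ℝ, V) ∞ Φs)
    (hl : ∀ b, Φs (Φ b) = b) (hπ : ∀ g, Φ (π g) = q (gr.theta g)) :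
    ContMDiff 𝓘(ℝ, E) 𝓘(ℝ, V) ∞ π := by
  have : π = fun g => Φs (q (gr.theta g)) := by
    ext g
    rw [← hπ, hl]
  rw [this]
  exact hΦs.comp (q.contDiff.contMDiff.comp gr.contMDiff_theta)

/-- Read through `Φ`, the projection is the linear map `q` after `theta`; since `Φ` and its inverse
are both differentiable, the kernels agree. -/
theorem mfderiv_proj_eq_zero_iff (gr : IsGrading E G r layer)
    (hΦ : ContMDiff 𝓘(ℝ, V) 𝓘(ℝ, V) ∞ Φ) (hΦs : ContMDiff 𝓘(ℝ, V) 𝓘(ℝ, V) ∞ Φs)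
    (hl : ∀ b, Φs (Φ b) = b) (hπ : ∀ g, Φ (π g) = q (gr.theta g)) (g : G) (X : E) :
    (mfderiv 𝓘(ℝ, E) 𝓘(ℝ, V) π g : E →L[ℝ] V) (lt E g X) = 0 ↔ q (ld gr.theta g X) = 0 := by
  have h1 : ld (fun g => q (gr.theta g)) g X = q (ld gr.theta g X) := by
    rw [ld_clm_comp q (gr.mdifferentiableAt_theta g)]; rfl
  have hφ : MDifferentiableAt 𝓘(ℝ, E) 𝓘(ℝ, V) (fun g => q (gr.theta g)) g :=
    (q.contDiff.contMDiff.comp gr.contMDiff_theta).mdifferentiable (by simp) g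
  have hpd := (gr.contMDiff_proj hΦs hl hπ).mdifferentiable (by simp) g
  rw [← h1, ← mfderiv_lt hφ]
  have h2 : (fun g => q (gr.theta g)) = Φ ∘ π := funext fun g => (hπ g).symm
  have h3 : π = Φs ∘ (fun g => q (gr.theta g)) := by
    ext g
    simp only [Function.comp_apply]
    rw [← hπ, hl]
  have h4 : (mfderiv 𝓘(ℝ, E) 𝓘(ℝ, V) (fun g => q (gr.theta g)) g : E →L[ℝ] V) (lt E g X) =
      (mfderiv 𝓘(ℝ, V) 𝓘(ℝ, V) Φ (π g) : V →L[ℝ] V)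
        ((mfderiv 𝓘(ℝ, E) 𝓘(ℝ, V) π g : E →L[ℝ] V) (lt E g X)) := by
    rw [h2]
    exact DFunLike.congr_fun (mfderiv_comp g (hΦ.mdifferentiable (by simp) _) hpd) (lt E g X)
  have h5 : (mfderiv 𝓘(ℝ, E) 𝓘(ℝ, V) π g : E →L[ℝ] V) (lt E g X) =
      (mfderiv 𝓘(ℝ, V) 𝓘(ℝ, V) Φs (q (gr.theta g)) : V →L[ℝ] V)
        ((mfderiv 𝓘(ℝ, E) 𝓘(ℝ, V) (fun g => q (gr.theta g)) g : E →L[ℝ] V) (lt E g X)) := by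
    conv_lhs => rw [h3]
    exact DFunLike.congr_fun (mfderiv_comp g (hΦs.mdifferentiable (by simp) _) hφ) (lt E g X)
  constructor
  · intro h
    exact h4.trans ((congrArg _ h).trans (map_zero _))
  · intro h
    rw [h5]
    refine (congrArg _ h).trans (map_zero _)

/-- A smooth section of the projection passes through every `g`: translate `theta g` in the
directions of `j`. -/
theorem mfderiv_proj_surjective (gr : IsGrading E G r layer) {j : V →L[ℝ] E}
    (hqj : ∀ v, q (j v) = v)
    (hΦ : ContMDiff 𝓘(ℝ, V) 𝓘(ℝ, V) ∞ Φ) (hΦs : ContMDiff 𝓘(ℝ, V) 𝓘(ℝ, V) ∞ Φs)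
    (hl : ∀ b, Φs (Φ b) = b) (hπ : ∀ g, Φ (π g) = q (gr.theta g)) (g : G) :
    Function.Surjective (mfderiv 𝓘(ℝ, E) 𝓘(ℝ, V) π g) := by
  let s : B → G := fun b => gr.thetaSymm (gr.theta g + j (Φ b - Φ (π g)))
  have hs : ContMDiff 𝓘(ℝ, V) 𝓘(ℝ, E) ∞ s := by
    refine gr.contMDiff_thetaSymm.comp (contMDiff_const.add ?_)
    exact j.contDiff.contMDiff.comp (hΦ.sub contMDiff_const)
  have hs1 : s (π g) = g := by simp [s]
  have hs2 : π ∘ s = id := by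
    ext b
    have : Φ (π (s b)) = Φ b := by
      simp [hπ, s, hqj]
    have h1 := congrArg Φs this
    rwa [hl, hl] at h1
  have hpd := (gr.contMDiff_proj hΦs hl hπ).mdifferentiable (by simp)
  have h1 := mfderiv_comp (I'' := 𝓘(ℝ, V)) (π g) (hpd (s (π g)))
    (hs.mdifferentiable (by simp) (π g))
  rw [hs2, hs1] at h1
  intro w
  refine ⟨mfderiv 𝓘(ℝ, V) 𝓘(ℝ, E) s (π g) w, ?_⟩
  have h2 := DFunLike.congr_fun h1 w
  rw [mfderiv_id] at h2
  exact h2.symm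

end Quotient

/-- The differential of `theta` is injective and is the identity on the vertical space, so only
vertical vectors are sent into that space. -/
theorem q_ld_theta_eq_zero_iff (gr : IsGrading E G r layer) {V : Type*} [NormedAddCommGroup V]
    [NormedSpace ℝ V] {q : E →L[ℝ] V} (hq : ∀ x, q x = 0 ↔ x ∈ vert r layer) (g : G) (X : E) :
    q (ld gr.theta g X) = 0 ↔ X ∈ vert r layer := by
  rw [hq]
  constructor
  · intro h
    have := gr.ld_theta_of_mem g (gr.vert_le_highIdeal h)
    rwa [gr.ld_theta_injective g this] at h
  · intro h
    rwa [gr.ld_theta_of_mem g (gr.vert_le_highIdeal h)]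

/-- If the horizontal bundle is invariant under a principal action whose orbits are the cosets of
`exp 𝔨`, then `[𝔭₂, 𝔨] = 0`. -/
theorem br_eq_zero_of_invariant (gr : IsGrading E G r layer) {L : Type*} {act : G → L → G}
    (hsmooth : ∀ a, ContMDiff 𝓘(ℝ, E) 𝓘(ℝ, E) ∞ fun p => act p a)
    (hvert : ∀ p a, gr.theta (act p a) - gr.theta p ∈ vert r layer)
    (htrans : ∀ y ∈ vert r layer, ∃ a, act 1 a = gr.ex y)
    (hinv : ∀ a p, ∀ X ∈ hor r layer, ∃ Z ∈ hor r layer,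
      (mfderiv 𝓘(ℝ, E) 𝓘(ℝ, E) (fun p => act p a) p : E →L[ℝ] E) (lt E p X) =
        lt E (act p a) Z) {X y : E} (hX : X ∈ horEven r layer) (hy : y ∈ vert r layer) :
    br E G X y = 0 := by
  obtain ⟨a, ha⟩ := htrans y hy
  set F : G → G := fun p => act p a with hF
  -- The vertical displacement: `F p = p * exp (Y p)` with `Y` valued in `𝔨`.
  set Y : G → E := fun p => gr.theta (F p) - gr.theta p with hY
  have hFs : ContMDiff 𝓘(ℝ, E) 𝓘(ℝ, E) ∞ F := hsmooth a
  have hcs : ContMDiff 𝓘(ℝ, E) 𝓘(ℝ, E) ∞ fun p => gr.theta (F p) := gr.contMDiff_theta.comp hFs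
  have hYs : ContMDiff 𝓘(ℝ, E) 𝓘(ℝ, E) ∞ Y := hcs.sub gr.contMDiff_theta
  have hYv : ∀ p, Y p ∈ vert r layer := fun p => hvert p a
  have hFY : ∀ p, F p = p * gr.ex (Y p) := fun p => gr.theta_injective (by
    rw [gr.theta_mul_ex p (gr.vert_le_highIdeal (hYv p)), hY, add_sub_cancel])
  have hldv : ∀ (p : G) (W : E), ld Y p W ∈ vert r layer := by
    intro p W
    have h0 : (fun x => gr.proj {k | Even k ∧ r / 2 < k}ᶜ (Y x)) = fun _ => (0 : E) :=
      funext fun x => gr.proj_eq_zero (T := {k | Even k ∧ r / 2 < k}ᶜ)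
        (fun k hk _ _ h => h hk) (hYv x)
    have h1 := ld_clm_comp (gr.proj {k | Even k ∧ r / 2 < k}ᶜ)
      (hYs.mdifferentiable (by simp) p)
    rw [h0, ld_const] at h1
    have h2 := gr.mem_compl_of_proj_eq_zero (DFunLike.congr_fun h1 W).symm
    rwa [compl_compl] at h2
  -- Both sides are the image of `W` under the differential of `F`, read through `theta`: the left
  -- from the displacement, the right from invariance and `ld_theta_mul_ex`.
  have key : ∀ p, ∀ W ∈ hor r layer, ∃ Z ∈ hor r layer,
      W + ld Y p W = Z + br E G (Y p) Z := by
    intro p W hW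
    obtain ⟨Z, hZ, h⟩ := hinv a p W hW
    refine ⟨Z, hZ, gr.ld_theta_injective p ?_⟩
    rw [gr.mfderiv_lt_eq_iff (hFs.mdifferentiable (by simp) p)] at h
    rw [hFY p, gr.ld_theta_mul_ex p (gr.vert_le_highIdeal (hYv p))] at h
    rw [← h, map_add, gr.ld_theta_of_mem p (gr.vert_le_highIdeal (hldv p W)), hY,
      ld_sub (hcs.mdifferentiable (by simp) p) (gr.mdifferentiableAt_theta p)]
    simp [hF]
  -- Since `[Y, Z₁]` is odd and `[Y, Z₂]` is vertical, the `𝔭₂`-component of `key` gives `Z₂ = W₂`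
  -- and the `𝔨`-component gives the derivative of `Y`.
  have key2 : ∀ p, ∀ W₁ ∈ horOdd layer, ∀ W₂ ∈ horEven r layer,
      ld Y p (W₁ + W₂) = br E G (Y p) W₂ := by
    intro p W₁ hW₁ W₂ hW₂
    obtain ⟨Z, hZ, h⟩ := key p (W₁ + W₂) (add_mem (horOdd_le_hor r layer hW₁) (horEven_le_hor r layer hW₂))
    rw [← horOdd_sup_horEven, Submodule.mem_sup] at hZ
    obtain ⟨Z₁, hZ₁, Z₂, hZ₂, rfl⟩ := hZ
    have hb1 : br E G (Y p) Z₁ ∈ horOdd layer := by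
      rw [br_swap]; exact neg_mem (gr.br_horOdd_vert hZ₁ (hYv p))
    have hb2 : br E G (Y p) Z₂ ∈ vert r layer := by
      rw [br_swap]; exact neg_mem (gr.br_horEven_vert hZ₂ (hYv p))
    have hη := hldv p (W₁ + W₂)
    generalize ld Y p (W₁ + W₂) = η at h hη ⊢
    rw [map_add] at h
    have hPe := congrArg (gr.proj {k | Even k ∧ k ≤ r / 2}) h
    have hPv := congrArg (gr.proj {k | Even k ∧ r / 2 < k}) h
    have hoe : ∀ {x : E}, x ∈ horOdd layer → gr.proj {k | Even k ∧ k ≤ r / 2} x = 0 := fun hx =>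
      gr.proj_eq_zero (fun k hk _ _ h => Nat.not_even_iff_odd.2 hk h.1) hx
    have hov : ∀ {x : E}, x ∈ horOdd layer → gr.proj {k | Even k ∧ r / 2 < k} x = 0 := fun hx =>
      gr.proj_eq_zero (fun k hk _ _ h => Nat.not_even_iff_odd.2 hk h.1) hx
    have hev : ∀ {x : E}, x ∈ horEven r layer → gr.proj {k | Even k ∧ r / 2 < k} x = 0 := fun hx =>
      gr.proj_eq_zero (fun k hk _ _ h => absurd hk.2 (not_le.2 h.2)) hx
    have hve : ∀ {x : E}, x ∈ vert r layer → gr.proj {k | Even k ∧ k ≤ r / 2} x = 0 := fun hx =>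
      gr.proj_eq_zero (fun k hk _ _ h => absurd h.2 (not_le.2 hk.2)) hx
    have hee : ∀ {x : E}, x ∈ horEven r layer → gr.proj {k | Even k ∧ k ≤ r / 2} x = x := fun hx =>
      gr.proj_of_mem (fun k hk _ _ => hk) hx
    have hvv : ∀ {x : E}, x ∈ vert r layer → gr.proj {k | Even k ∧ r / 2 < k} x = x := fun hx =>
      gr.proj_of_mem (fun k hk _ _ => hk) hx
    simp only [map_add, hoe hW₁, hee hW₂, hoe hZ₁, hee hZ₂, hoe hb1, hve hb2, hve hη, zero_add,
      add_zero] at hPe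
    simp only [map_add, hov hW₁, hev hW₂, hvv hη, hov hZ₁, hev hZ₂, hov hb1, hvv hb2, zero_add,
      add_zero] at hPv
    rw [hPv, hPe]
  -- The first layer is odd, so `Y` is constant along generating directions and hence everywhere.
  have hconst : ∀ p, ld Y p = 0 := fun p => gr.ld_eq_zero hYs (fun g W hW => by
    have := key2 g W (layer_one_le_horOdd layer hW) 0 (zero_mem _)
    simpa using this) p
  have h1 := key2 1 0 (zero_mem _) X hX
  rw [hconst] at h1
  have h2 : Y 1 = y := by
    simp only [hY, hF]
    rw [ha]
    have := gr.theta_mul_ex (1 : G) (gr.vert_le_highIdeal hy)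
    rw [one_mul] at this
    rw [this, add_sub_cancel_left]
  rw [br_swap, ← h2, ← h1]
  simp

end IsGrading

end CarnotFoliation

end

/-! ### The principal action of `exp 𝔨` and the quotient manifold. -/

noncomputable section

namespace CarnotFoliation

/-- The additive group of a normed space, as a multiplicative Lie group. -/
abbrev multiplicativeGroup (V : Type*) [NormedAddCommGroup V] : Group V :=
  inferInstanceAs (Group (Multiplicative V))

theorem lieGroup_multiplicativeGroup (V : Type*) [NormedAddCommGroup V] [NormedSpace ℝ V] :
    @LieGroup ℝ _ V _ V _ _ 𝓘(ℝ, V) ∞ V (multiplicativeGroup V) _ _ :=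
  let _ := multiplicativeGroup V
  { contMDiff_mul := contMDiff_add 𝓘(ℝ, V) ∞
    contMDiff_inv := contMDiff_neg 𝓘(ℝ, V) ∞ }

namespace IsGrading

variable {E : Type*} [NormedAddCommGroup E] [NormedSpace ℝ E] [FiniteDimensional ℝ E]
    {G : Type*} [TopologicalSpace G] [T2Space G] [SimplyConnectedSpace G] [ChartedSpace E G]
    [Group G] [LieGroup 𝓘(ℝ, E) ∞ G]
    {r : ℕ} {layer : ℕ → Submodule ℝ E}

/-- Right translations by `exp 𝔨` preserve the horizontal bundle if `[𝔭₂, 𝔨] = 0`. -/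
theorem map_mfderiv_mul_ex (gr : IsGrading E G r layer)
    (hbr : ∀ X ∈ horEven r layer, ∀ Y ∈ vert r layer, br E G X Y = 0) {y : E}
    (hy : y ∈ vert r layer) (p : G) :
    (leftTranslate (I := 𝓘(ℝ, E)) (G := G) (hor r layer : Submodule ℝ E) p).map
      (mfderiv 𝓘(ℝ, E) 𝓘(ℝ, E) (fun x : G => x * gr.ex y) p).toLinearMap =
    leftTranslate (I := 𝓘(ℝ, E)) (G := G) (hor r layer : Submodule ℝ E) (p * gr.ex y) := by
  have hd : MDifferentiableAt 𝓘(ℝ, E) 𝓘(ℝ, E) (fun x : G => x * gr.ex y) p :=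
    (contMDiff_mul_right (I := 𝓘(ℝ, E)) (n := ∞) (a := gr.ex y)).mdifferentiable (by simp) p
  have hstab : ∀ {z : E}, z ∈ vert r layer → ∀ W ∈ hor r layer, W + br E G z W ∈ hor r layer := by
    intro z hz W hW
    have hW' := hW
    rw [← horOdd_sup_horEven, Submodule.mem_sup] at hW'
    obtain ⟨W₁, hW₁, W₂, hW₂, rfl⟩ := hW'
    refine add_mem hW ?_
    rw [map_add, br_swap, br_swap z W₂, hbr W₂ hW₂ z hz, neg_zero, add_zero]
    exact neg_mem (horOdd_le_hor r layer (gr.br_horOdd_vert hW₁ hz))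
  have key : ∀ Z : E, (mfderiv 𝓘(ℝ, E) 𝓘(ℝ, E) (fun x : G => x * gr.ex y) p : E →L[ℝ] E)
      (lt E p (Z + br E G y Z)) = lt E (p * gr.ex y) Z := by
    intro Z
    rw [gr.mfderiv_lt_eq_iff hd, gr.ld_theta_mul_ex p (gr.vert_le_highIdeal hy)]
    have h2 : (fun x : G => gr.theta (x * gr.ex y)) = fun x => gr.theta x - (-y) := by
      ext x
      rw [gr.theta_mul_ex x (gr.vert_le_highIdeal hy), sub_neg_eq_add]
    rw [h2, ld_sub (gr.mdifferentiableAt_theta p) mdifferentiableAt_const, ld_const, sub_zero]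
  ext w
  constructor
  · rintro ⟨_, ⟨X', hX', rfl⟩, rfl⟩
    obtain ⟨X, rfl, hX⟩ : ∃ X : E, X = X' ∧ X ∈ hor r layer := ⟨X', rfl, hX'⟩
    have h1 := hstab (neg_mem hy) X hX
    refine ⟨_, h1, ?_⟩
    refine (key _).symm.trans ?_
    -- As the square of `ad y` vanishes, `1 - ad y` is inverse to `1 + ad y`; this supplies the
    -- preimage of a horizontal vector.
    have h2 : br E G y (br E G y X) = 0 := gr.br_highIdeal_highIdeal (gr.vert_le_highIdeal hy)
      (gr.br_mem_highIdeal X (gr.vert_le_highIdeal hy))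
    have h3 : X + br E G (-y) X + br E G y (X + br E G (-y) X) = X := by
      simp [h2]
    rw [h3]
    rfl
  · rintro ⟨Z, hZ, rfl⟩
    exact ⟨_, ⟨_, hstab hy Z hZ, rfl⟩, key Z⟩

/-- The structure group is the additive group of coordinates on `𝔨`, acting by right multiplication
with `exp (κ a)`. In `theta` this is translation by `κ a`, so the bundle axioms become linear
algebra and the pair (projection, vertical coordinate) trivializes the bundle globally. -/
theorem canBeMadePrincipal (gr : IsGrading E G r layer) {m d : ℕ} {B : Type*} [TopologicalSpace B]
    [ChartedSpace (EuclideanSpace ℝ (Fin m)) B] {π : G → B} (Φ : B ≃ₜ EuclideanSpace ℝ (Fin m))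
    {q : E →L[ℝ] EuclideanSpace ℝ (Fin m)} {j : EuclideanSpace ℝ (Fin m) →L[ℝ] E}
    {κ' : E →L[ℝ] EuclideanSpace ℝ (Fin d)} {κ : EuclideanSpace ℝ (Fin d) →L[ℝ] E}
    (hΦ : ContMDiff 𝓘(ℝ, EuclideanSpace ℝ (Fin m)) 𝓘(ℝ, EuclideanSpace ℝ (Fin m)) ∞ Φ)
    (hΦs : ContMDiff 𝓘(ℝ, EuclideanSpace ℝ (Fin m)) 𝓘(ℝ, EuclideanSpace ℝ (Fin m)) ∞ Φ.symm)
    (hπ : ∀ g, Φ (π g) = q (gr.theta g))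
    (hqj : ∀ v, q (j v) = v) (hκκ : ∀ a, κ' (κ a) = a) (hjκ : ∀ x, j (q x) + κ (κ' x) = x)
    (hκj : ∀ v, κ' (j v) = 0) (hqκ : ∀ a, q (κ a) = 0) (hκv : ∀ a, κ a ∈ vert r layer)
    (hbr : ∀ X ∈ horEven r layer, ∀ Y ∈ vert r layer, br E G X Y = 0) :
    CanBeMadePrincipal 𝓘(ℝ, E) 𝓘(ℝ, EuclideanSpace ℝ (Fin m)) π
      (leftTranslate (I := 𝓘(ℝ, E)) (G := G) (hor r layer : Submodule ℝ E)) := by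
  have hκh : ∀ a, κ a ∈ highIdeal r layer := fun a => gr.vert_le_highIdeal (hκv a)
  have hπs : ContMDiff 𝓘(ℝ, E) 𝓘(ℝ, EuclideanSpace ℝ (Fin m)) ∞ π :=
    gr.contMDiff_proj hΦs Φ.symm_apply_apply hπ
  have hfib : ContMDiff 𝓘(ℝ, E) 𝓘(ℝ, EuclideanSpace ℝ (Fin d)) ∞ fun p : G => κ' (gr.theta p) :=
    κ'.contDiff.contMDiff.comp gr.contMDiff_theta
  have hinv : ContMDiff (𝓘(ℝ, EuclideanSpace ℝ (Fin m)).prod 𝓘(ℝ, EuclideanSpace ℝ (Fin d)))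
      𝓘(ℝ, E) ∞ fun x : B × EuclideanSpace ℝ (Fin d) => (gr.thetaSymm (j (Φ x.1) + κ x.2) : G) :=
    gr.contMDiff_thetaSymm.comp ((j.contDiff.contMDiff.comp (hΦ.comp contMDiff_fst)).add
      (κ.contDiff.contMDiff.comp contMDiff_snd))
  let T : G ≃ₜ B × EuclideanSpace ℝ (Fin d) :=
    { toFun := fun p => (π p, κ' (gr.theta p))
      invFun := fun x => gr.thetaSymm (j (Φ x.1) + κ x.2)
      left_inv := fun p => by
        simp only [hπ, hjκ, thetaSymm_theta]
      right_inv := fun x => by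
        have h1 : π (gr.thetaSymm (j (Φ x.1) + κ x.2)) = x.1 :=
          Φ.injective (by rw [hπ, theta_thetaSymm, map_add, hqj, hqκ, add_zero])
        simp only [h1, theta_thetaSymm, map_add, hκj, hκκ, zero_add]
      continuous_toFun := hπs.continuous.prodMk hfib.continuous
      continuous_invFun := hinv.continuous }
  let _ := multiplicativeGroup (EuclideanSpace ℝ (Fin d))
  have hmul : ∀ a b : EuclideanSpace ℝ (Fin d), a * b = a + b := fun _ _ => rfl
  have hone : (1 : EuclideanSpace ℝ (Fin d)) = 0 := rfl
  refine ⟨d, EuclideanSpace ℝ (Fin d), inferInstance, inferInstance, inferInstance,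
    lieGroup_multiplicativeGroup _, inferInstance, fun p a => p * gr.ex (κ a), ?_, ?_⟩
  · refine ⟨fun p => ?_, fun p a b => ?_, ?_, fun p a => ?_, fun p a h => ?_, fun p q' h => ?_,
      fun b => ?_⟩
    · simp [hone]
    · simp only [hmul, map_add]
      rw [gr.ex_add (hκh a) (hκh b), mul_assoc]
    · exact contMDiff_fst.mul (gr.contMDiff_ex.comp (κ.contDiff.contMDiff.comp contMDiff_snd))
    · refine Φ.injective ?_
      rw [hπ, hπ, gr.theta_mul_ex p (hκh a), map_add, hqκ, add_zero]
    · have h1 := gr.theta_mul_ex p (hκh a)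
      rw [h] at h1
      have h2 : κ a = 0 := by simpa using h1
      rw [hone, ← hκκ a, h2, map_zero]
    · refine ⟨κ' (gr.theta q' - gr.theta p), gr.theta_injective ?_⟩
      have h1 : q (gr.theta q' - gr.theta p) = 0 := by
        rw [map_sub, ← hπ, ← hπ, h, sub_self]
      have h2 := hjκ (gr.theta q' - gr.theta p)
      rw [h1, map_zero, zero_add] at h2
      rw [gr.theta_mul_ex p (hκh _), h2, add_sub_cancel]
    · refine ⟨{ toOpenPartialHomeomorph := T.toOpenPartialHomeomorph
                baseSet := Set.univ
                open_baseSet := isOpen_univ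
                source_eq := by simp
                target_eq := by simp
                proj_toFun := fun p _ => rfl }, Set.mem_univ b, ?_, ?_, fun p _ a => ?_⟩
      · exact (hπs.prodMk hfib).contMDiffOn
      · exact hinv.contMDiffOn
      · change κ' (gr.theta (p * gr.ex (κ a))) = κ' (gr.theta p) + a
        rw [gr.theta_mul_ex p (hκh a), map_add, hκκ]
  · exact fun p a => gr.map_mfderiv_mul_ex hbr (hκv a) p

theorem br_eq_zero_of_canBeMadePrincipal (gr : IsGrading E G r layer) {m : ℕ} {B : Type*}
    [TopologicalSpace B] [ChartedSpace (EuclideanSpace ℝ (Fin m)) B] {π : G → B}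
    (hπ : ∀ g g', π g = π g' ↔ gr.theta g' - gr.theta g ∈ vert r layer)
    (h : CanBeMadePrincipal 𝓘(ℝ, E) 𝓘(ℝ, EuclideanSpace ℝ (Fin m)) π
      (leftTranslate (I := 𝓘(ℝ, E)) (G := G) (hor r layer : Submodule ℝ E))) :
    ∀ X ∈ horEven r layer, ∀ Y ∈ vert r layer, br E G X Y = 0 := by
  obtain ⟨d, L, _, _, _, _, _, act, hP, hI⟩ := h
  intro X hX Y hY
  refine gr.br_eq_zero_of_invariant (act := act) (fun a => ?_) (fun p a => ?_) (fun y hy => ?_)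
    (fun a p X hX => ?_) hX hY
  · exact hP.contMDiff_act.comp (contMDiff_id.prodMk contMDiff_const)
  · exact (hπ _ _).1 (hP.proj_act p a).symm
  · refine hP.transitive _ _ ((hπ _ _).2 ?_)
    have := gr.theta_mul_ex (1 : G) (gr.vert_le_highIdeal hy)
    rw [one_mul] at this
    rwa [this, add_sub_cancel_left]
  · have h1 : (mfderiv 𝓘(ℝ, E) 𝓘(ℝ, E) (fun p => act p a) p : E →L[ℝ] E) (lt E p X) ∈
        (leftTranslate (I := 𝓘(ℝ, E)) (G := G) (hor r layer : Submodule ℝ E) (act p a) : Submodule ℝ E) := by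
      rw [← hI p a]
      exact ⟨lt E p X, ⟨X, hX, rfl⟩, rfl⟩
    obtain ⟨Z, hZ, h2⟩ := h1
    exact ⟨Z, hZ, h2.symm⟩

/-- The quotient of `G` by the connected subgroup with Lie algebra `𝔨`. -/
theorem exists_chartedSpace_quotient (gr : IsGrading E G r layer) {K : Subgroup G}
    (hK : K = connectedSubgroup (I := 𝓘(ℝ, E)) (G := G) (vert r layer : Submodule ℝ E))
    {D : Π x : G, Submodule ℝ (TangentSpace 𝓘(ℝ, E) x)}
    (hD : D = leftTranslate (I := 𝓘(ℝ, E)) (G := G) (hor r layer : Submodule ℝ E)) :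
    ∃ (m : ℕ) (_ : ChartedSpace (EuclideanSpace ℝ (Fin m)) (G ⧸ K)),
      T2Space (G ⧸ K) ∧
      IsManifold 𝓘(ℝ, EuclideanSpace ℝ (Fin m)) ∞ (G ⧸ K) ∧
      IsSurjectiveSubmersion 𝓘(ℝ, E) 𝓘(ℝ, EuclideanSpace ℝ (Fin m))
        (QuotientGroup.mk : G → G ⧸ K) ∧
      IsEhresmannConnection 𝓘(ℝ, E) 𝓘(ℝ, EuclideanSpace ℝ (Fin m))
        (QuotientGroup.mk : G → G ⧸ K) D ∧
      (CanBeMadePrincipal 𝓘(ℝ, E) 𝓘(ℝ, EuclideanSpace ℝ (Fin m))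
          (QuotientGroup.mk : G → G ⧸ K) D ↔
        ∀ X ∈ horEven r layer, ∀ Y ∈ vert r layer, br E G X Y = 0) := by
  subst hK hD
  set K := connectedSubgroup (I := 𝓘(ℝ, E)) (G := G) (vert r layer : Submodule ℝ E)
  obtain ⟨m, d, q, j, κ', κ, hqj, hκκ, hjκ, hκj, hqκ, hq, hκv⟩ :=
    exists_coords_of_isCompl gr.isCompl_hor_vert
  have hmk : ∀ g g' : G, (QuotientGroup.mk g : G ⧸ K) = QuotientGroup.mk g' ↔
      gr.theta g' - gr.theta g ∈ vert r layer := fun g g' =>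
    QuotientGroup.eq.trans (gr.inv_mul_mem_iff gr.vert_le_highIdeal)
  have hqc : Continuous fun g : G => q (gr.theta g) :=
    q.continuous.comp gr.contMDiff_theta.continuous
  -- Cosets of `K` are the fibres of `q ∘ theta`, so this map descends to a homeomorphism with a
  -- Euclidean space, used below as the single chart of the quotient.
  let Φ : G ⧸ K ≃ₜ EuclideanSpace ℝ (Fin m) :=
    { toFun := Quotient.lift (fun g : G => q (gr.theta g)) (fun g g' h => by
        have h1 := (hmk g g').1 (Quotient.sound h)
        have h2 := (hq _).2 h1
        rw [map_sub, sub_eq_zero] at h2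
        exact h2.symm)
      invFun := fun v => QuotientGroup.mk (gr.thetaSymm (j v))
      left_inv := by
        intro x
        obtain ⟨g, rfl⟩ := QuotientGroup.mk_surjective x
        refine (hmk _ _).2 ?_
        rw [theta_thetaSymm, ← hq, map_sub, hqj]
        exact sub_self _
      right_inv := fun v => by
        change q (gr.theta (gr.thetaSymm (j v) : G)) = v
        rw [theta_thetaSymm, hqj]
      continuous_toFun := hqc.quotient_lift _
      continuous_invFun := QuotientGroup.continuous_mk.comp
        (gr.contMDiff_thetaSymm.continuous.comp j.continuous) }
  have hπ : ∀ g : G, Φ (QuotientGroup.mk g) = q (gr.theta g) := fun g => rfl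
  obtain ⟨cs, hman, hΦ, hΦs⟩ := exists_chartedSpace_of_homeomorph Φ
  refine ⟨m, cs, Φ.isEmbedding.t2Space, hman, ⟨gr.contMDiff_proj hΦs Φ.symm_apply_apply hπ,
    QuotientGroup.mk_surjective, gr.mfderiv_proj_surjective hqj hΦ hΦs Φ.symm_apply_apply hπ⟩,
    fun p => ?_, ?_, ?_⟩
  · have hker : ∀ X : E, (mfderiv 𝓘(ℝ, E) 𝓘(ℝ, EuclideanSpace ℝ (Fin m))
        (QuotientGroup.mk : G → G ⧸ K) p : E →L[ℝ] EuclideanSpace ℝ (Fin m)) (lt E p X) = 0 ↔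
        X ∈ vert r layer := fun X =>
      (gr.mfderiv_proj_eq_zero_iff hΦ hΦs Φ.symm_apply_apply hπ p X).trans
        (gr.q_ld_theta_eq_zero_iff hq p X)
    refine ⟨Submodule.disjoint_def.2 ?_, codisjoint_iff.2 (eq_top_iff.2 ?_)⟩
    · rintro _ ⟨X, hX, rfl⟩ hw
      have h1 := (hker X).1 hw
      have h2 := Submodule.disjoint_def.1 gr.isCompl_hor_vert.disjoint X hX h1
      rw [h2]
      exact map_zero (lt E p)
    · intro w _
      have h1 : (ltInv E p w : E) ∈ hor r layer ⊔ vert r layer := by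
        rw [gr.isCompl_hor_vert.sup_eq_top]; trivial
      obtain ⟨X, hX, Y, hY, h2⟩ := Submodule.mem_sup.1 h1
      refine Submodule.mem_sup.2 ⟨lt E p X, ⟨X, hX, rfl⟩, lt E p Y, (hker Y).2 hY, ?_⟩
      refine (map_add (lt E p) X Y).symm.trans ?_
      rw [h2]
      exact lt_ltInv (E := E) p w
  · exact fun h => gr.br_eq_zero_of_canBeMadePrincipal hmk h
  · exact gr.canBeMadePrincipal Φ hΦ hΦs hπ hqj hκκ hjκ hκj hqκ hκv

end IsGrading

end CarnotFoliation

end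

/-! ### Vector fields expressed in the left-invariant frame. -/

noncomputable section

namespace CarnotFoliation

namespace IsGrading

variable {E : Type*} [NormedAddCommGroup E] [NormedSpace ℝ E] [FiniteDimensional ℝ E]
    {G : Type*} [TopologicalSpace G] [T2Space G] [SimplyConnectedSpace G] [ChartedSpace E G]
    [Group G] [LieGroup 𝓘(ℝ, E) ∞ G]
    {r : ℕ} {layer : ℕ → Submodule ℝ E}

/-- Solving the formula for the left derivative of `coord` exhibits the left trivialization through
globally defined smooth maps, from which its smoothness is read off. -/
theorem ltInv_eq (gr : IsGrading E G r layer) (x : G) : ltInv E x =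
    (gr.δinv ∘L Ad E x⁻¹) ∘L (mfderiv 𝓘(ℝ, E) 𝓘(ℝ, E) gr.coord x : E →L[ℝ] E) := by
  refine ContinuousLinearMap.ext fun v => ?_
  have h1 := mfderiv_lt (gr.mdifferentiableAt_coord x) (ltInv E x v)
  rw [lt_ltInv, ld_coord] at h1
  have h2 := congrArg (fun w => gr.δinv (Ad E x⁻¹ w)) h1
  simp only [ContinuousLinearMap.comp_apply, Ad_inv_Ad, δinv_δ] at h2
  exact h2.symm

/-- The left trivialization of the tangent bundle, read in the trivialization at `x₀`. -/
def mcLocal (x₀ x : G) : E →L[ℝ] E :=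
  ltInv E x ∘L ((trivializationAt E (TangentSpace 𝓘(ℝ, E)) x₀).symmL ℝ x : E →L[ℝ] E)

theorem contMDiffAt_mcLocal (gr : IsGrading E G r layer) (x₀ : G) :
    ContMDiffAt 𝓘(ℝ, E) 𝓘(ℝ, E →L[ℝ] E) ∞ (mcLocal (E := E) x₀) x₀ := by
  have h1 := ContMDiffAt.mfderiv_const (m := ∞) (gr.contMDiff_coord x₀) le_rfl
  have h2 : ContMDiffAt 𝓘(ℝ, E) 𝓘(ℝ, E →L[ℝ] E) ∞ (fun x : G => gr.δinv ∘L Ad E x⁻¹) x₀ :=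
    contMDiffAt_const.clm_comp (contMDiff_Ad.comp (contMDiff_inv 𝓘(ℝ, E) ∞)).contMDiffAt
  have h3 := h2.clm_comp h1
  convert h3 using 1
  ext1 x
  rw [mcLocal, gr.ltInv_eq]
  simp only [inTangentCoordinates, ContinuousLinearMap.inCoordinates,
    TangentBundle.continuousLinearMapAt_model_space]
  rfl

theorem mcLocal_apply {x₀ x : G} (hx : x ∈ (trivializationAt E (TangentSpace 𝓘(ℝ, E)) x₀).baseSet)
    (v : TangentSpace 𝓘(ℝ, E) x) :
    mcLocal x₀ x (trivializationAt E (TangentSpace 𝓘(ℝ, E)) x₀ ⟨x, v⟩).2 = ltInv E x v := by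
  have h := (trivializationAt E (TangentSpace 𝓘(ℝ, E)) x₀).symmL_continuousLinearMapAt
    (R := ℝ) hx v
  have h2 : (trivializationAt E (TangentSpace 𝓘(ℝ, E)) x₀ ⟨x, v⟩).2 =
      (trivializationAt E (TangentSpace 𝓘(ℝ, E)) x₀).continuousLinearMapAt ℝ x v := by
    rw [Bundle.Trivialization.continuousLinearMapAt_apply, Bundle.Trivialization.linearMapAt_apply, if_pos hx]
  rw [h2]
  exact congrArg (ltInv E x) h

theorem baseSet_mem_nhds (x₀ : G) :
    (trivializationAt E (TangentSpace 𝓘(ℝ, E)) x₀).baseSet ∈ 𝓝 x₀ :=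
  (trivializationAt E (TangentSpace 𝓘(ℝ, E)) x₀).open_baseSet.mem_nhds
    (FiberBundle.mem_baseSet_trivializationAt' x₀)

/-- The components of a vector field in the left-invariant frame. -/
def comp (Y : Π x : G, TangentSpace 𝓘(ℝ, E) x) (x : G) : E := ltInv E x (Y x)

theorem comp_eventuallyEq (Y : Π x : G, TangentSpace 𝓘(ℝ, E) x) (x₀ : G) :
    comp Y =ᶠ[𝓝 x₀] fun x =>
      mcLocal x₀ x (trivializationAt E (TangentSpace 𝓘(ℝ, E)) x₀ ⟨x, Y x⟩).2 := by
  filter_upwards [baseSet_mem_nhds (E := E) x₀] with x hx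
  exact (mcLocal_apply hx (Y x)).symm

theorem mdifferentiableAt_comp (gr : IsGrading E G r layer)
    {Y : Π x : G, TangentSpace 𝓘(ℝ, E) x} {x₀ : G} (hY : MDiffAt (T% Y) x₀) :
    MDifferentiableAt 𝓘(ℝ, E) 𝓘(ℝ, E) (comp Y) x₀ := by
  rw [mdifferentiableAt_section] at hY
  exact (((gr.contMDiffAt_mcLocal x₀).mdifferentiableAt (by simp)).clm_apply hY).congr_of_eventuallyEq
    (comp_eventuallyEq Y x₀)

theorem mcLocal_isInvertible {x₀ x : G}
    (hx : x ∈ (trivializationAt E (TangentSpace 𝓘(ℝ, E)) x₀).baseSet) :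
    (mcLocal (E := E) x₀ x).IsInvertible := by
  let A : E →L[ℝ] E := (trivializationAt E (TangentSpace 𝓘(ℝ, E)) x₀).continuousLinearMapAt ℝ x
  refine ContinuousLinearMap.IsInvertible.of_inverse (g := A ∘L lt E x) ?_ ?_
  · refine ContinuousLinearMap.ext fun v => ?_
    have h := (trivializationAt E (TangentSpace 𝓘(ℝ, E)) x₀).symmL_continuousLinearMapAt
      (R := ℝ) hx (lt E x v)
    exact (congrArg (ltInv E x) h).trans (ltInv_lt x v)
  · refine ContinuousLinearMap.ext fun v => ?_
    have h := (trivializationAt E (TangentSpace 𝓘(ℝ, E)) x₀).continuousLinearMapAt_symmL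
      (R := ℝ) hx v
    exact (congrArg A (lt_ltInv (E := E) x _)).trans h

/-- A vector field with smooth components is smooth. -/
theorem contMDiff_of_comp (gr : IsGrading E G r layer)
    {Y : Π x : G, TangentSpace 𝓘(ℝ, E) x} (hY : ContMDiff 𝓘(ℝ, E) 𝓘(ℝ, E) ∞ (comp Y)) :
    CMDiff ∞ (T% Y) := by
  have := FiniteDimensional.complete ℝ E
  intro x₀
  rw [Bundle.contMDiffAt_section]
  have h1 : ContMDiffAt 𝓘(ℝ, E) 𝓘(ℝ, E →L[ℝ] E) ∞
      (fun x => (mcLocal (E := E) x₀ x).inverse) x₀ :=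
    ContMDiffAt.comp (I' := 𝓘(ℝ, E →L[ℝ] E)) (g := ContinuousLinearMap.inverse)
      (f := mcLocal (E := E) x₀) x₀
      (mcLocal_isInvertible (mem_of_mem_nhds (baseSet_mem_nhds (E := E) x₀))).contDiffAt_map_inverse.contMDiffAt
      (gr.contMDiffAt_mcLocal x₀)
  refine (h1.clm_apply (hY x₀)).congr_of_eventuallyEq ?_
  filter_upwards [baseSet_mem_nhds (E := E) x₀, comp_eventuallyEq Y x₀] with x hx hx'
  rw [hx']
  obtain ⟨A, hA⟩ := mcLocal_isInvertible hx
  rw [← hA, ContinuousLinearMap.inverse_equiv]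
  simp

theorem comp_liv (X : E) : comp (liv G X) = fun _ => X :=
  funext fun x => ltInv_lt x X

theorem contMDiff_liv_infty (gr : IsGrading E G r layer) (X : E) : CMDiff ∞ (T% (liv G X)) :=
  gr.contMDiff_of_comp (by rw [comp_liv]; exact contMDiff_const)

/-- The bracket of vector fields in the left-invariant frame. -/
theorem comp_mlieBracket (gr : IsGrading E G r layer) {X Y : Π x : G, TangentSpace 𝓘(ℝ, E) x}
    {x : G} (hX : MDiffAt (T% X) x) (hY : MDiffAt (T% Y) x) :
    comp (VectorField.mlieBracket 𝓘(ℝ, E) X Y) x =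
      ld (comp Y) x (comp X x) - ld (comp X) x (comp Y x) + br E G (comp X x) (comp Y x) := by
  have := FiniteDimensional.complete ℝ E
  -- The commutator identity is tested on `coord`: its left derivative is injective, so the bracket
  -- itself can be recovered from the result.
  have h1 := mfderiv_mlieBracket (gr.contMDiff_coord x) hX hY
  have hv : ∀ (Z : Π x : G, TangentSpace 𝓘(ℝ, E) x),
      vfDeriv gr.coord Z = fun y => ld gr.coord y (comp Z y) := fun Z => funext fun y => by
    have := mfderiv_lt (gr.mdifferentiableAt_coord y) (comp Z y)
    rw [← this]
    exact congrArg (mfderiv 𝓘(ℝ, E) 𝓘(ℝ, E) gr.coord y : E →L[ℝ] E)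
      (lt_ltInv (E := E) y (Z y)).symm
  have hA : MDifferentiableAt 𝓘(ℝ, E) 𝓘(ℝ, E →L[ℝ] E) (ld (E := E) gr.coord) x :=
    (contMDiff_ld gr.contMDiff_coord).mdifferentiable (by simp) x
  have hd : ∀ {Z W : Π x : G, TangentSpace 𝓘(ℝ, E) x}, MDiffAt (T% Z) x →
      vfDeriv (vfDeriv gr.coord Z) W x =
        ld gr.coord x (ld (comp Z) x (comp W x)) +
          ld (ld gr.coord) x (comp W x) (comp Z x) := by
    intro Z W hZ
    have hZ' := gr.mdifferentiableAt_comp hZ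
    rw [hv Z]
    have h2 : MDifferentiableAt 𝓘(ℝ, E) 𝓘(ℝ, E) (fun y => ld (E := E) gr.coord y (comp Z y)) x :=
      hA.clm_apply hZ'
    have h3 := mfderiv_lt h2 (comp W x)
    have h4 : vfDeriv (fun y => ld (E := E) gr.coord y (comp Z y)) W x =
        ld (fun y => ld (E := E) gr.coord y (comp Z y)) x (comp W x) := by
      rw [← h3]
      exact congrArg (mfderiv 𝓘(ℝ, E) 𝓘(ℝ, E) (fun y => ld (E := E) gr.coord y (comp Z y)) x : E →L[ℝ] E)
        (lt_ltInv (E := E) x (W x)).symm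
    have h5 := ((hasFDerivAt_ld hA).clm_apply (hasFDerivAt_ld hZ')).fderiv
    rw [h4, ld, h5]
    simp [ltChart_basePt]
  rw [hd hX, hd hY, congrFun (hv _) x] at h1
  refine gr.ld_coord_injective x ?_
  rw [h1, map_add, map_sub, ← ld_ld_comm (gr.contMDiff_coord x)]
  abel

end IsGrading

end CarnotFoliation

end

/-! ### Necessity of the bracket condition for a totally geodesic foliation. -/

noncomputable section

namespace CarnotFoliation

namespace IsGrading

variable {E : Type*} [NormedAddCommGroup E] [NormedSpace ℝ E] [FiniteDimensional ℝ E]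
    {G : Type*} [TopologicalSpace G] [T2Space G] [SimplyConnectedSpace G] [ChartedSpace E G]
    [Group G] [LieGroup 𝓘(ℝ, E) ∞ G]
    {r : ℕ} {layer : ℕ → Submodule ℝ E}

theorem contMDiff_inner_liv (gr : IsGrading E G r layer)
    (g : Bundle.ContMDiffRiemannianMetric 𝓘(ℝ, E) ∞ E (fun x : G ↦ TangentSpace 𝓘(ℝ, E) x))
    (Y Z : E) :
    ContMDiff 𝓘(ℝ, E) 𝓘(ℝ, ℝ) ∞ (fun x => g.inner x (liv G Y x) (liv G Z x)) := by
  intro x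
  have h : ContMDiffAt 𝓘(ℝ, E) (𝓘(ℝ, E).prod 𝓘(ℝ)) ∞
      (fun m => Bundle.TotalSpace.mk' ℝ (E := Bundle.Trivial G ℝ) m
        (g.inner m (liv G Y m) (liv G Z m))) x := by
    apply ContMDiffAt.clm_bundle_apply₂ (F₁ := E) (F₂ := E)
    · exact g.contMDiff x
    · exact gr.contMDiff_liv_infty Y x
    · exact gr.contMDiff_liv_infty Z x
  simp only [Bundle.contMDiffAt_totalSpace] at h
  exact h.2

theorem liv_mem_leftTranslate {𝔞 : Submodule ℝ E} {X : E} (hX : X ∈ 𝔞) (x : G) :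
    liv G X x ∈ (leftTranslate (I := 𝓘(ℝ, E)) (G := G) 𝔞 x : Submodule ℝ E) :=
  ⟨X, hX, rfl⟩

theorem mlieBracket_liv (gr : IsGrading E G r layer) (X Y : E) (x : G) :
    VectorField.mlieBracket 𝓘(ℝ, E) (liv G X) (liv G Y) x = liv G (br E G X Y) x := by
  have h := gr.comp_mlieBracket (x := x) ((gr.contMDiff_liv_infty X).mdifferentiable (by simp) x)
    ((gr.contMDiff_liv_infty Y).mdifferentiable (by simp) x)
  rw [comp_liv, comp_liv, ld_const, ld_const] at h
  simp only [zero_apply, sub_zero, zero_add] at h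
  exact (lt_ltInv (E := E) x _).symm.trans (congrArg (lt E x) h)

/-- Differentiate `⟨Y, Z⟩` along `X` and replace `∇_X Y` by `[X, Y] + ∇_Y X`. Differentiating `⟨X,
Z⟩ = 0` along `Y` gives `⟨∇_Y X, Z⟩ = -⟨X, ∇_Y Z⟩`, which is zero because `∇_Y Z` is tangent to the
leaves. -/
theorem ld_inner_liv (gr : IsGrading E G r layer)
    {g : Bundle.ContMDiffRiemannianMetric 𝓘(ℝ, E) ∞ E (fun x : G ↦ TangentSpace 𝓘(ℝ, E) x)}
    {𝔭 𝔨 : Submodule ℝ E}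
    (hort : AreOrthogonal g (leftTranslate (I := 𝓘(ℝ, E)) (G := G) 𝔭)
      (leftTranslate (I := 𝓘(ℝ, E)) (G := G) 𝔨))
    (hgeo : IsTotallyGeodesic g (leftTranslate (I := 𝓘(ℝ, E)) (G := G) 𝔨))
    {X Y Z : E} (hX : X ∈ 𝔭) (hY : Y ∈ 𝔨) (hZ : Z ∈ 𝔨) (x : G) :
    ld (fun y => g.inner y (liv G Y y) (liv G Z y)) x X =
      g.inner x (liv G (br E G X Y) x) (liv G Z x) +
        g.inner x (liv G Y x) (liv G (br E G X Z) x) := by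
  obtain ⟨cov, hcov, htg⟩ := hgeo
  have hs : ∀ (W : E) (x : G), MDiffAt (T% (liv G W)) x := fun W =>
    (gr.contMDiff_liv_infty W).mdifferentiable (by simp)
  have key : ∀ {Y Z : E}, Y ∈ 𝔨 → Z ∈ 𝔨 →
      g.inner x (cov (liv G Y) x (liv G X x)) (liv G Z x) =
        g.inner x (liv G (br E G X Y) x) (liv G Z x) := by
    intro Y Z hY hZ
    have h1 := hcov.torsion_free (liv G X) (liv G Y) x (hs X x) (hs Y x)
    rw [gr.mlieBracket_liv] at h1
    have h2 := hcov.metric (liv G X) (liv G Z) x (liv G Y x) (hs X x) (hs Z x)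
    have h3 : (fun y => g.inner y (liv G X y) (liv G Z y)) = fun _ => (0 : ℝ) :=
      funext fun y => hort y _ (liv_mem_leftTranslate hX y) _ (liv_mem_leftTranslate hZ y)
    rw [h3] at h2
    have h4 := hort x _ (liv_mem_leftTranslate hX x) _
      (htg (liv G Z) (liv G Y) (gr.contMDiff_liv_infty Z) (gr.contMDiff_liv_infty Y)
        (liv_mem_leftTranslate hZ) (liv_mem_leftTranslate hY) x)
    rw [h4, add_zero] at h2
    have h5 : g.inner x (cov (liv G X) x (liv G Y x)) (liv G Z x) = 0 := by
      rw [← h2]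
      exact congrArg (fun A : E →L[ℝ] ℝ => A (liv G Y x))
        (mfderiv_const (I := 𝓘(ℝ, E)) (I' := 𝓘(ℝ, ℝ)) (x := x) (c := (0 : ℝ)))
    rw [← h1, map_sub, sub_apply, h5, sub_zero]
  have h6 := hcov.metric (liv G Y) (liv G Z) x (liv G X x) (hs Y x) (hs Z x)
  rw [key hY hZ, g.symm x (liv G Y x), key hZ hY, g.symm x (liv G (br E G X Z) x)] at h6
  refine Eq.trans ?_ h6
  exact (mfderiv_lt ((gr.contMDiff_inner_liv g Y Z).mdifferentiable (by simp) x) X).symm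

/-- A nilpotent operator that is skew for a positive definite form vanishes. -/
theorem apply_eq_zero_of_skew_of_nilpotent {A : E → E} {b : E → E → ℝ} {q : Submodule ℝ E}
    (hA : ∀ y ∈ q, A y ∈ q) (hb : ∀ y ∈ q, b y y = 0 → y = 0) (hb0 : ∀ y, b y 0 = 0)
    (hskew : ∀ y ∈ q, ∀ z ∈ q, b (A y) z + b y (A z) = 0) (n : ℕ) {y : E} (hy : y ∈ q)
    (hn : A^[n + 1] y = 0) : A y = 0 := by
  induction n generalizing y with
  | zero => exact hn
  | succ n ih =>
    -- Then skewness gives `b (A y) (A y) = -b y (A (A y)) = 0`.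
    have h1 : A (A y) = 0 := ih (hA y hy) hn
    have h2 := hskew y hy (A y) (hA y hy)
    rw [h1, hb0, add_zero] at h2
    exact hb _ (hA y hy) h2

/-- Along the first layer the inner products of vertical left-invariant fields do not change,
because brackets of odd with vertical vectors are horizontal. So these products are constant, and
`ad X` for `X` in `𝔭₂` is a skew nilpotent operator on `𝔨`. -/
theorem br_eq_zero_of_isTotallyGeodesic (gr : IsGrading E G r layer)
    {g : Bundle.ContMDiffRiemannianMetric 𝓘(ℝ, E) ∞ E (fun x : G ↦ TangentSpace 𝓘(ℝ, E) x)}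
    (hort : AreOrthogonal g
      (leftTranslate (I := 𝓘(ℝ, E)) (G := G) (hor r layer : Submodule ℝ E))
      (leftTranslate (I := 𝓘(ℝ, E)) (G := G) (vert r layer : Submodule ℝ E)))
    (hgeo : IsTotallyGeodesic g
      (leftTranslate (I := 𝓘(ℝ, E)) (G := G) (vert r layer : Submodule ℝ E)))
    {X Y : E} (hX : X ∈ horEven r layer) (hY : Y ∈ vert r layer) : br E G X Y = 0 := by
  let b : E → E → ℝ := fun y z => g.inner (1 : G) (liv G y 1) (liv G z 1)
  have hconst : ∀ y ∈ vert r layer, ∀ z ∈ vert r layer, ∀ x : G,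
      ld (E := E) (fun x => g.inner x (liv G y x) (liv G z x)) x = 0 := by
    intro y hy z hz
    refine gr.ld_eq_zero (gr.contMDiff_inner_liv g y z) fun x W hW => ?_
    have hW' := layer_one_le_horOdd layer hW
    rw [gr.ld_inner_liv hort hgeo (horOdd_le_hor r layer hW') hy hz,
      hort x _ (liv_mem_leftTranslate (horOdd_le_hor r layer (gr.br_horOdd_vert hW' hy)) x) _
        (liv_mem_leftTranslate hz x), g.symm,
      hort x _ (liv_mem_leftTranslate (horOdd_le_hor r layer (gr.br_horOdd_vert hW' hz)) x) _
        (liv_mem_leftTranslate hy x), add_zero]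
  refine apply_eq_zero_of_skew_of_nilpotent (A := fun y => br E G X y) (b := b)
    (fun y hy => gr.br_horEven_vert hX hy) (fun y _ hy => ?_) (fun y => ?_) (fun y hy z hz => ?_)
    r hY ?_
  · by_contra h
    have h1 : liv G y (1 : G) ≠ 0 := fun h0 => h (by
      rw [← ltInv_lt (E := E) (1 : G) y]
      exact (congrArg (ltInv E (1 : G)) h0).trans (map_zero _))
    exact (g.pos 1 _ h1).ne' hy
  · have : liv G (0 : E) (1 : G) = 0 := map_zero (lt E (1 : G))
    simp only [b, this, map_zero]
  · rw [← gr.ld_inner_liv hort hgeo (horEven_le_hor r layer hX) hy hz 1, hconst y hy z hz 1]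
    rfl
  -- Each bracket moves one step down the filtration, so `r + 1` brackets leave the grading.
  · have h1 : ∀ n, (fun y => br E G X y)^[n] Y ∈ filt layer n := fun n => by
      induction n with
      | zero => exact gr.part_mono (fun _ _ _ _ => Nat.zero_le _) hY
      | succ n ih =>
        rw [Function.iterate_succ_apply']
        exact gr.br_mem_filt X ih
    have h2 := h1 (r + 1)
    rwa [gr.filt_eq_bot (Nat.lt_succ_self r), Submodule.mem_bot] at h2

end IsGrading

end CarnotFoliation

end

/-! ### Inner products and the Koszul formula. -/

noncomputable section

namespace CarnotFoliation

section LinearAlgebra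

variable {E : Type*} [NormedAddCommGroup E] [NormedSpace ℝ E] [FiniteDimensional ℝ E]

/-- An inner product, as a continuous bilinear form. -/
structure IsInnerForm (B : E →L[ℝ] E →L[ℝ] ℝ) : Prop where
  symm : ∀ x y, B x y = B y x
  pos : ∀ x, x ≠ 0 → 0 < B x x

theorem IsInnerForm.eq_zero {B : E →L[ℝ] E →L[ℝ] ℝ} (hB : IsInnerForm B) {x : E}
    (h : ∀ z, B x z = 0) : x = 0 := by
  by_contra hx
  exact (hB.pos x hx).ne' (h x)

/-- Riesz representation: positivity makes `B` injective into the dual, hence an isomorphism by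
equality of dimensions. -/
theorem IsInnerForm.exists_apply_eq {B : E →L[ℝ] E →L[ℝ] ℝ} (hB : IsInnerForm B)
    (K : E →L[ℝ] E →L[ℝ] E →L[ℝ] ℝ) : ∃ Γ : E →L[ℝ] E →L[ℝ] E, ∀ x y z, B (Γ x y) z = K x y z := by
  have hinj : Function.Injective B.toLinearMap :=
    (injective_iff_map_eq_zero B.toLinearMap).2 fun x hx =>
      hB.eq_zero fun z => congrArg (fun A : E →L[ℝ] ℝ => A z) hx
  have hrank : Module.finrank ℝ E = Module.finrank ℝ (E →L[ℝ] ℝ) := by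
    rw [← (LinearMap.toContinuousLinearMap (𝕜 := ℝ) (E := E) (F' := ℝ)).finrank_eq]
    exact (Subspace.dual_finrank_eq (K := ℝ) (V := E)).symm
  let J : E ≃L[ℝ] (E →L[ℝ] ℝ) :=
    (LinearMap.linearEquivOfInjective B.toLinearMap hinj hrank).toContinuousLinearEquiv
  have hJ : ∀ x, J x = B x := fun _ => rfl
  refine ⟨(ContinuousLinearMap.compL ℝ E (E →L[ℝ] ℝ) E
    (J.symm : (E →L[ℝ] ℝ) →L[ℝ] E)) ∘L K, fun x y z => ?_⟩
  rw [← hJ]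
  simp

/-- The connection form of a left-invariant metric, defined by the Koszul formula. -/
theorem IsInnerForm.exists_koszul {B : E →L[ℝ] E →L[ℝ] ℝ} (hB : IsInnerForm B)
    (c : E →L[ℝ] E →L[ℝ] E) : ∃ Γ : E →L[ℝ] E →L[ℝ] E, ∀ x y z,
      2 * B (Γ x y) z = B (c x y) z - B x (c y z) - B y (c x z) := by
  -- `Λ x y` represents `z ↦ B x (c y z)`; its flip yields the third Koszul term.
  obtain ⟨Λ, hΛ⟩ := hB.exists_apply_eq ((ContinuousLinearMap.compL ℝ E E ℝ).bilinearComp B c)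
  refine ⟨(2 : ℝ)⁻¹ • (c - Λ - Λ.flip), fun x y z => ?_⟩
  simp [hΛ]

theorem exists_isInnerForm (E : Type*) [NormedAddCommGroup E] [NormedSpace ℝ E]
    [FiniteDimensional ℝ E] : ∃ B : E →L[ℝ] E →L[ℝ] ℝ, IsInnerForm B := by
  let T : E →L[ℝ] EuclideanSpace ℝ (Fin (Module.finrank ℝ E)) := (toEuclidean (E := E))
  refine ⟨(innerSL ℝ).bilinearComp T T, fun x y => ?_, fun x hx => ?_⟩
  · simp only [ContinuousLinearMap.bilinearComp_apply, innerSL_apply_apply]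
    exact real_inner_comm _ _
  · simp only [ContinuousLinearMap.bilinearComp_apply, innerSL_apply_apply]
    exact real_inner_self_pos.2 fun h => hx ((toEuclidean (E := E)).map_eq_zero_iff.1 h)

/-- On the compact unit sphere `v ↦ B v v` attains a positive minimum, so `B v v < 1` bounds the
norm of `v`. -/
theorem IsInnerForm.isVonNBounded {B : E →L[ℝ] E →L[ℝ] ℝ} (hB : IsInnerForm B) :
    Bornology.IsVonNBounded ℝ {v : E | B v v < 1} := by
  rcases subsingleton_or_nontrivial E with hE | hE
  · exact (NormedSpace.isVonNBounded_iff ℝ).2 (Set.subsingleton_of_subsingleton.finite.isBounded)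
  have hc : Continuous fun v : E => B v v := by fun_prop
  obtain ⟨u, hu, hmin⟩ := (isCompact_sphere (0 : E) 1).exists_isMinOn
    (NormedSpace.sphere_nonempty.2 zero_le_one) hc.continuousOn
  have hu0 : u ≠ 0 := fun h => by simp [h] at hu
  have hpos := hB.pos u hu0
  refine (NormedSpace.isVonNBounded_iff ℝ).2 (isBounded_iff_forall_norm_le.2
    ⟨1 + (B u u)⁻¹, fun v hv => ?_⟩)
  rcases eq_or_ne v 0 with rfl | hv0
  · rw [norm_zero]; positivity
  have hn : 0 < ‖v‖ := norm_pos_iff.2 hv0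
  have h1 : B u u ≤ B (‖v‖⁻¹ • v) (‖v‖⁻¹ • v) := hmin (by simp [norm_smul, hn.ne'])
  simp only [map_smul, smul_apply, smul_eq_mul] at h1
  have hv' : B v v < 1 := hv
  have h2 : ‖v‖ ^ 2 * B u u ≤ B v v := by
    calc ‖v‖ ^ 2 * B u u ≤ ‖v‖ ^ 2 * (‖v‖⁻¹ * (‖v‖⁻¹ * B v v)) := by gcongr
      _ = B v v := by field_simp
  have h3 : ‖v‖ ^ 2 ≤ (B u u)⁻¹ := by
    rw [← one_div, le_div_iff₀ hpos]; linarith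
  nlinarith [inv_pos.2 hpos]

end LinearAlgebra

end CarnotFoliation

end

/-! ### Sufficiency: left-invariant metrics and their Levi-Civita connections. -/

noncomputable section

namespace CarnotFoliation

namespace IsGrading

variable {E : Type*} [NormedAddCommGroup E] [NormedSpace ℝ E] [FiniteDimensional ℝ E]
    {G : Type*} [TopologicalSpace G] [T2Space G] [SimplyConnectedSpace G] [ChartedSpace E G]
    [Group G] [LieGroup 𝓘(ℝ, E) ∞ G]
    {r : ℕ} {layer : ℕ → Submodule ℝ E}

/-- The left-invariant bilinear form on the tangent bundle with value `B` at `1`. -/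
def leftInner (B : E →L[ℝ] E →L[ℝ] ℝ) (x : G) :
    TangentSpace 𝓘(ℝ, E) x →L[ℝ] TangentSpace 𝓘(ℝ, E) x →L[ℝ] ℝ :=
  (B.bilinearComp (ltInv E x) (ltInv E x) : E →L[ℝ] E →L[ℝ] ℝ)

theorem leftInner_apply (B : E →L[ℝ] E →L[ℝ] ℝ) (x : G) (v w : TangentSpace 𝓘(ℝ, E) x) :
    leftInner B x v w = B (ltInv E x v) (ltInv E x w) := rfl

theorem ltInv_eq_zero_iff {x : G} {v : E} : ltInv E x v = 0 ↔ v = 0 := by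
  refine ⟨fun h => ?_, fun h => by rw [h, map_zero]⟩
  rw [← lt_ltInv (E := E) x v, h, map_zero]

set_option maxSynthPendingDepth 3 in
theorem contMDiff_leftInner (gr : IsGrading E G r layer) (B : E →L[ℝ] E →L[ℝ] ℝ) :
    ContMDiff 𝓘(ℝ, E) (𝓘(ℝ, E).prod 𝓘(ℝ, E →L[ℝ] E →L[ℝ] ℝ)) ∞
      (fun x : G => Bundle.TotalSpace.mk' (E →L[ℝ] E →L[ℝ] ℝ)
        (E := fun x : G => TangentSpace 𝓘(ℝ, E) x →L[ℝ] TangentSpace 𝓘(ℝ, E) x →L[ℝ] ℝ)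
        x (leftInner B x)) := by
  intro x₀
  refine (contMDiffAt_hom_bundle _).2 ⟨contMDiffAt_id, ?_⟩
  have hm := gr.contMDiffAt_mcLocal (G := G) x₀
  -- In a local trivialization the metric is `B` with `mcLocal` inserted in both slots; flipping
  -- before and after reduces the second slot to a composition.
  let Φ : (E →L[ℝ] E →L[ℝ] ℝ) → (E →L[ℝ] E →L[ℝ] ℝ) := ContinuousLinearMap.flip
  have hΦ' : ContDiff ℝ ∞ Φ := (ContinuousLinearMap.flipₗᵢ ℝ E E ℝ).contDiff
  have hΦ : ∀ {f : G → E →L[ℝ] E →L[ℝ] ℝ}, ContMDiffAt 𝓘(ℝ, E) 𝓘(ℝ, E →L[ℝ] E →L[ℝ] ℝ) ∞ f x₀ →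
      ContMDiffAt 𝓘(ℝ, E) 𝓘(ℝ, E →L[ℝ] E →L[ℝ] ℝ) ∞ (fun x => Φ (f x)) x₀ := fun hf =>
    ContMDiffAt.comp (I' := 𝓘(ℝ, E →L[ℝ] E →L[ℝ] ℝ)) (g := Φ) x₀ hΦ'.contMDiff.contMDiffAt hf
  have h1 : ContMDiffAt 𝓘(ℝ, E) 𝓘(ℝ, E →L[ℝ] E →L[ℝ] ℝ) ∞
      (fun x => Φ (Φ (B ∘L mcLocal x₀ x) ∘L mcLocal x₀ x)) x₀ :=
    hΦ ((hΦ (contMDiffAt_const.clm_comp hm)).clm_comp hm)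
  refine h1.congr_of_eventuallyEq ?_
  filter_upwards [baseSet_mem_nhds (E := E) x₀] with x hx
  refine ContinuousLinearMap.ext fun v => ContinuousLinearMap.ext fun w => ?_
  refine (inCoordinates_apply_eq₂ hx hx (Set.mem_univ _)).trans ?_
  have hs : ∀ u : E, mcLocal x₀ x u =
      ltInv E x ((trivializationAt E (TangentSpace 𝓘(ℝ, E)) x₀).symm x u) := fun u =>
    congrArg (ltInv E x) (Bundle.Trivialization.symmL_apply _ hx u)
  simp [Φ, hs, leftInner_apply]

/-- The left-invariant Riemannian metric with value `B` at `1`. -/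
def leftMetric (gr : IsGrading E G r layer) {B : E →L[ℝ] E →L[ℝ] ℝ} (hB : IsInnerForm B) :
    Bundle.ContMDiffRiemannianMetric 𝓘(ℝ, E) ∞ E (fun x : G ↦ TangentSpace 𝓘(ℝ, E) x) where
  inner x := leftInner B x
  symm x v w := hB.symm _ _
  pos x v hv := hB.pos _ fun h => hv ((ltInv_eq_zero_iff (E := E) (x := x)).1 h)
  isVonNBounded x := by
    have h : IsInnerForm (B.bilinearComp (ltInv E x) (ltInv E x)) :=
      ⟨fun v w => hB.symm _ _, fun v hv => hB.pos _ fun h => hv ((ltInv_eq_zero_iff (E := E) (x := x)).1 h)⟩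
    exact h.isVonNBounded
  contMDiff := gr.contMDiff_leftInner B

theorem mfderiv_eq_ld {F : Type*} [NormedAddCommGroup F] [NormedSpace ℝ F] {f : G → F} {x : G}
    (hf : MDifferentiableAt 𝓘(ℝ, E) 𝓘(ℝ, F) f x) (v : E) :
    (mfderiv 𝓘(ℝ, E) 𝓘(ℝ, F) f x : E →L[ℝ] F) v = ld f x (ltInv E x v) := by
  refine Eq.trans ?_ (mfderiv_lt hf (ltInv E x v))
  exact congrArg (mfderiv 𝓘(ℝ, E) 𝓘(ℝ, F) f x : E →L[ℝ] F) (lt_ltInv (E := E) x v).symm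

/-- The connection with connection form `Γ` in the left-invariant frame. -/
def leftCov (gr : IsGrading E G r layer) (Γ : E →L[ℝ] E →L[ℝ] E) :
    CovariantDerivative 𝓘(ℝ, E) E (fun x : G ↦ TangentSpace 𝓘(ℝ, E) x) where
  toFun Y x := (lt E x ∘L (ld (comp Y) x + Γ.flip (comp Y x)) ∘L ltInv E x : E →L[ℝ] E)
  isCovariantDerivativeOnUniv :=
    { add := fun {Y Y' : Π x : G, TangentSpace 𝓘(ℝ, E) x} {x : G} hY hY' _ => by
        have h0 : comp (Y + Y') = fun y : G => (comp Y y + comp Y' y : E) :=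
          funext fun x => map_add (ltInv E x) (Y x) (Y' x)
        have h1 := ((hasFDerivAt_ld (gr.mdifferentiableAt_comp hY)).add
          (hasFDerivAt_ld (gr.mdifferentiableAt_comp hY'))).fderiv
        have h2 : ld (E := E) (comp (Y + Y')) x = ld (comp Y) x + ld (comp Y') x := by
          rw [h0]; exact h1
        refine ContinuousLinearMap.ext fun v => ?_
        change lt E x (ld (comp (Y + Y')) x (ltInv E x v) + Γ (ltInv E x v) (comp (Y + Y') x)) =
          lt E x (ld (comp Y) x (ltInv E x v) + Γ (ltInv E x v) (comp Y x)) +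
          lt E x (ld (comp Y') x (ltInv E x v) + Γ (ltInv E x v) (comp Y' x))
        rw [h2, h0]
        simp only [add_apply, map_add]
        abel
      leibniz := fun {Y : Π x : G, TangentSpace 𝓘(ℝ, E) x} {f : G → ℝ} {x : G} hY hf _ => by
        have h0 : comp (f • Y) = fun y : G => (f y • comp Y y : E) :=
          funext fun x => map_smul (ltInv E x) (f x) (Y x)
        have h1 := ((hasFDerivAt_ld hf).smul
          (hasFDerivAt_ld (gr.mdifferentiableAt_comp hY))).fderiv
        have h2 : ld (E := E) (comp (f • Y)) x =
            f x • ld (comp Y) x + (ld f x).smulRight (comp Y x) := by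
          rw [h0]; refine Eq.trans h1 ?_; simp [ltChart_basePt]
        refine ContinuousLinearMap.ext fun v => ?_
        let A : E →L[ℝ] ℝ := mfderiv 𝓘(ℝ, E) 𝓘(ℝ, ℝ) f x
        let y : E := Y x
        have hA : A v = ld f x (ltInv E x v) := mfderiv_eq_ld hf v
        have hy : y = lt E x (comp Y x) := (lt_ltInv (E := E) x y).symm
        change lt E x (ld (comp (f • Y)) x (ltInv E x v) + Γ (ltInv E x v) (comp (f • Y) x)) =
          f x • lt E x (ld (comp Y) x (ltInv E x v) + Γ (ltInv E x v) (comp Y x)) +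
            A v • y
        rw [hA, hy, h2, h0]
        simp only [add_apply, smul_apply, ContinuousLinearMap.smulRight_apply, map_add, map_smul,
          smul_add]
        abel }

/-- In the left-invariant frame the metric is the constant form `B` and the covariant derivative is
the ordinary one plus `Γ`. Thus parallelism of the metric is skewness of `Γ x`, and the bracket term
of `comp_mlieBracket` matches the torsion condition. -/
theorem isLeviCivita_leftCov (gr : IsGrading E G r layer) {B : E →L[ℝ] E →L[ℝ] ℝ}
    (hB : IsInnerForm B) {Γ : E →L[ℝ] E →L[ℝ] E} (hskew : ∀ x y z, B (Γ x y) z + B y (Γ x z) = 0)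
    (htor : ∀ x y, Γ x y - Γ y x = br E G x y) :
    IsLeviCivita (gr.leftMetric (G := G) hB) (gr.leftCov Γ) where
  torsion_free X Y x hX hY := by
    refine Eq.trans ?_ (lt_ltInv (E := E) x (VectorField.mlieBracket 𝓘(ℝ, E) X Y x))
    change lt E x (ld (comp Y) x (comp X x) + Γ (comp X x) (comp Y x)) -
      lt E x (ld (comp X) x (comp Y x) + Γ (comp Y x) (comp X x)) =
      lt E x (comp (VectorField.mlieBracket 𝓘(ℝ, E) X Y) x)
    rw [gr.comp_mlieBracket hX hY, ← map_sub, ← htor]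
    congr 1
    abel
  metric Y Z x v hY hZ := by
    have hY' := gr.mdifferentiableAt_comp hY
    have hZ' := gr.mdifferentiableAt_comp hZ
    have h0 : MDifferentiableAt 𝓘(ℝ, E) 𝓘(ℝ, ℝ) (fun y => B (comp Y y) (comp Z y)) x :=
      ((mdifferentiableAt_const (c := B)).clm_apply hY').clm_apply hZ'
    have h1 := ((B.hasFDerivAt.comp (basePt E G) (hasFDerivAt_ld hY')).clm_apply
      (hasFDerivAt_ld hZ')).fderiv
    have h2 : ∀ w, ld (fun y => B (comp Y y) (comp Z y)) x w =
        B (ld (comp Y) x w) (comp Z x) + B (comp Y x) (ld (comp Z) x w) := fun w => by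
      refine (congrArg (fun A : E →L[ℝ] ℝ => A w) h1).trans ?_
      simp [ltChart_basePt, add_comm]
    refine (mfderiv_eq_ld h0 v).trans ?_
    rw [h2]
    change _ = B (ltInv E x (lt E x (ld (comp Y) x (ltInv E x v) + Γ (ltInv E x v) (comp Y x))))
        (comp Z x) +
      B (comp Y x) (ltInv E x (lt E x (ld (comp Z) x (ltInv E x v) + Γ (ltInv E x v) (comp Z x))))
    rw [ltInv_lt, ltInv_lt, map_add, map_add, add_apply]
    linarith [hskew (ltInv E x v) (comp Y x) (comp Z x)]

theorem ld_mem_of_forall_mem {f : G → E} {q : Submodule ℝ E} {x : G}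
    (hf : MDifferentiableAt 𝓘(ℝ, E) 𝓘(ℝ, E) f x) (P : E →L[ℝ] E) (hP : ∀ y, P y ∈ q)
    (hP' : ∀ y ∈ q, P y = y) (h : ∀ x, f x ∈ q) (v : E) : ld f x v ∈ q := by
  have h1 := ld_clm_comp P hf
  have h2 : (fun x => P (f x)) = f := funext fun x => hP' _ (h x)
  rw [h2] at h1
  rw [h1]
  exact hP _

/-- An inner product for which `𝔭₁ ⊕ 𝔭₂` and `𝔨` are orthogonal. -/
theorem exists_isInnerForm_part (gr : IsGrading E G r layer) (S : Set ℕ) :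
    ∃ B : E →L[ℝ] E →L[ℝ] ℝ, IsInnerForm B ∧
      ∀ x ∈ part layer Sᶜ, ∀ y ∈ part layer S, B x y = 0 := by
  obtain ⟨s, hs⟩ := exists_isInnerForm E
  refine ⟨s.bilinearComp (gr.proj S) (gr.proj S) + s.bilinearComp (gr.proj Sᶜ) (gr.proj Sᶜ),
    ⟨fun x y => ?_, fun x hx => ?_⟩, fun x hx y hy => ?_⟩
  · simp only [add_apply, ContinuousLinearMap.bilinearComp_apply]
    rw [hs.symm (gr.proj S x), hs.symm (gr.proj Sᶜ x)]
  · simp only [add_apply, ContinuousLinearMap.bilinearComp_apply]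
    have hnn : ∀ z, 0 ≤ s z z := fun z => by
      rcases eq_or_ne z 0 with rfl | hz
      · simp
      · exact (hs.pos z hz).le
    by_cases h : gr.proj S x = 0
    · have h' : gr.proj Sᶜ x ≠ 0 := fun h' => hx (by
        rw [← gr.proj_add_proj_compl S x, h, h', add_zero])
      linarith [hnn (gr.proj S x), hs.pos _ h']
    · linarith [hnn (gr.proj Sᶜ x), hs.pos _ h]
  · have h1 := gr.proj_eq_zero (T := S) (fun k hk _ _ => hk) hx
    have h2 := gr.proj_eq_zero (T := Sᶜ) (fun k hk _ _ h => h hk) hy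
    simp [h1, h2]

/-- Any left-invariant metric with the two summands orthogonal works: its connection form sends `𝔨 ×
𝔨` to `𝔨`, and derivatives of `𝔨`-valued component functions are `𝔨`-valued. -/
theorem exists_isTotallyGeodesic (gr : IsGrading E G r layer)
    (h : ∀ X ∈ horEven r layer, ∀ Y ∈ vert r layer, br E G X Y = 0) :
    ∃ g : Bundle.ContMDiffRiemannianMetric 𝓘(ℝ, E) ∞ E (fun x : G ↦ TangentSpace 𝓘(ℝ, E) x),
      AreOrthogonal g (leftTranslate (I := 𝓘(ℝ, E)) (G := G) (hor r layer : Submodule ℝ E))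
        (leftTranslate (I := 𝓘(ℝ, E)) (G := G) (vert r layer : Submodule ℝ E)) ∧
      IsTotallyGeodesic g
        (leftTranslate (I := 𝓘(ℝ, E)) (G := G) (vert r layer : Submodule ℝ E)) := by
  obtain ⟨B, hB, hort⟩ := gr.exists_isInnerForm_part {k | Even k ∧ r / 2 < k}
  obtain ⟨Γ, hΓ⟩ := hB.exists_koszul (br E G)
  have hskew : ∀ x y z, B (Γ x y) z + B y (Γ x z) = 0 := fun x y z => by
    have h1 := hΓ x y z
    have h2 := hΓ x z y
    rw [br_swap z y, map_neg, hB.symm z] at h2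
    rw [hB.symm y (Γ x z)]
    have h3 := hB.symm z (br E G x y)
    have h4 := hB.symm y (br E G x z)
    linarith
  have htor : ∀ x y, Γ x y - Γ y x = br E G x y := fun x y => by
    refine sub_eq_zero.1 (hB.eq_zero fun z => ?_)
    have h1 := hΓ x y z
    have h2 := hΓ y x z
    rw [br_swap y x, map_neg, neg_apply] at h2
    simp only [map_sub, sub_apply]
    linarith
  have hbr : ∀ y ∈ vert r layer, ∀ x ∈ hor r layer, ∀ z ∈ vert r layer, B z (br E G y x) = 0 := by
    intro y hy x hx z hz
    rw [← horOdd_sup_horEven] at hx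
    obtain ⟨x₁, hx₁, x₂, hx₂, rfl⟩ := Submodule.mem_sup.1 hx
    rw [br_swap, map_neg, hB.symm, map_add, add_apply, h x₂ hx₂ y hy, add_zero,
      hort _ (horOdd_le_hor r layer (gr.br_horOdd_vert hx₁ hy)) z hz, neg_zero]
  have hvv : ∀ y ∈ vert r layer, ∀ z ∈ vert r layer, br E G y z = 0 := fun y hy z hz =>
    gr.br_part_eq_zero (fun i hi j hj _ _ => by have := hi.2; have := hj.2; omega) hy hz
  have hΓv : ∀ y ∈ vert r layer, ∀ z ∈ vert r layer, Γ y z ∈ vert r layer := by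
    intro y hy z hz
    -- Test the Koszul formula against the horizontal component `u` of `Γ y z`: the terms vanish by
    -- `hvv` and `hbr`, leaving `B u u = 0`.
    have h1 : gr.proj {k | Even k ∧ r / 2 < k}ᶜ (Γ y z) = 0 := by
      by_contra hne
      set u := gr.proj {k | Even k ∧ r / 2 < k}ᶜ (Γ y z) with hu
      have hu' : u ∈ hor r layer := gr.proj_mem _ _
      have h2 := hΓ y z u
      rw [hvv y hy z hz, hbr z hz u hu' y hy, hbr y hy u hu' z hz, map_zero, zero_apply] at h2
      have h3 := gr.proj_add_proj_compl {k | Even k ∧ r / 2 < k} (Γ y z)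
      have h4 := hort u hu' _ (gr.proj_mem {k | Even k ∧ r / 2 < k} (Γ y z))
      rw [← h3, ← hu, map_add, add_apply, hB.symm _ u, h4] at h2
      linarith [hB.pos u hne]
    have := gr.mem_compl_of_proj_eq_zero h1
    rwa [compl_compl] at this
  refine ⟨gr.leftMetric hB, fun x u hu v hv => ?_, gr.leftCov Γ,
    gr.isLeviCivita_leftCov hB hskew htor, fun Y Z hY hZ hYv hZv x => ?_⟩
  · exact hort _ (mem_leftTranslate_iff.1 hu) _ (mem_leftTranslate_iff.1 hv)
  · refine ⟨ld (comp Y) x (comp Z x) + Γ (comp Z x) (comp Y x), add_mem ?_ ?_, rfl⟩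
    · exact ld_mem_of_forall_mem (gr.mdifferentiableAt_comp (hY.mdifferentiable (by simp) x))
        (gr.proj {k | Even k ∧ r / 2 < k}) (gr.proj_mem _)
        (fun y hy => gr.proj_of_mem (fun _ hk _ _ => hk) hy)
        (fun x => mem_leftTranslate_iff.1 (hYv x)) _
    · exact hΓv _ (mem_leftTranslate_iff.1 (hZv x)) _ (mem_leftTranslate_iff.1 (hYv x))

end IsGrading

end CarnotFoliation

end

/-! ### Assembly of the two equivalences. -/

theorem mainTheorem8
    {E : Type*} [NormedAddCommGroup E] [NormedSpace ℝ E] [FiniteDimensional ℝ E]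
    {G : Type*} [TopologicalSpace G] [T2Space G] [SecondCountableTopology G]
    [SimplyConnectedSpace G] [ChartedSpace E G] [Group G] [LieGroup 𝓘(ℝ, E) ∞ G]
    (r : ℕ) (layer : ℕ → Submodule ℝ (GroupLieAlgebra 𝓘(ℝ, E) G))
    (hlayer : CarnotFoliation.IsCarnotGrading 𝓘(ℝ, E) G r layer)
    (𝔭₁ 𝔭₂ 𝔨 : Submodule ℝ (GroupLieAlgebra 𝓘(ℝ, E) G))
    (h𝔭₁ : 𝔭₁ = CarnotFoliation.oddPart layer)
    (h𝔭₂ : 𝔭₂ = CarnotFoliation.lowEvenPart r layer)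
    (h𝔨 : 𝔨 = CarnotFoliation.highEvenPart r layer)
    (D V : Π x : G, Submodule ℝ (TangentSpace 𝓘(ℝ, E) x))
    (hD : D = CarnotFoliation.leftTranslate (𝔭₁ ⊔ 𝔭₂))
    (hV : V = CarnotFoliation.leftTranslate 𝔨)
    (K : Subgroup G) (hK : K = CarnotFoliation.connectedSubgroup 𝔨) :
    -- the metric statement
    ((∃ g : Bundle.ContMDiffRiemannianMetric 𝓘(ℝ, E) ∞ E
          (fun x : G ↦ TangentSpace 𝓘(ℝ, E) x),
        CarnotFoliation.AreOrthogonal g D V ∧ CarnotFoliation.IsTotallyGeodesic g V) ↔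
      CarnotFoliation.bracketSpan 𝓘(ℝ, E) G 𝔭₂ 𝔨 = ⊥) ∧
    -- `G ⧸ K` is a smooth manifold for the (unique) structure making `π` a submersion,
    -- `D` is an Ehresmann connection on `π`, and the principal bundle statement holds
    ∃ (m : ℕ) (_ : ChartedSpace (EuclideanSpace ℝ (Fin m)) (G ⧸ K)),
      T2Space (G ⧸ K) ∧
      IsManifold 𝓘(ℝ, EuclideanSpace ℝ (Fin m)) ∞ (G ⧸ K) ∧
      CarnotFoliation.IsSurjectiveSubmersion 𝓘(ℝ, E) 𝓘(ℝ, EuclideanSpace ℝ (Fin m))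
        (QuotientGroup.mk : G → G ⧸ K) ∧
      CarnotFoliation.IsEhresmannConnection 𝓘(ℝ, E) 𝓘(ℝ, EuclideanSpace ℝ (Fin m))
        (QuotientGroup.mk : G → G ⧸ K) D ∧
      (CarnotFoliation.CanBeMadePrincipal 𝓘(ℝ, E) 𝓘(ℝ, EuclideanSpace ℝ (Fin m))
          (QuotientGroup.mk : G → G ⧸ K) D ↔
        CarnotFoliation.bracketSpan 𝓘(ℝ, E) G 𝔭₂ 𝔨 = ⊥) := by
  -- The Lie algebra is the tangent space at `1`, definitionally the model space `E`; the layers are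
  -- reread there.
  let lay : ℕ → Submodule ℝ E := layer
  have gr : CarnotFoliation.IsGrading E G r lay := hlayer.isGrading
  have hp : (𝔭₁ ⊔ 𝔭₂ : Submodule ℝ E) = CarnotFoliation.hor r lay := by
    rw [h𝔭₁, h𝔭₂]
    exact CarnotFoliation.horOdd_sup_horEven (E := E) r lay
  have hD' : D = CarnotFoliation.leftTranslate (I := 𝓘(ℝ, E)) (G := G)
      (CarnotFoliation.hor r lay : Submodule ℝ E) :=
    hD.trans (congrArg (CarnotFoliation.leftTranslate (I := 𝓘(ℝ, E)) (G := G)) hp)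
  have hbr : CarnotFoliation.bracketSpan 𝓘(ℝ, E) G 𝔭₂ 𝔨 = ⊥ ↔
      ∀ X ∈ CarnotFoliation.horEven r lay,
        ∀ Y ∈ CarnotFoliation.vert r lay,
          CarnotFoliation.br E G X Y = 0 := by
    rw [h𝔭₂, h𝔨]
    exact CarnotFoliation.bracketSpan_eq_bot_iff
  rw [h𝔨] at hV hK
  rw [hbr]
  refine ⟨⟨?_, fun h => ?_⟩, gr.exists_chartedSpace_quotient hK hD'⟩
  · rintro ⟨g, hort, hgeo⟩ X hX Y hY
    rw [hD', hV] at hort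
    rw [hV] at hgeo
    exact gr.br_eq_zero_of_isTotallyGeodesic hort hgeo hX hY
  · rw [hD', hV]
    exact gr.exists_isTotallyGeodesic h
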